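/- **Setting.** Let $\mathbb T^3=\mathbb R^3/(2\pi\mathbb Z)^3$ and $u=\sum_{k\in\mathbb Z^3}\widehat u_k e^{ik\cdot x}$, $\|u\|_{H^\sigma}^2=\sum_k(1+|k|^2)^{\sigma}|\widehat u_k|^2$. Let $\mu_s$ be the Gaussian probability measure formally given by $\frac1{\mathcal Z}e^{-\frac12\sum_k(1+|k|^{2s})|\widehat u_k|^2}du$, i.e. the law on $L^2(\mathbb T^3)$ of $\sum_{k}\frac{g_k}{\sqrt{1+|k|^{2s}}}e^{ik\cdot x}$, where the $g_k$ are independent complex Gaussians whose real and imaginary parts are independent standard real Gaussians. Let $\chi\in C_c^\infty(\mathbb R)$ with $\chi=1$ on $[-\frac12,\frac12]$ and $\operatorname{supp}\chi\subset(-1,1)$, let $\underline\chi\in C_c^\infty(\mathbb R^3)$ be real-valued and radial with $\underline\chi=1$ on $[-\frac12,\frac12]^3$ and $\operatorname{supp}\underline\chi\subset\{|x|<1\}$, and put $\chi_R(\cdot)=\chi(\cdot/R)$ for $R>0$, $\underline\chi_N(k)=\underline\chi(k/N)$ for $N\in\mathbb N$, $N\ge1$. Let $0<\delta_0<\frac23$.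 For $\vec k=(k_1,\dots,k_6)\in(\mathbb Z^3)^6$ write $$\psi_{2s}(\vec k)=\sum_{j=1}^6(-1)^{j-1}|k_j|^{2s},\qquad \Omega(\vec k)=\sum_{j=1}^6(-1)^{j-1}|k_j|^{2},\qquad \lambda(\vec k)=\Big(\sum_{j=1}^6|k_j|^2\Big)^{1/2},$$ and, for a finitely supported $m:\mathbb Z^3\to\mathbb R$, $$R_s[m](u)=\frac16\,\mathrm{Im}\sum_{k_1-k_2+k_3-k_4+k_5-k_6=0}\Big(1-\chi\Big(\frac{\Omega(\vec k)}{\lambda(\vec k)^{\delta_0}}\Big)\Big)\frac{\psi_{2s}(\vec k)}{-i\,\Omega(\vec k)}\Big(\prod_{j=1}^6m(k_j)\Big)\widehat u_{k_1}\overline{\widehat u_{k_2}}\widehat u_{k_3}\overline{\widehat u_{k_4}}\widehat u_{k_5}\overline{\widehat u_{k_6}},$$ where the terms with $\Omega(\vec k)=0$ are zero. Set $R_{s,N}(u)=R_s[\underline\chi_N](u)$ and let $R_s(u)=\lim_{M\to\infty}R_s[\mathbf 1_{|k|\le M}](u)$ be the same sum without truncation, summed over the balls $|k_j|\le M$. **Proposition.**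 Let $s\ge10$. There is $\sigma_0<s-\frac32$ such that for every $\sigma\in(\sigma_0,s-\frac32)$ and all $\chi,\underline\chi,\delta_0$ as above the following hold. 1. The limit defining $R_s(u)$ exists for $\mu_s$-almost every $u$. 2. For every $R\ge1$ and $p\in[1,\infty)$ there is a constant $C>0$, independent of $N$, such that for all $N\ge1$ $$\big\|\chi_R(\|u\|_{H^\sigma})\,e^{|R_{s,N}(u)|}\big\|_{L^p(d\mu_s)}\le C.$$ 3. For every $R>0$ and $p\in[1,\infty)$, the functions $\chi_R(\|u\|_{H^\sigma})e^{-R_{s,N}(u)}$, $N\ge1$, and $\chi_R(\|u\|_{H^\sigma})e^{-R_s(u)}$ belong to $L^p(d\mu_s)$, and $$\lim_{N\to\infty}\big\|\chi_R(\|u\|_{H^\sigma})e^{-R_{s,N}(u)}-\chi_R(\|u\|_{H^\sigma})e^{-R_s(u)}\big\|_{L^p(d\mu_s)}=0.$$ -/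

import Mathlib

open MeasureTheory ProbabilityTheory Filter Topology
open scoped ENNReal

noncomputable section

namespace NLSTorus

/-! ## The torus, Fourier modes and Sobolev norms -/

/-- Frequencies `k ∈ ℤ³`. -/
abbrev Freq : Type := Fin 3 → ℤ

/-- The Euclidean length `|k|` of a frequency. -/
def freqNorm (k : Freq) : ℝ := √(∑ i, (k i : ℝ) ^ 2)

/-- The normalized Lebesgue (Haar) measure on `𝕋³`. The torus `ℝ³ / (2πℤ)³` is written in the
coordinate `y = x / (2π) ∈ (ℝ/ℤ)³`, so that the character `e^{i k·x}` is `UnitAddTorus.mFourier k`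
and has frequency `k`. -/
abbrev torusMeasure : Measure (UnitAddTorus (Fin 3)) :=
  Measure.pi fun _ => (AddCircle.haarAddCircle : Measure UnitAddCircle)

/-- Complex valued square integrable functions on `𝕋³`, with the Borel σ-algebra of the norm. -/
abbrev L2Torus : Type := Lp ℂ 2 torusMeasure

instance : MeasurableSpace L2Torus := borel L2Torus

instance : BorelSpace L2Torus := ⟨rfl⟩

/-- The function `x ↦ e^{i k·x}` as an element of `L²(𝕋³)`. -/
def mode (k : Freq) : L2Torus := UnitAddTorus.mFourierLp 2 k

/-- The Fourier coefficient `û_k`, normalized so that `u = ∑ û_k e^{i k·x}`. -/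
def fourierCoeff (u : L2Torus) (k : Freq) : ℂ := UnitAddTorus.mFourierCoeff u k

/-- The norm `‖u‖_{H^σ} = (∑ (1 + |k|²)^σ |û_k|²)^{1/2}`, equal to `∞` if `u ∉ H^σ`. -/
def sobolevNorm (σ : ℝ) (u : L2Torus) : ℝ≥0∞ :=
  (∑' k : Freq, ENNReal.ofReal ((1 + freqNorm k ^ 2) ^ σ * ‖fourierCoeff u k‖ ^ 2)) ^ (1 / 2 : ℝ)

/-! ## The Gaussian measure -/

/-- The law of a standard complex Gaussian `g = X + i Y`, with `X`, `Y` independent standard real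
Gaussians, i.e. the density is `(2π)⁻¹ e^{-|z|²/2}`. -/
def stdComplexGaussian : Measure ℂ :=
  ((gaussianReal 0 1).prod (gaussianReal 0 1)).map Complex.measurableEquivRealProd.symm

/-- The law of an independent family `(g_k)` of standard complex Gaussians. -/
def gaussianFamily : Measure (Freq → ℂ) := Measure.infinitePi fun _ => stdComplexGaussian

/-- The random Fourier series `∑ g_k (1 + |k|^{2s})^{-1/2} e^{i k·x}`, an unconditionally
convergent sum in `L²(𝕋³)` for almost every `g`. -/
def randomSeries (s : ℝ) (g : Freq → ℂ) : L2Torus :=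
  ∑' k : Freq, (g k / ((√(1 + freqNorm k ^ (2 * s)) : ℝ) : ℂ)) • mode k

/-- The Gaussian measure `μ_s`, formally `Z⁻¹ exp (-½ ∑ (1 + |k|^{2s}) |û_k|²) du`: the law of the
random Fourier series. -/
def gaussMeasure (s : ℝ) : Measure L2Torus := gaussianFamily.map (randomSeries s)

/-! ## Cutoff functions -/

/-- A smooth bump function on `ℝ`: equal to `1` on `[-1/2, 1/2]`, with (closed) support contained
in `(-1, 1)`. -/
structure IsBump (χ : ℝ → ℝ) : Prop where
  smooth : ContDiff ℝ (⊤ : ℕ∞) χ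
  eq_one : ∀ x ∈ Set.Icc (-1 / 2 : ℝ) (1 / 2), χ x = 1
  support : tsupport χ ⊆ Set.Ioo (-1) 1

/-- A smooth radial cutoff on `ℝ³`: equal to `1` on the cube `[-1/2, 1/2]³`, with (closed) support
contained in the open unit ball. -/
structure IsRadialCutoff (χ : EuclideanSpace ℝ (Fin 3) → ℝ) : Prop where
  smooth : ContDiff ℝ (⊤ : ℕ∞) χ
  radial : ∀ x y, ‖x‖ = ‖y‖ → χ x = χ y
  eq_one : ∀ x, (∀ i, x i ∈ Set.Icc (-1 / 2 : ℝ) (1 / 2)) → χ x = 1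
  support : tsupport χ ⊆ Metric.ball 0 1

/-- The multiplier `χ_N(k) = χ(k / N)` of the smooth frequency truncation. -/
def smoothTrunc (χ : EuclideanSpace ℝ (Fin 3) → ℝ) (N : ℕ) (k : Freq) : ℝ :=
  χ ((N : ℝ)⁻¹ • WithLp.toLp 2 fun i => (k i : ℝ))

/-- The multiplier `1_{|k| ≤ M}` of the sharp frequency truncation `Π_M`. -/
def sharpTrunc (M : ℕ) (k : Freq) : ℝ := if freqNorm k ≤ M then 1 else 0

/-- `χ_R(‖u‖_{H^σ}) = χ(‖u‖_{H^σ} / R)`, which vanishes if `‖u‖_{H^σ} = ∞`. -/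
def normCutoff (χ : ℝ → ℝ) (R σ : ℝ) (u : L2Torus) : ℝ :=
  if sobolevNorm σ u = ∞ then 0 else χ (R⁻¹ * (sobolevNorm σ u).toReal)

/-! ## The modified energy correction -/

/-- `ψ_{2s}(k⃗) = ∑_{j=1}^6 (-1)^{j-1} |k_j|^{2s}`; the index `j` is shifted by one. -/
def psi (s : ℝ) (k : Fin 6 → Freq) : ℝ :=
  ∑ j : Fin 6, (-1 : ℝ) ^ (j : ℕ) * freqNorm (k j) ^ (2 * s)

/-- The resonant function `Ω(k⃗) = ∑_{j=1}^6 (-1)^{j-1} |k_j|²`. -/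
def Omega (k : Fin 6 → Freq) : ℝ := ∑ j : Fin 6, (-1 : ℝ) ^ (j : ℕ) * freqNorm (k j) ^ 2

/-- `λ(k⃗) = (∑_{j=1}^6 |k_j|²)^{1/2}`. -/
def lam (k : Fin 6 → Freq) : ℝ := √(∑ j : Fin 6, freqNorm (k j) ^ 2)

/-- One term of the sextic sum, with each frequency weighted by `m`. Since `1 - χ(0) = 0`, terms
with `Ω(k⃗) = 0` vanish. -/
def sexticTerm (χ : ℝ → ℝ) (δ₀ s : ℝ) (m : Freq → ℝ) (u : L2Torus) (k : Fin 6 → Freq) : ℂ :=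
  ((1 - χ (Omega k / lam k ^ δ₀) : ℝ) : ℂ) * ((psi s k : ℂ) / (-Complex.I * (Omega k : ℂ))) *
    ((∏ j : Fin 6, m (k j) : ℝ) : ℂ) *
    (fourierCoeff u (k 0) * star (fourierCoeff u (k 1)) *
      fourierCoeff u (k 2) * star (fourierCoeff u (k 3)) *
      fourierCoeff u (k 4) * star (fourierCoeff u (k 5)))

/-- `(1/6) Im ∑_{k_1 - k_2 + k_3 - k_4 + k_5 - k_6 = 0}` of the sextic terms, for a finitely
supported frequency multiplier `m` (so that the sum is finite). -/
def sexticForm (χ : ℝ → ℝ) (δ₀ s : ℝ) (m : Freq → ℝ) (u : L2Torus) : ℝ :=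
  (1 / 6) * (∑' k : {k : Fin 6 → Freq // k 0 - k 1 + k 2 - k 3 + k 4 - k 5 = 0},
    sexticTerm χ δ₀ s m u k).im

/-- The functional `R_{s,N}`. -/
def energyCorrN (χ₃ : EuclideanSpace ℝ (Fin 3) → ℝ) (χ : ℝ → ℝ) (δ₀ s : ℝ) (N : ℕ)
    (u : L2Torus) : ℝ :=
  sexticForm χ δ₀ s (smoothTrunc χ₃ N) u

/-- The functional `R_s`, i.e. the sextic sum without frequency truncation. The series does not
converge absolutely for typical `u`; it is summed over the balls `|k_1|, …, |k_6| ≤ M`, `M → ∞`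
(an arbitrary value where this limit does not exist). -/
def energyCorr (χ : ℝ → ℝ) (δ₀ s : ℝ) (u : L2Torus) : ℝ :=
  limUnder atTop fun M : ℕ => sexticForm χ δ₀ s (sharpTrunc M) u

/-! ## The Gaussian measure is a probability measure -/

instance : IsProbabilityMeasure stdComplexGaussian :=
  Measure.isProbabilityMeasure_map Complex.measurableEquivRealProd.symm.measurable.aemeasurable

instance : IsProbabilityMeasure gaussianFamily := by
  unfold gaussianFamily; infer_instance

lemma summable_weight {s : ℝ} (hs : 3 / 2 < s) :
    Summable fun k : Freq => 1 / (1 + freqNorm k ^ (2 * s)) := by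
  let b := Pi.basisFun ℝ (Fin 3)
  let L : Submodule ℤ (Fin 3 → ℝ) := Submodule.span ℤ (Set.range b)
  have hfr : Module.finrank ℤ L = 3 := by
    rw [Module.finrank_eq_card_basis (b.restrictScalars ℤ)]; simp
  have h1 : Summable fun z : L => ‖z‖ ^ (-(2 * s)) :=
    ZLattice.summable_norm_rpow L _ (by rw [hfr]; push_cast; linarith)
  let e : Freq ≃ L := (b.restrictScalars ℤ).equivFun.symm.toEquiv
  have he : ∀ k i, (e k : Fin 3 → ℝ) i = k i := by
    intro k i
    have h2 := (b.restrictScalars ℤ).repr_sum_self k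
    have h3 : (b.restrictScalars ℤ).repr (e k) i = k i := by
      have : e k = ∑ j, k j • (b.restrictScalars ℤ) j := Module.Basis.equivFun_symm_apply _ _
      rw [this, h2]
    have h4 := b.restrictScalars_repr_apply ℤ (e k) i
    rw [h3] at h4
    simpa [b] using h4.symm
  have h5 := e.summable_iff.mpr h1
  refine Summable.of_norm_bounded_eventually h5 ?_
  have : ∀ᶠ k : Freq in cofinite, k ≠ 0 := by
    simp [Filter.eventually_cofinite]
  filter_upwards [this] with k hk
  have hpos : 0 < ‖e k‖ := by
    rw [norm_pos_iff]
    intro h0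
    apply hk
    funext i
    have := he k i
    rw [h0] at this
    simpa using this.symm
  have hle : ‖e k‖ ≤ freqNorm k := by
    change ‖(e k : Fin 3 → ℝ)‖ ≤ _
    refine (pi_norm_le_iff_of_nonneg (Real.sqrt_nonneg _)).2 fun i => ?_
    rw [he, Real.norm_eq_abs]
    apply Real.abs_le_sqrt
    exact Finset.single_le_sum (f := fun i => (k i : ℝ) ^ 2) (fun _ _ => sq_nonneg _)
      (Finset.mem_univ i)
  have hf : 0 < ‖e k‖ ^ (2 * s) := Real.rpow_pos_of_pos hpos _
  have hmono : ‖e k‖ ^ (2 * s) ≤ freqNorm k ^ (2 * s) :=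
    Real.rpow_le_rpow hpos.le hle (by linarith)
  have hk0 : 0 ≤ freqNorm k ^ (2 * s) := hf.le.trans hmono
  rw [Real.norm_of_nonneg (by positivity), Function.comp_apply, Real.rpow_neg hpos.le,
    one_div]
  exact inv_anti₀ hf (by linarith)

lemma lintegral_stdComplexGaussian :
    ∫⁻ z, ENNReal.ofReal (‖z‖ ^ 2) ∂stdComplexGaussian < ⊤ := by
  unfold stdComplexGaussian
  rw [lintegral_map (by fun_prop) Complex.measurableEquivRealProd.symm.measurable]
  have hint : Integrable (fun x : ℝ => x ^ 2) (gaussianReal 0 1) :=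
    (memLp_id_gaussianReal 2).integrable_sq
  have h : Integrable (fun x : ℝ × ℝ => x.1 ^ 2 + x.2 ^ 2)
      ((gaussianReal 0 1).prod (gaussianReal 0 1)) :=
    (hint.comp_fst _).add (hint.comp_snd _)
  have h2 := h.lintegral_lt_top
  refine lt_of_eq_of_lt (lintegral_congr fun x => ?_) h2
  rw [Complex.sq_norm, Complex.normSq_apply]
  congr 1
  simp [Complex.measurableEquivRealProd]
  ring

lemma orthonormal_mode : Orthonormal ℂ mode := UnitAddTorus.orthonormal_mFourier

/-- The random Fourier series converges almost surely. -/
lemma ae_summable_randomSeries {s : ℝ} (hs : 3 / 2 < s) :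
    ∀ᵐ g ∂gaussianFamily, Summable fun k : Freq =>
      (g k / ((√(1 + freqNorm k ^ (2 * s)) : ℝ) : ℂ)) • mode k := by
  have hpos : ∀ k : Freq, 0 ≤ freqNorm k ^ (2 * s) := fun k =>
    Real.rpow_nonneg (Real.sqrt_nonneg _) _
  have hm : ∀ k : Freq, Measurable fun g : Freq → ℂ => ENNReal.ofReal (‖g k‖ ^ 2) *
      ENNReal.ofReal (1 / (1 + freqNorm k ^ (2 * s))) := fun k => by fun_prop
  have key : ∫⁻ g, ∑' k : Freq, ENNReal.ofReal (‖g k‖ ^ 2) *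
      ENNReal.ofReal (1 / (1 + freqNorm k ^ (2 * s))) ∂gaussianFamily ≠ ⊤ := by
    rw [lintegral_tsum (fun k => (hm k).aemeasurable)]
    have : ∀ k : Freq, ∫⁻ g, ENNReal.ofReal (‖g k‖ ^ 2) *
        ENNReal.ofReal (1 / (1 + freqNorm k ^ (2 * s))) ∂gaussianFamily =
        (∫⁻ z, ENNReal.ofReal (‖z‖ ^ 2) ∂stdComplexGaussian) *
          ENNReal.ofReal (1 / (1 + freqNorm k ^ (2 * s))) := by
      intro k
      rw [lintegral_mul_const _ (by fun_prop)]
      congr 1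
      exact (measurePreserving_eval_infinitePi (fun _ : Freq => stdComplexGaussian) k).lintegral_comp
        (f := fun z => ENNReal.ofReal (‖z‖ ^ 2)) (by fun_prop)
    simp_rw [this]
    rw [ENNReal.tsum_mul_left]
    exact ENNReal.mul_ne_top lintegral_stdComplexGaussian.ne
      (summable_weight hs).tsum_ofReal_ne_top
  have hae := ae_lt_top (Measurable.tsum hm) key
  filter_upwards [hae] with g hg
  have h1 : Summable fun k : Freq => ‖g k / ((√(1 + freqNorm k ^ (2 * s)) : ℝ) : ℂ)‖ ^ 2 := by
    refine (ENNReal.summable_toReal hg.ne).congr fun k => ?_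
    have := hpos k
    rw [ENNReal.toReal_mul, ENNReal.toReal_ofReal (by positivity),
      ENNReal.toReal_ofReal (by positivity), norm_div, div_pow, Complex.norm_real,
      Real.norm_of_nonneg (Real.sqrt_nonneg _), Real.sq_sqrt (by linarith)]
    ring
  have h2 := (orthonormal_mode.orthogonalFamily.summable_iff_norm_sq_summable
    (fun k => g k / ((√(1 + freqNorm k ^ (2 * s)) : ℝ) : ℂ))).2 h1
  simpa using h2

lemma aemeasurable_randomSeries {s : ℝ} (hs : 3 / 2 < s) :
    AEMeasurable (randomSeries s) gaussianFamily := by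
  refine aemeasurable_of_tendsto_metrizable_ae (atTop : Filter (Finset Freq))
    (f := fun F g => ∑ k ∈ F, (g k / ((√(1 + freqNorm k ^ (2 * s)) : ℝ) : ℂ)) • mode k)
    (fun F => ?_) ?_
  · refine (Continuous.measurable ?_).aemeasurable
    fun_prop
  · filter_upwards [ae_summable_randomSeries hs] with g hg
    exact hg.hasSum

lemma isProbabilityMeasure_gaussMeasure {s : ℝ} (hs : 3 / 2 < s) :
    IsProbabilityMeasure (gaussMeasure s) :=
  Measure.isProbabilityMeasure_map (aemeasurable_randomSeries hs)

end NLSTorus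

end

noncomputable section

namespace NLSTorus

/-! On a ball of `H^σ` the sextic form is, up to a well summable superposition, a quadratic form in
the Gaussian variables of its two largest frequencies `k_a`, `k_b`. Since `Ω` is an integer, `|Ω| ≥
1` wherever it is nonzero. The zeroth-order growth `|k_a|^{2s}` of `ψ` is either cancelled by the
opposite sign of `k_b` or, for equal signs, absorbed by `Ω` and the other frequencies. Hence `ψ/Ω =
O(|k_a|^{2s-2})`, times a polynomial in the four low frequencies (`abs_psi_div_Omega_le`).

If `k_a ≠ k_b`, fix the four low frequencies. The zero-sum condition makes `k_b` a function of
`k_a`, and the two variances reduce the coefficient of `g_{k_a} g_{k_b}` to `O(|k_a|^{-2})`. This is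
square summable over `ℤ³` with room for a factor `L^{-1/2}` when `|k_a| ≥ L`. A two-colouring of the
frequencies splits this form into two sums of independent products, whose exponential moments are
explicit (`lintegral_exp_norm_quadratic_le`). The low coefficients are bounded pointwise by powers
of `R` and of the frequency, so convexity of `exp` sums the fibers (`exists_exp_offdiagonal_le`).

If `k_a = k_b`, the product of the two Gaussians has no oscillation to exploit, but the symbol gains
two more powers (`abs_psi_div_Omega_le_of_eq`) and the sum is bounded deterministically by the `H^σ`
norm (`norm_sum_diagonal_le`). This is where `σ ≥ s - 7/4` is needed.

Together, the part of the form with some frequency of size at least `L` is `O(L^{-1/4})` in the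
exponential sense (`exists_lintegral_exp_sextic_le`). Taking `L` large beats any prescribed
exponent, the remaining finite part being bounded on the ball; this gives the uniform `L^p` bounds.
The same decay in `L⁸` compares two truncations and gives almost sure convergence. A uniform bound
on squares then yields uniform integrability, and Vitali's theorem upgrades almost sure to `L^p`
convergence. -/

/-! ### Exponential moments of real and complex Gaussians. -/

lemma lintegral_exp_mul_gaussianReal (t : ℝ) :
    ∫⁻ x, ENNReal.ofReal (Real.exp (t * x)) ∂gaussianReal 0 1
      = ENNReal.ofReal (Real.exp (t ^ 2 / 2)) := by
  rw [← ofReal_integral_eq_lintegral_ofReal (integrable_exp_mul_gaussianReal t)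
    (Eventually.of_forall fun x => (Real.exp_pos _).le)]
  congr 1
  have := congrFun (mgf_fun_id_gaussianReal (μ := 0) (v := 1)) t
  simpa [mgf] using this

lemma lintegral_exp_sq_gaussianReal {a : ℝ} (ha : a < 1) :
    ∫⁻ x, ENNReal.ofReal (Real.exp (a * x ^ 2 / 2)) ∂gaussianReal 0 1
      = ENNReal.ofReal (1 / √(1 - a)) := by
  rw [gaussianReal_of_var_ne_zero 0 one_ne_zero,
    lintegral_withDensity_eq_lintegral_mul _ (measurable_gaussianPDF 0 1) (by fun_prop)]
  have hb : 0 < (1 - a) / 2 := by linarith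
  have h1 : ∀ x : ℝ, (gaussianPDF 0 1 * fun x => ENNReal.ofReal (Real.exp (a * x ^ 2 / 2))) x
      = ENNReal.ofReal ((√(2 * Real.pi))⁻¹ * Real.exp (-((1 - a) / 2) * x ^ 2)) := by
    intro x
    simp only [Pi.mul_apply, gaussianPDF]
    rw [← ENNReal.ofReal_mul (gaussianPDFReal_nonneg _ _ _), gaussianPDFReal_def]
    simp only [NNReal.coe_one, mul_one, sub_zero]
    rw [mul_assoc, ← Real.exp_add]
    congr 3
    ring
  simp_rw [h1]
  rw [← ofReal_integral_eq_lintegral_ofReal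
    ((integrable_exp_neg_mul_sq hb).const_mul _) (Eventually.of_forall fun x => by positivity),
    integral_const_mul, integral_gaussian]
  congr 1
  rw [← Real.sqrt_inv, ← Real.sqrt_mul (by positivity), one_div, ← Real.sqrt_inv]
  congr 1
  have : (1 - a) ≠ 0 := by linarith
  field_simp

lemma lintegral_stdComplexGaussian_eq {f : ℂ → ℝ≥0∞} (hf : Measurable f) :
    ∫⁻ z, f z ∂stdComplexGaussian
      = ∫⁻ x, ∫⁻ y, f ⟨x, y⟩ ∂gaussianReal 0 1 ∂gaussianReal 0 1 := by
  unfold stdComplexGaussian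
  rw [lintegral_map hf Complex.measurableEquivRealProd.symm.measurable]
  exact lintegral_prod _ (hf.comp Complex.measurableEquivRealProd.symm.measurable).aemeasurable

lemma lintegral_exp_re_stdComplexGaussian (w : ℂ) :
    ∫⁻ z, ENNReal.ofReal (Real.exp (w * z).re) ∂stdComplexGaussian
      = ENNReal.ofReal (Real.exp (‖w‖ ^ 2 / 2)) := by
  rw [lintegral_stdComplexGaussian_eq (by fun_prop)]
  have h : ∀ x y : ℝ, ENNReal.ofReal (Real.exp (w * ⟨x, y⟩).re)
      = ENNReal.ofReal (Real.exp (w.re * x)) * ENNReal.ofReal (Real.exp (-w.im * y)) := by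
    intro x y
    rw [← ENNReal.ofReal_mul (Real.exp_pos _).le, ← Real.exp_add]
    simp [Complex.mul_re, sub_eq_add_neg]
  simp_rw [h]
  have h2 : ∀ x : ℝ, ∫⁻ y, ENNReal.ofReal (Real.exp (w.re * x)) *
      ENNReal.ofReal (Real.exp (-w.im * y)) ∂gaussianReal 0 1
      = ENNReal.ofReal (Real.exp (w.re * x)) * ENNReal.ofReal (Real.exp ((-w.im) ^ 2 / 2)) := by
    intro x
    rw [lintegral_const_mul _ (by fun_prop), lintegral_exp_mul_gaussianReal]
  simp_rw [h2]
  rw [lintegral_mul_const _ (by fun_prop), lintegral_exp_mul_gaussianReal,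
    ← ENNReal.ofReal_mul (Real.exp_pos _).le, ← Real.exp_add, Complex.sq_norm,
    Complex.normSq_apply]
  ring_nf

lemma lintegral_exp_sq_stdComplexGaussian {a : ℝ} (ha : a < 1) :
    ∫⁻ z, ENNReal.ofReal (Real.exp (a * ‖z‖ ^ 2 / 2)) ∂stdComplexGaussian
      = ENNReal.ofReal (1 / (1 - a)) := by
  rw [lintegral_stdComplexGaussian_eq (by fun_prop)]
  have h : ∀ x y : ℝ, ENNReal.ofReal (Real.exp (a * ‖(⟨x, y⟩ : ℂ)‖ ^ 2 / 2))
      = ENNReal.ofReal (Real.exp (a * x ^ 2 / 2)) * ENNReal.ofReal (Real.exp (a * y ^ 2 / 2)) := by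
    intro x y
    rw [← ENNReal.ofReal_mul (Real.exp_pos _).le, ← Real.exp_add, Complex.sq_norm,
      Complex.normSq_apply]
    ring_nf
  simp_rw [h]
  have h2 : ∀ x : ℝ, ∫⁻ y, ENNReal.ofReal (Real.exp (a * x ^ 2 / 2)) *
      ENNReal.ofReal (Real.exp (a * y ^ 2 / 2)) ∂gaussianReal 0 1
      = ENNReal.ofReal (Real.exp (a * x ^ 2 / 2)) * ENNReal.ofReal (1 / √(1 - a)) := by
    intro x
    rw [lintegral_const_mul _ (by fun_prop), lintegral_exp_sq_gaussianReal ha]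
  simp_rw [h2]
  rw [lintegral_mul_const _ (by fun_prop), lintegral_exp_sq_gaussianReal ha,
    ← ENNReal.ofReal_mul (by positivity)]
  congr 1
  have : 0 ≤ 1 - a := by linarith
  rw [div_mul_div_comm, Real.mul_self_sqrt this, one_mul]

/-! ### Exponential moments of quadratic forms in independent Gaussians. -/

/-- Complex conjugation if `b`, and the identity otherwise. -/
def conjIf (b : Bool) (z : ℂ) : ℂ := if b then star z else z

lemma measurable_conjIf (b : Bool) : Measurable (conjIf b) := by
  cases b
  · exact measurable_id
  · exact Complex.continuous_conj.measurable

lemma norm_conjIf (b : Bool) (z : ℂ) : ‖conjIf b z‖ = ‖z‖ := by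
  cases b <;> simp [conjIf]

lemma re_mul_conjIf (b : Bool) (w z : ℂ) : (w * conjIf b z).re = (conjIf b w * z).re := by
  cases b <;> simp [conjIf, Complex.mul_re]

/-- Integrating out `w` leaves `exp (|d|²|z|²/2)`, whose mean is `1/(1 - |d|²)`. For `t = |d|² ≤
1/2` one has `1/(1 - t) ≤ 1 + 2t ≤ exp (2t)`, a form that multiplies well over many pairs. -/
lemma lintegral_exp_re_mul_le (b₁ b₂ : Bool) {d : ℂ} (hd : ‖d‖ ^ 2 ≤ 1 / 2) :
    ∫⁻ z, ∫⁻ w, ENNReal.ofReal (Real.exp (d * conjIf b₁ z * conjIf b₂ w).re)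
        ∂stdComplexGaussian ∂stdComplexGaussian
      ≤ ENNReal.ofReal (Real.exp (2 * ‖d‖ ^ 2)) := by
  have h1 : ∀ z, ∫⁻ w, ENNReal.ofReal (Real.exp (d * conjIf b₁ z * conjIf b₂ w).re)
      ∂stdComplexGaussian = ENNReal.ofReal (Real.exp (‖d‖ ^ 2 * ‖z‖ ^ 2 / 2)) := by
    intro z
    simp_rw [re_mul_conjIf b₂]
    rw [lintegral_exp_re_stdComplexGaussian, norm_conjIf, norm_mul, norm_conjIf, mul_pow]
  simp_rw [h1]
  rw [lintegral_exp_sq_stdComplexGaussian (by linarith)]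
  apply ENNReal.ofReal_le_ofReal
  have h0 : 0 ≤ ‖d‖ ^ 2 := sq_nonneg _
  have h2 : 1 + 2 * ‖d‖ ^ 2 ≤ Real.exp (2 * ‖d‖ ^ 2) := by
    linarith [Real.add_one_le_exp (2 * ‖d‖ ^ 2)]
  refine le_trans ?_ h2
  rw [div_le_iff₀ (by linarith)]
  nlinarith

/-- Functions of disjoint pairs of coordinates of `gaussianFamily` are independent. -/
lemma lintegral_prod_disjoint_pairs {ι : Type*} (I : Finset ι) (α β : ι → Freq)
    (f : ι → ℂ → ℂ → ℝ≥0∞) (hf : ∀ i, Measurable (Function.uncurry (f i)))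
    (hαβ : ∀ i ∈ I, ∀ j ∈ I, α i ≠ β j)
    (hα : Set.InjOn α I) (hβ : Set.InjOn β I) :
    ∫⁻ g, ∏ i ∈ I, f i (g (α i)) (g (β i)) ∂gaussianFamily
      = ∏ i ∈ I, ∫⁻ z, ∫⁻ w, f i z w ∂stdComplexGaussian ∂stdComplexGaussian := by
  classical
  have hind : iIndepFun (fun (k : Freq) (g : Freq → ℂ) => g k) gaussianFamily :=
    iIndepFun_infinitePi (P := fun _ : Freq => stdComplexGaussian) (X := fun _ z => z)
      (fun _ => measurable_id)
  have hlaw : ∀ k : Freq, gaussianFamily.map (fun g => g k) = stdComplexGaussian := fun k =>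
    (measurePreserving_eval_infinitePi (fun _ : Freq => stdComplexGaussian) k).map_eq
  have hpair : ∀ i ∈ I, ∫⁻ g, f i (g (α i)) (g (β i)) ∂gaussianFamily
      = ∫⁻ z, ∫⁻ w, f i z w ∂stdComplexGaussian ∂stdComplexGaussian := by
    intro i hi
    have h1 := hind.indepFun (hαβ i hi i hi)
    rw [indepFun_iff_map_prod_eq_prod_map_map (measurable_pi_apply _).aemeasurable
      (measurable_pi_apply _).aemeasurable, hlaw, hlaw] at h1
    rw [← lintegral_prod (fun z : ℂ × ℂ => f i z.1 z.2) (hf i).aemeasurable, ← h1]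
    have hp : Measurable fun g : Freq → ℂ => (g (α i), g (β i)) := by fun_prop
    exact (lintegral_map (hf i) hp).symm
  induction I using Finset.induction_on with
  | empty => simp
  | insert j I hj ih =>
    have hmf : ∀ i, Measurable fun g : Freq → ℂ => f i (g (α i)) (g (β i)) := fun i =>
      (hf i).comp (f := fun g : Freq → ℂ => (g (α i), g (β i))) (by fun_prop)
    -- The new pair and the old pairs involve disjoint sets of coordinates, so the new factor is
    -- independent of the product of the old ones.
    let S : Finset Freq := {α j, β j}
    let T : Finset Freq := I.image α ∪ I.image β
    have hST : Disjoint S T := by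
      rw [Finset.disjoint_left]
      intro k hk hk'
      simp only [S, T, Finset.mem_insert, Finset.mem_singleton, Finset.mem_union,
        Finset.mem_image] at hk hk'
      rcases hk with rfl | rfl <;> rcases hk' with ⟨i, hi, h⟩ | ⟨i, hi, h⟩
      · have := hα (by simp [hi]) (by simp) h; subst this; exact hj hi
      · exact hαβ j (by simp) i (by simp [hi]) h.symm
      · exact hαβ i (by simp [hi]) j (by simp) h
      · have := hβ (by simp [hi]) (by simp) h; subst this; exact hj hi
    -- Independence is available for restrictions to finite sets of coordinates; extension by zero
    -- lets the factors be written in terms of a restriction. The value `0` is never read at the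
    -- frequencies used.
    let ext (U : Finset Freq) (x : U → ℂ) (k : Freq) : ℂ := if h : k ∈ U then x ⟨k, h⟩ else 0
    have hext : ∀ U k, Measurable fun x => ext U x k := by
      intro U k
      by_cases h : k ∈ U
      · simp only [ext, h, dite_true]; fun_prop
      · simp only [ext, h, dite_false]; fun_prop
    have h2 := (hind.indepFun_finset S T hST (by fun_prop)).comp
      (φ := fun x => f j (ext S x (α j)) (ext S x (β j)))
      (ψ := fun x => ∏ i ∈ I, f i (ext T x (α i)) (ext T x (β i)))
      ((hf j).comp ((hext S _).prodMk (hext S _)))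
      (Finset.measurable_prod _ fun i _ => (hf i).comp ((hext T _).prodMk (hext T _)))
    have e1 : (fun x => f j (ext S x (α j)) (ext S x (β j))) ∘ (fun (g : Freq → ℂ) (i : S) => g i)
        = fun g => f j (g (α j)) (g (β j)) := by
      funext g; simp [ext, S]
    have e2 : (fun x => ∏ i ∈ I, f i (ext T x (α i)) (ext T x (β i))) ∘
        (fun (g : Freq → ℂ) (i : T) => g i) = fun g => ∏ i ∈ I, f i (g (α i)) (g (β i)) := by
      funext g
      refine Finset.prod_congr rfl fun i hi => ?_
      have h3 : α i ∈ T := Finset.mem_union_left _ (Finset.mem_image_of_mem _ hi)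
      have h4 : β i ∈ T := Finset.mem_union_right _ (Finset.mem_image_of_mem _ hi)
      simp [ext, h3, h4]
    rw [e1, e2] at h2
    simp only [Finset.prod_insert hj]
    have h5 := lintegral_mul_eq_lintegral_mul_lintegral_of_indepFun (μ := gaussianFamily)
      (hmf j) (Finset.measurable_prod I fun i _ => hmf i) h2
    simp only [Pi.mul_apply] at h5
    rw [h5, hpair j (by simp), ih
      (fun i hi k hk => hαβ i (by simp [hi]) k (by simp [hk]))
      (hα.mono (by simp)) (hβ.mono (by simp)) (fun i hi => hpair i (by simp [hi]))]

lemma lintegral_exp_sum_disjoint_le {ι : Type*} (I : Finset ι) (α β : ι → Freq) (d : ι → ℂ)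
    (b₁ b₂ : Bool) (hαβ : ∀ i ∈ I, ∀ j ∈ I, α i ≠ β j)
    (hα : Set.InjOn α I) (hβ : Set.InjOn β I) (hd : ∑ i ∈ I, ‖d i‖ ^ 2 ≤ 1 / 2) :
    ∫⁻ g, ENNReal.ofReal (Real.exp
        (∑ i ∈ I, d i * conjIf b₁ (g (α i)) * conjIf b₂ (g (β i))).re) ∂gaussianFamily
      ≤ ENNReal.ofReal (Real.exp 1) := by
  have h1 : ∀ g : Freq → ℂ, ENNReal.ofReal (Real.exp
        (∑ i ∈ I, d i * conjIf b₁ (g (α i)) * conjIf b₂ (g (β i))).re)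
      = ∏ i ∈ I, ENNReal.ofReal (Real.exp
          (d i * conjIf b₁ (g (α i)) * conjIf b₂ (g (β i))).re) := by
    intro g
    rw [Complex.re_sum, Real.exp_sum, ENNReal.ofReal_prod_of_nonneg fun _ _ => (Real.exp_pos _).le]
  simp_rw [h1]
  have hm := measurable_conjIf
  rw [lintegral_prod_disjoint_pairs I α β (fun i z w => ENNReal.ofReal (Real.exp
    (d i * conjIf b₁ z * conjIf b₂ w).re)) (fun i => by
      simp only [Function.uncurry_def]
      have h1 : Measurable fun p : ℂ × ℂ => conjIf b₁ p.1 := (hm b₁).comp measurable_fst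
      have h2 : Measurable fun p : ℂ × ℂ => conjIf b₂ p.2 := (hm b₂).comp measurable_snd
      exact (Real.measurable_exp.comp (Complex.measurable_re.comp
        ((h1.const_mul _).mul h2))).ennreal_ofReal) hαβ hα hβ]
  calc _ ≤ ∏ i ∈ I, ENNReal.ofReal (Real.exp (2 * ‖d i‖ ^ 2)) := by
        refine Finset.prod_le_prod' fun i hi => lintegral_exp_re_mul_le b₁ b₂ ?_
        exact (Finset.single_le_sum (f := fun i => ‖d i‖ ^ 2) (fun _ _ => sq_nonneg _) hi).trans hd
    _ = ENNReal.ofReal (Real.exp (∑ i ∈ I, 2 * ‖d i‖ ^ 2)) := by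
        rw [Real.exp_sum, ENNReal.ofReal_prod_of_nonneg fun _ _ => (Real.exp_pos _).le]
    _ ≤ _ := by
        rw [← Finset.mul_sum]
        exact ENNReal.ofReal_le_ofReal (Real.exp_le_exp.2 (by linarith))

/-- Use `|z| ≤ |Re z| + |Im z|` and `2xy ≤ x² + y²`: the exponential of a norm is reduced to
exponentials of real parts of four rotations of `2z`, which factorize over independent pairs. -/
lemma exp_norm_le (z : ℂ) : Real.exp ‖z‖ ≤ 1 / 2 * (Real.exp (2 * z).re + Real.exp (-2 * z).re
    + (Real.exp (-2 * Complex.I * z).re + Real.exp (2 * Complex.I * z).re)) := by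
  have h1 : ∀ x : ℝ, Real.exp (2 * |x|) ≤ Real.exp (2 * x) + Real.exp (-2 * x) := by
    intro x
    rcases abs_cases x with ⟨h, _⟩ | ⟨h, _⟩ <;> rw [h]
    · linarith [Real.exp_pos (-2 * x)]
    · rw [mul_neg, ← neg_mul]; linarith [Real.exp_pos (2 * x)]
  have h2 : Real.exp ‖z‖ ≤ Real.exp |z.re| * Real.exp |z.im| := by
    rw [← Real.exp_add]; exact Real.exp_le_exp.2 (Complex.norm_le_abs_re_add_abs_im z)
  have h3 := h1 z.re
  have h4 := h1 z.im
  have e : ∀ x : ℝ, Real.exp (2 * x) = Real.exp x ^ 2 := fun x => by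
    rw [sq, ← Real.exp_add]; ring_nf
  rw [e |z.re|] at h3
  rw [e |z.im|] at h4
  have h5 := two_mul_le_add_sq (Real.exp |z.re|) (Real.exp |z.im|)
  simp [Complex.mul_re, Complex.mul_im]
  simp at h3 h4
  linarith

/-- Exponential integrability of a quadratic form in Gaussians whose pairs `(α i, β i)` are
separated by a two-colouring of the frequencies. -/
lemma lintegral_exp_norm_quadratic_le {ι : Type*} (I : Finset ι) (α β : ι → Freq) (d : ι → ℂ)
    (b₁ b₂ : Bool) (col : Freq → Bool) (hcol : ∀ i ∈ I, col (α i) ≠ col (β i))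
    (hα : Set.InjOn α I) (hβ : Set.InjOn β I) (hd : ∑ i ∈ I, ‖d i‖ ^ 2 ≤ 1 / 32) :
    ∫⁻ g, ENNReal.ofReal (Real.exp
        ‖∑ i ∈ I, d i * conjIf b₁ (g (α i)) * conjIf b₂ (g (β i))‖) ∂gaussianFamily
      ≤ ENNReal.ofReal (2 * Real.exp 1) := by
  classical
  have hm := measurable_conjIf
  -- A frequency may be both some `α i` and some `β j`, so the pairs need not be independent. Among
  -- the pairs with `α i` of colour `c`, every `β j` has the other colour, and the two families are
  -- disjoint.
  let Q (c : Bool) (g : Freq → ℂ) : ℂ := ∑ i ∈ I.filter (fun i => col (α i) = c),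
    d i * conjIf b₁ (g (α i)) * conjIf b₂ (g (β i))
  have hQm : ∀ c, Measurable (Q c) := fun c => Finset.measurable_sum _ fun i _ =>
    (((hm b₁).comp (measurable_pi_apply _)).const_mul _).mul
      ((hm b₂).comp (measurable_pi_apply _))
  have hQ : ∀ g : Freq → ℂ, ∑ i ∈ I, d i * conjIf b₁ (g (α i)) * conjIf b₂ (g (β i))
      = Q true g + Q false g := by
    intro g
    rw [← Finset.sum_filter_add_sum_filter_not I (fun i => col (α i) = true)]
    simp [Q]
  have key : ∀ (c : Bool) (w : ℂ), ‖w‖ = 4 →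
      ∫⁻ g, ENNReal.ofReal (Real.exp (w * Q c g).re) ∂gaussianFamily
        ≤ ENNReal.ofReal (Real.exp 1) := by
    intro c w hw
    have := lintegral_exp_sum_disjoint_le (I.filter (fun i => col (α i) = c)) α β
      (fun i => w * d i) b₁ b₂ ?_
      (hα.mono (Finset.coe_subset.2 (Finset.filter_subset _ _)))
      (hβ.mono (Finset.coe_subset.2 (Finset.filter_subset _ _))) ?_
    · simpa only [Q, Finset.mul_sum, mul_assoc] using this
    · intro i hi j hj h
      simp only [Finset.mem_filter] at hi hj
      have := hcol j hj.1
      rw [← h, hi.2, hj.2] at this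
      exact this rfl
    · simp only [norm_mul, mul_pow, ← Finset.mul_sum, hw]
      have := Finset.sum_le_sum_of_subset_of_nonneg (Finset.filter_subset
        (fun i => col (α i) = c) I) (f := fun i => ‖d i‖ ^ 2) (fun _ _ _ => sq_nonneg _)
      linarith
  have hpt : ∀ (w x y : ℂ), Real.exp (w * (x + y)).re
      ≤ 1 / 2 * (Real.exp (2 * w * x).re + Real.exp (2 * w * y).re) := by
    intro w x y
    have e : ∀ z : ℂ, Real.exp (2 * w * z).re = Real.exp (w * z).re ^ 2 := fun z => by
      rw [sq, ← Real.exp_add, ← Complex.add_re]; ring_nf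
    rw [e, e, mul_add, Complex.add_re, Real.exp_add]
    linarith [two_mul_le_add_sq (Real.exp (w * x).re) (Real.exp (w * y).re)]
  let E (w : ℂ) (c : Bool) (g : Freq → ℂ) : ℝ := Real.exp (2 * w * Q c g).re
  have hE : ∀ w c, Measurable fun g => ENNReal.ofReal (E w c g) := fun w c =>
    (Real.measurable_exp.comp (Complex.measurable_re.comp ((hQm c).const_mul _))).ennreal_ofReal
  let w : Fin 4 → ℂ := ![2, -2, -2 * Complex.I, 2 * Complex.I]
  -- One factor `2` comes from `exp_norm_le`, another from separating the two colours. The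
  -- coefficients grow by `4`, their squares by `16`, which turns the hypothesis `1/32` into the
  -- admissible `1/2`.
  have hw : ∀ j, ‖2 * w j‖ = 4 := by
    intro j; fin_cases j <;> norm_num [w]
  have hE2 : ∀ j, Measurable fun g =>
      ENNReal.ofReal (E (w j) true g) + ENNReal.ofReal (E (w j) false g) := fun j =>
    (hE _ _).add (hE _ _)
  have hle : ∀ g : Freq → ℂ, ENNReal.ofReal (Real.exp
        ‖∑ i ∈ I, d i * conjIf b₁ (g (α i)) * conjIf b₂ (g (β i))‖)
      ≤ ENNReal.ofReal (1 / 4) * ∑ j : Fin 4,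
        (ENNReal.ofReal (E (w j) true g) + ENNReal.ofReal (E (w j) false g)) := by
    intro g
    have e : ∑ j : Fin 4, (ENNReal.ofReal (E (w j) true g) + ENNReal.ofReal (E (w j) false g))
        = ENNReal.ofReal (∑ j : Fin 4, (E (w j) true g + E (w j) false g)) := by
      rw [ENNReal.ofReal_sum_of_nonneg fun _ _ => by positivity]
      exact Finset.sum_congr rfl fun j _ =>
        (ENNReal.ofReal_add (Real.exp_pos _).le (Real.exp_pos _).le).symm
    rw [e, ← ENNReal.ofReal_mul (by norm_num), hQ]
    apply ENNReal.ofReal_le_ofReal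
    refine (exp_norm_le _).trans ?_
    simp only [Fin.sum_univ_four, E, w]
    have h1 := hpt 2 (Q true g) (Q false g)
    have h2 := hpt (-2) (Q true g) (Q false g)
    have h3 := hpt (-2 * Complex.I) (Q true g) (Q false g)
    have h4 := hpt (2 * Complex.I) (Q true g) (Q false g)
    simp only [Matrix.cons_val]
    linarith
  refine (lintegral_mono hle).trans ?_
  rw [lintegral_const_mul _ (Finset.measurable_sum _ fun j _ => hE2 j),
    lintegral_finsetSum _ fun j _ => hE2 j]
  simp_rw [lintegral_add_left (hE _ _)]
  calc _ ≤ ENNReal.ofReal (1 / 4) * ∑ j : Fin 4,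
        (ENNReal.ofReal (Real.exp 1) + ENNReal.ofReal (Real.exp 1)) := by
        gcongr with j _
        · exact key _ _ (hw j)
        · exact key _ _ (hw j)
    _ = ENNReal.ofReal (2 * Real.exp 1) := by
        rw [← ENNReal.ofReal_add (Real.exp_pos _).le (Real.exp_pos _).le,
          ← ENNReal.ofReal_sum_of_nonneg fun _ _ => by positivity,
          ← ENNReal.ofReal_mul (by norm_num)]
        congr 1
        simp
        ring

/-! ## Elementary facts on frequencies -/

lemma freqNorm_nonneg (k : Freq) : 0 ≤ freqNorm k := Real.sqrt_nonneg _

lemma freqNorm_sq (k : Freq) : freqNorm k ^ 2 = ∑ i, (k i : ℝ) ^ 2 :=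
  Real.sq_sqrt (Finset.sum_nonneg fun _ _ => sq_nonneg _)

/-- The squared Japanese bracket `1 + |k|²`. -/
def bracketSq (k : Freq) : ℝ := 1 + freqNorm k ^ 2

lemma one_le_bracketSq (k : Freq) : 1 ≤ bracketSq k := by
  unfold bracketSq; nlinarith [sq_nonneg (freqNorm k)]

lemma bracketSq_pos (k : Freq) : 0 < bracketSq k := zero_lt_one.trans_le (one_le_bracketSq k)

lemma summable_bracketSq_rpow {r : ℝ} (hr : 3 / 2 < r) :
    Summable fun k : Freq => bracketSq k ^ (-r) := by
  refine ((summable_weight hr).mul_left 2).of_nonneg_of_le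
    (fun k => Real.rpow_nonneg (bracketSq_pos k).le _) fun k => ?_
  have hx := freqNorm_nonneg k
  have h1 : 1 ≤ bracketSq k ^ r :=
    Real.one_le_rpow (one_le_bracketSq k) (by linarith)
  have h2 : freqNorm k ^ (2 * r) ≤ bracketSq k ^ r := by
    rw [Real.rpow_mul hx]
    refine Real.rpow_le_rpow (by positivity) ?_ (by linarith)
    rw [Real.rpow_two]
    unfold bracketSq
    linarith
  have h3 : 0 ≤ freqNorm k ^ (2 * r) := Real.rpow_nonneg hx _
  rw [Real.rpow_neg (bracketSq_pos k).le, mul_one_div, inv_eq_one_div,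
    div_le_div_iff₀ (by linarith) (by linarith)]
  linarith

lemma summable_bracketSq : Summable fun k : Freq => bracketSq k ^ (-(7 / 4) : ℝ) :=
  summable_bracketSq_rpow (by norm_num)

/-- The constant `∑ (1 + |k|²)^{-7/4}`. -/
def bracketSum : ℝ := ∑' k : Freq, bracketSq k ^ (-(7 / 4) : ℝ)

lemma sum_bracketSq_le (S : Finset Freq) : ∑ k ∈ S, bracketSq k ^ (-(7 / 4) : ℝ) ≤ bracketSum :=
  summable_bracketSq.sum_le_tsum S fun k _ => Real.rpow_nonneg (bracketSq_pos k).le _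

lemma one_le_bracketSum : 1 ≤ bracketSum := by
  have := sum_bracketSq_le {0}
  simpa [bracketSq, freqNorm] using this

/-- Enlarge the set of tuples to a box, where the sum of products is the product of the sums. -/
lemma sum_prod_le {ι κ : Type*} [Fintype ι] (F : Finset (ι → κ)) (f : ι → κ → ℝ) (C : ι → ℝ)
    (hf : ∀ j k, 0 ≤ f j k) (hC : ∀ j (S : Finset κ), ∑ k ∈ S, f j k ≤ C j) :
    ∑ k ∈ F, ∏ j, f j (k j) ≤ ∏ j, C j := by
  classical
  let t : ι → Finset κ := fun j => F.image fun k => k j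
  have h : F ⊆ Fintype.piFinset t := by
    intro k hk
    rw [Fintype.mem_piFinset]
    exact fun j => Finset.mem_image_of_mem _ hk
  have h1 : ∑ k ∈ F, ∏ j, f j (k j) ≤ ∑ k ∈ Fintype.piFinset t, ∏ j, f j (k j) :=
    Finset.sum_le_sum_of_subset_of_nonneg h fun _ _ _ => Finset.prod_nonneg fun _ _ => hf _ _
  rw [← Finset.prod_univ_sum t f] at h1
  exact h1.trans (Finset.prod_le_prod (fun _ _ => Finset.sum_nonneg fun _ _ => hf _ _)
    fun _ _ => hC _ _)

/-! ## Six-tuples of frequencies -/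

/-- The sign `(-1)^j`. -/
def sgn (j : Fin 6) : ℤ := (-1) ^ (j : ℕ)

lemma sgn_eq_or (j : Fin 6) : sgn j = 1 ∨ sgn j = -1 := neg_one_pow_eq_or _ _

lemma abs_sgn (j : Fin 6) : |(sgn j : ℝ)| = 1 := by
  rcases sgn_eq_or j with h | h <;> simp [h]

lemma sum_sgn_eq_zero {k : Fin 6 → Freq} (hk : k 0 - k 1 + k 2 - k 3 + k 4 - k 5 = 0) :
    ∑ j, sgn j • k j = 0 := by
  rw [← hk, Fin.sum_univ_six]
  simp [sgn, pow_succ]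
  abel

/-- The indices other than `a` and `b`. -/
def others (a b : Fin 6) : Finset (Fin 6) := (Finset.univ.erase a).erase b

lemma mem_others {a b j : Fin 6} : j ∈ others a b ↔ j ≠ b ∧ j ≠ a := by
  simp [others]

lemma card_others {a b : Fin 6} (hab : a ≠ b) : (others a b).card = 4 := by
  rw [others, Finset.card_erase_of_mem (by simp [hab.symm]), Finset.card_erase_of_mem (by simp)]
  rfl

lemma sum_eq_add_others {M : Type*} [AddCommMonoid M] {a b : Fin 6} (hab : a ≠ b)
    (f : Fin 6 → M) : ∑ j, f j = f a + (f b + ∑ j ∈ others a b, f j) := by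
  rw [← Finset.add_sum_erase _ _ (Finset.mem_univ a), others,
    Finset.add_sum_erase (Finset.univ.erase a) f (by simp [hab.symm])]

lemma prod_eq_mul_others {M : Type*} [CommMonoid M] {a b : Fin 6} (hab : a ≠ b)
    (f : Fin 6 → M) : ∏ j, f j = f a * (f b * ∏ j ∈ others a b, f j) := by
  rw [← Finset.mul_prod_erase _ _ (Finset.mem_univ a), others,
    Finset.mul_prod_erase (Finset.univ.erase a) f (by simp [hab.symm])]

lemma one_add_sum_le_prod {ι : Type*} (S : Finset ι) (f : ι → ℝ) (hf : ∀ i, 0 ≤ f i) :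
    1 + ∑ i ∈ S, f i ≤ ∏ i ∈ S, (1 + f i) := by
  classical
  induction S using Finset.induction_on with
  | empty => simp
  | insert j S hj ih =>
    rw [Finset.sum_insert hj, Finset.prod_insert hj]
    have h1 : 0 ≤ ∑ i ∈ S, f i := Finset.sum_nonneg fun i _ => hf i
    nlinarith [hf j, mul_le_mul_of_nonneg_left ih (by linarith [hf j] : 0 ≤ 1 + f j),
      mul_nonneg (hf j) h1]

lemma Omega_eq_intCast (k : Fin 6 → Freq) : ∃ n : ℤ, Omega k = n := by
  refine ⟨∑ j : Fin 6, (-1) ^ (j : ℕ) * ∑ i, (k j i) ^ 2, ?_⟩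
  simp [Omega, freqNorm_sq]

/-- The resonant function is integer valued, so division by it never amplifies. -/
lemma one_le_abs_Omega {k : Fin 6 → Freq} (h : Omega k ≠ 0) : 1 ≤ |Omega k| := by
  obtain ⟨n, hn⟩ := Omega_eq_intCast k
  rw [hn] at h ⊢
  have : n ≠ 0 := by exact_mod_cast h
  exact_mod_cast Int.one_le_abs this

/-! ### The two largest frequencies and the size of the symbol. -/

/-- The frequencies with indices `a`, `b` are the two largest ones. -/
structure IsTopPair (k : Fin 6 → Freq) (a b : Fin 6) : Prop where
  ne : a ≠ b
  le : freqNorm (k b) ≤ freqNorm (k a)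
  le_of_ne : ∀ j ∈ others a b, freqNorm (k j) ≤ freqNorm (k b)

lemma exists_isTopPair (k : Fin 6 → Freq) : ∃ p : Fin 6 × Fin 6, IsTopPair k p.1 p.2 := by
  obtain ⟨a, -, ha⟩ := Finset.exists_max_image (Finset.univ : Finset (Fin 6))
    (fun j => freqNorm (k j)) ⟨0, by simp⟩
  have hne : (Finset.univ.erase a).Nonempty := by
    rw [← Finset.card_pos, Finset.card_erase_of_mem (by simp)]
    simp
  obtain ⟨b, hb, hb'⟩ := Finset.exists_max_image _ (fun j => freqNorm (k j)) hne
  refine ⟨(a, b), ?_, ha b (by simp), fun j hj => hb' j (Finset.mem_of_mem_erase hj)⟩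
  simpa [eq_comm] using hb

lemma IsTopPair.le_left {k : Fin 6 → Freq} {a b : Fin 6} (h : IsTopPair k a b) (j : Fin 6) :
    freqNorm (k j) ≤ freqNorm (k a) := by
  by_cases hja : j = a
  · rw [hja]
  by_cases hjb : j = b
  · rw [hjb]; exact h.le
  · exact (h.le_of_ne j (mem_others.2 ⟨hjb, hja⟩)).trans h.le

lemma rpow_sub_rpow_le {x y s : ℝ} (hs : 1 ≤ s) (hy : 0 ≤ y) (hxy : y ≤ x) :
    x ^ s - y ^ s ≤ s * x ^ (s - 1) * (x - y) := by
  rcases hy.eq_or_lt with rfl | hy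
  · rcases hxy.eq_or_lt with rfl | hx
    · simp
    · rw [Real.zero_rpow (by linarith), sub_zero, sub_zero, mul_assoc, ← Real.rpow_add_one hx.ne',
        sub_add_cancel]
      nlinarith [Real.rpow_pos_of_pos hx s]
  have hx : 0 < x := hy.trans_le hxy
  -- Bernoulli's inequality for the ratio `y / x` plays the role of the mean value theorem.
  have h1 : 1 + s * (y / x - 1) ≤ (1 + (y / x - 1)) ^ s :=
    one_add_mul_self_le_rpow_one_add (by linarith [div_pos hy hx]) hs
  rw [add_sub_cancel, Real.div_rpow hy.le hx.le, le_div_iff₀ (Real.rpow_pos_of_pos hx _)] at h1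
  have h2 : x ^ s = x ^ (s - 1) * x := by rw [← Real.rpow_add_one hx.ne', sub_add_cancel]
  have h3 : (1 + s * (y / x - 1)) * x ^ s = x ^ s + s * x ^ (s - 1) * (y - x) := by
    rw [h2]; field_simp
  linarith

lemma psi_eq (s : ℝ) (k : Fin 6 → Freq) :
    psi s k = ∑ j, (sgn j : ℝ) * (freqNorm (k j) ^ 2) ^ s := by
  refine Finset.sum_congr rfl fun j _ => ?_
  rw [Real.rpow_mul (freqNorm_nonneg _), Real.rpow_two]
  simp [sgn]

lemma Omega_eq (k : Fin 6 → Freq) : Omega k = ∑ j, (sgn j : ℝ) * freqNorm (k j) ^ 2 := by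
  simp [Omega, sgn]

lemma rpow_le_mul_rpow {x y s : ℝ} (hs : 1 ≤ s) (hy : 0 ≤ y) (hxy : y ≤ x) :
    y ^ s ≤ y * x ^ (s - 1) := by
  rcases hy.eq_or_lt with rfl | hy
  · rw [Real.zero_rpow (by linarith), zero_mul]
  · have : y ^ s = y * y ^ (s - 1) := by
      rw [mul_comm, ← Real.rpow_add_one hy.ne', sub_add_cancel]
    rw [this]
    exact mul_le_mul_of_nonneg_left (Real.rpow_le_rpow hy.le hxy (by linarith)) hy.le

lemma abs_sum_sgn_mul_le (S : Finset (Fin 6)) (f : Fin 6 → ℝ) (hf : ∀ j, 0 ≤ f j) :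
    |∑ j ∈ S, (sgn j : ℝ) * f j| ≤ ∑ j ∈ S, f j := by
  refine (Finset.abs_sum_le_sum_abs _ _).trans (Finset.sum_le_sum fun j _ => ?_)
  rw [abs_mul, abs_sgn, one_mul, abs_of_nonneg (hf j)]

/-- With `x ≥ y` the two largest squares and `S` the sum of the others, `Ω` controls `x - y`
(opposite signs) or `x + y` (equal signs) up to `S`. The same combination, times `x^{s-1}`, controls
the leading part of `ψ`. Thus `|ψ|` is at most a multiple of `x^{s-1} (|Ω| + S)`, and `|Ω| ≥ 1`
gives `|Ω| + S ≤ (1 + S)|Ω|`. -/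
lemma abs_psi_div_Omega_le_sum {s : ℝ} (hs : 1 ≤ s) {k : Fin 6 → Freq} {a b : Fin 6}
    (h : IsTopPair k a b) :
    |psi s k / Omega k| ≤ (s + 2) * (freqNorm (k a) ^ 2) ^ (s - 1) *
      (1 + ∑ j ∈ others a b, freqNorm (k j) ^ 2) := by
  set x := freqNorm (k a) ^ 2 with hx
  set y := freqNorm (k b) ^ 2 with hy
  set S := ∑ j ∈ others a b, freqNorm (k j) ^ 2 with hS
  have hS0 : 0 ≤ S := Finset.sum_nonneg fun _ _ => sq_nonneg _
  have hx0 : 0 ≤ x := sq_nonneg _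
  have hy0 : 0 ≤ y := sq_nonneg _
  have hyx : y ≤ x := pow_le_pow_left₀ (freqNorm_nonneg _) h.le 2
  have hX : 0 ≤ x ^ (s - 1) := Real.rpow_nonneg hx0 _
  have hr : |∑ j ∈ others a b, (sgn j : ℝ) * freqNorm (k j) ^ 2| ≤ S :=
    abs_sum_sgn_mul_le _ _ fun _ => sq_nonneg _
  have hr' : |∑ j ∈ others a b, (sgn j : ℝ) * (freqNorm (k j) ^ 2) ^ s| ≤ S * x ^ (s - 1) := by
    refine (abs_sum_sgn_mul_le _ _ fun _ => Real.rpow_nonneg (sq_nonneg _) _).trans ?_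
    rw [hS, Finset.sum_mul]
    exact Finset.sum_le_sum fun j _ => rpow_le_mul_rpow hs (sq_nonneg _)
      (pow_le_pow_left₀ (freqNorm_nonneg _) (h.le_left j) 2)
  clear_value x y S
  by_cases hO : Omega k = 0
  · rw [hO, div_zero, abs_zero]; positivity
  have hO1 := one_le_abs_Omega hO
  have hΩ := Omega_eq k
  have hψ := psi_eq s k
  rw [sum_eq_add_others h.ne] at hΩ hψ
  rw [← hx, ← hy] at hΩ hψ
  set r := ∑ j ∈ others a b, (sgn j : ℝ) * freqNorm (k j) ^ 2
  set r' := ∑ j ∈ others a b, (sgn j : ℝ) * (freqNorm (k j) ^ 2) ^ s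
  have hxs : x ^ s ≤ x * x ^ (s - 1) := rpow_le_mul_rpow hs hx0 le_rfl
  have hys : y ^ s ≤ y * x ^ (s - 1) := rpow_le_mul_rpow hs hy0 hyx
  have hxs0 : 0 ≤ x ^ s := Real.rpow_nonneg hx0 _
  have hys0 : 0 ≤ y ^ s := Real.rpow_nonneg hy0 _
  have hdiff := rpow_sub_rpow_le hs hy0 hyx
  have hdiff0 : y ^ s ≤ x ^ s := Real.rpow_le_rpow hy0 hyx (by linarith)
  have habs1 := abs_le.1 hr
  have habs2 := abs_le.1 hr'
  have hOl := le_abs_self (Omega k)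
  have hOr := neg_abs_le (Omega k)
  have hmain : |psi s k| ≤ (s + 2) * x ^ (s - 1) * (|Omega k| + S) := by
    have same : x + y ≤ |Omega k| + S → |psi s k| ≤ x ^ s + y ^ s + S * x ^ (s - 1) →
        |psi s k| ≤ (s + 2) * x ^ (s - 1) * (|Omega k| + S) := by
      intro h1 h2
      have h3 : x * x ^ (s - 1) + y * x ^ (s - 1) + S * x ^ (s - 1)
          ≤ (|Omega k| + S + S) * x ^ (s - 1) := by
        rw [← add_mul, ← add_mul]; exact mul_le_mul_of_nonneg_right (by linarith) hX
      have h4 : (|Omega k| + S + S) * x ^ (s - 1) ≤ (s + 2) * (|Omega k| + S) * x ^ (s - 1) :=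
        mul_le_mul_of_nonneg_right (by nlinarith) hX
      nlinarith
    have opp : x - y ≤ |Omega k| + S → |psi s k| ≤ x ^ s - y ^ s + S * x ^ (s - 1) →
        |psi s k| ≤ (s + 2) * x ^ (s - 1) * (|Omega k| + S) := by
      intro h1 h2
      have h3 : s * x ^ (s - 1) * (x - y) ≤ s * x ^ (s - 1) * (|Omega k| + S) :=
        mul_le_mul_of_nonneg_left h1 (by positivity)
      have h4 : S * x ^ (s - 1) ≤ 2 * (|Omega k| + S) * x ^ (s - 1) :=
        mul_le_mul_of_nonneg_right (by nlinarith) hX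
      nlinarith
    rcases sgn_eq_or a with ha | ha <;> rcases sgn_eq_or b with hb | hb <;>
      simp only [ha, hb, Int.cast_one, Int.cast_neg, one_mul, neg_mul] at hΩ hψ
    · exact same (by linarith) (abs_le.2 ⟨by linarith, by linarith⟩)
    · exact opp (by linarith) (abs_le.2 ⟨by linarith, by linarith⟩)
    · exact opp (by linarith) (abs_le.2 ⟨by linarith, by linarith⟩)
    · exact same (by linarith) (abs_le.2 ⟨by linarith, by linarith⟩)
  rw [abs_div, div_le_iff₀ (by linarith)]
  refine hmain.trans ?_
  rw [mul_assoc _ (1 + S)]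
  exact mul_le_mul_of_nonneg_left (by nlinarith) (by positivity)

lemma one_add_sum_others_le (k : Fin 6 → Freq) (a b : Fin 6) :
    1 + ∑ j ∈ others a b, freqNorm (k j) ^ 2 ≤ ∏ j ∈ others a b, bracketSq (k j) :=
  one_add_sum_le_prod _ _ fun _ => sq_nonneg _

/-- The symbol is of order `2s - 2` in the two largest frequencies. -/
lemma abs_psi_div_Omega_le {s : ℝ} (hs : 1 ≤ s) {k : Fin 6 → Freq} {a b : Fin 6}
    (h : IsTopPair k a b) :
    |psi s k / Omega k| ≤ (s + 2) * (freqNorm (k a) ^ 2) ^ (s - 1) *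
      ∏ j ∈ others a b, bracketSq (k j) :=
  (abs_psi_div_Omega_le_sum hs h).trans (mul_le_mul_of_nonneg_left (one_add_sum_others_le k a b)
    (by positivity))

/-- Cauchy–Schwarz in each coordinate. It is used with `c = ±1` to compare the two largest
frequencies and with `c = ±2` when they coincide with equal signs. -/
lemma sq_le_of_sum_eq_zero {ι : Type*} (S : Finset ι) (c : ℤ) (x : Freq) (e : ι → ℤ)
    (he : ∀ j, e j = 1 ∨ e j = -1) (y : ι → Freq) (h : c • x + ∑ j ∈ S, e j • y j = 0) :
    (c : ℝ) ^ 2 * freqNorm x ^ 2 ≤ S.card * ∑ j ∈ S, freqNorm (y j) ^ 2 := by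
  simp_rw [freqNorm_sq]
  rw [Finset.sum_comm, Finset.mul_sum, Finset.mul_sum]
  refine Finset.sum_le_sum fun i _ => ?_
  have h1 := congrFun h i
  simp only [Pi.add_apply, Pi.smul_apply, Finset.sum_apply, smul_eq_mul, Pi.zero_apply] at h1
  have h2 : (c : ℝ) * x i = -∑ j ∈ S, (e j : ℝ) * y j i := by
    rw [eq_neg_iff_add_eq_zero]; exact_mod_cast h1
  rw [← mul_pow, h2, neg_sq]
  refine sq_sum_le_card_mul_sum_sq.trans (le_of_eq ?_)
  congr 1
  refine Finset.sum_congr rfl fun j _ => ?_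
  rcases he j with h | h <;> simp [h]

/-- The two largest frequencies are comparable. -/
lemma IsTopPair.sq_le {k : Fin 6 → Freq} {a b : Fin 6} (h : IsTopPair k a b)
    (hk : k 0 - k 1 + k 2 - k 3 + k 4 - k 5 = 0) :
    freqNorm (k a) ^ 2 ≤ 25 * freqNorm (k b) ^ 2 := by
  have h0 := sum_sgn_eq_zero hk
  rw [← Finset.add_sum_erase _ _ (Finset.mem_univ a)] at h0
  have h1 := sq_le_of_sum_eq_zero _ _ _ _ sgn_eq_or _ h0
  rw [Finset.card_erase_of_mem (by simp)] at h1
  have h2 : ∑ j ∈ Finset.univ.erase a, freqNorm (k j) ^ 2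
      ≤ ∑ _j ∈ Finset.univ.erase a, freqNorm (k b) ^ 2 := by
    refine Finset.sum_le_sum fun j hj => pow_le_pow_left₀ (freqNorm_nonneg _) ?_ 2
    by_cases hjb : j = b
    · rw [hjb]
    · exact h.le_of_ne j (mem_others.2 ⟨hjb, Finset.ne_of_mem_erase hj⟩)
  rw [Finset.sum_const, Finset.card_erase_of_mem (by simp)] at h2
  have h3 : ((sgn a : ℝ)) ^ 2 = 1 := by rw [← sq_abs, abs_sgn, one_pow]
  simp [h3] at h1 h2
  linarith

/-- If the two largest frequencies coincide, then the symbol is of order `2s - 4` in them. -/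
lemma abs_psi_div_Omega_le_of_eq {s : ℝ} (hs : 2 ≤ s) {k : Fin 6 → Freq} {a b : Fin 6}
    (h : IsTopPair k a b) (hk : k 0 - k 1 + k 2 - k 3 + k 4 - k 5 = 0) (hab : k a = k b) :
    |psi s k / Omega k| ≤ (s + 2) * (freqNorm (k a) ^ 2) ^ (s - 2) *
      ∏ j ∈ others a b, bracketSq (k j) ^ 2 := by
  set x := freqNorm (k a) ^ 2 with hx
  set S := ∑ j ∈ others a b, freqNorm (k j) ^ 2 with hS
  have hS0 : 0 ≤ S := Finset.sum_nonneg fun _ _ => sq_nonneg _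
  have hx0 : 0 ≤ x := sq_nonneg _
  have hX : 0 ≤ x ^ (s - 2) := Real.rpow_nonneg hx0 _
  have hle : (1 + S) ^ 2 ≤ ∏ j ∈ others a b, bracketSq (k j) ^ 2 := by
    rw [Finset.prod_pow]
    exact pow_le_pow_left₀ (by linarith) (one_add_sum_others_le k a b) 2
  have hjx : ∀ j, freqNorm (k j) ^ 2 ≤ x := fun j =>
    pow_le_pow_left₀ (freqNorm_nonneg _) (h.le_left j) 2
  have hjS : ∀ j ∈ others a b, freqNorm (k j) ^ 2 ≤ S := fun j hj =>
    Finset.single_le_sum (f := fun j => freqNorm (k j) ^ 2) (fun _ _ => sq_nonneg _) hj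
  clear_value x S
  suffices h1 : |psi s k / Omega k| ≤ (s + 2) * x ^ (s - 2) * (1 + S) ^ 2 from
    h1.trans (mul_le_mul_of_nonneg_left hle (by positivity))
  have h1 := abs_psi_div_Omega_le_sum (by linarith : 1 ≤ s) h
  rw [← hx, ← hS] at h1
  -- With equal signs the zero-sum relation writes `2 k_a` through the four low frequencies, so `x ≤
  -- S` and a power of `x` can be traded for `S`. With opposite signs the two leading terms of `ψ`
  -- cancel exactly, and only low terms are left.
  by_cases hsg : sgn a = sgn b
  · have hxS : x ≤ S := by
      have h0 := sum_sgn_eq_zero hk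
      rw [sum_eq_add_others h.ne, ← hab, ← hsg, ← add_assoc, ← two_smul ℤ, smul_smul] at h0
      have h2 := sq_le_of_sum_eq_zero _ _ _ _ sgn_eq_or _ h0
      rw [card_others h.ne] at h2
      have h3 : ((sgn a : ℝ)) ^ 2 = 1 := by rw [← sq_abs, abs_sgn, one_pow]
      push_cast at h2
      rw [mul_pow, h3] at h2
      linarith
    have h2 : x ^ (s - 1) ≤ x * x ^ (s - 2) := by
      have := rpow_le_mul_rpow (by linarith : 1 ≤ s - 1) hx0 le_rfl
      rwa [sub_sub, one_add_one_eq_two] at this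
    have h3 : x ^ (s - 1) ≤ x ^ (s - 2) * (1 + S) := by nlinarith
    calc _ ≤ _ := h1
      _ ≤ (s + 2) * (x ^ (s - 2) * (1 + S)) * (1 + S) := by gcongr
      _ = _ := by ring
  · by_cases hO : Omega k = 0
    · rw [hO, div_zero, abs_zero]; positivity
    have hO1 := one_le_abs_Omega hO
    have hψ := psi_eq s k
    rw [sum_eq_add_others h.ne, ← hab] at hψ
    have hcancel : (sgn a : ℝ) * x ^ s + (sgn b : ℝ) * x ^ s = 0 := by
      rcases sgn_eq_or a with ha | ha <;> rcases sgn_eq_or b with hb | hb <;>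
        simp [ha, hb] at hsg ⊢
    rw [← add_assoc, ← hx, hcancel, zero_add] at hψ
    have hle2 : |psi s k| ≤ S ^ 2 * x ^ (s - 2) := by
      rw [hψ]
      refine (abs_sum_sgn_mul_le _ _ fun _ => Real.rpow_nonneg (sq_nonneg _) _).trans ?_
      have hj : ∀ j ∈ others a b, (freqNorm (k j) ^ 2) ^ s
          ≤ freqNorm (k j) ^ 2 * (S * x ^ (s - 2)) := by
        intro j hj
        refine (rpow_le_mul_rpow (by linarith : 1 ≤ s) (sq_nonneg _) le_rfl).trans
          (mul_le_mul_of_nonneg_left ?_ (sq_nonneg _))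
        refine (rpow_le_mul_rpow (by linarith : 1 ≤ s - 1) (sq_nonneg _) (hjx j)).trans ?_
        rw [sub_sub, one_add_one_eq_two]
        exact mul_le_mul_of_nonneg_right (hjS j hj) hX
      refine (Finset.sum_le_sum hj).trans (le_of_eq ?_)
      rw [← Finset.sum_mul, ← hS]
      ring
    rw [abs_div, div_le_iff₀ (by linarith)]
    refine hle2.trans ?_
    have h5 : S ^ 2 ≤ (1 + S) ^ 2 := pow_le_pow_left₀ hS0 (by linarith) 2
    calc S ^ 2 * x ^ (s - 2) ≤ (1 + S) ^ 2 * x ^ (s - 2) := mul_le_mul_of_nonneg_right h5 hX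
      _ = 1 * x ^ (s - 2) * (1 + S) ^ 2 * 1 := by ring
      _ ≤ (s + 2) * x ^ (s - 2) * (1 + S) ^ 2 * |Omega k| := by
        gcongr
        linarith

/-! ## Two-colourings -/

/-- Pick a coordinate with `v i ≠ 0`. Translation by `v` raises the integer quotient `k i / v i` by
exactly one, so its parity alternates along every orbit. -/
lemma exists_coloring_shift (v : Freq) :
    ∃ col : Freq → Bool, ∀ k, k ≠ k + v → col k ≠ col (k + v) := by
  by_cases hv : v = 0
  · exact ⟨fun _ => true, fun k hk => by simp [hv] at hk⟩
  obtain ⟨i, hi⟩ : ∃ i, v i ≠ 0 := by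
    by_contra! h; exact hv (funext h)
  refine ⟨fun k => decide (Even (k i / v i)), fun k _ => ?_⟩
  have h1 : (k + v) i / v i = k i / v i + 1 := by
    rw [Pi.add_apply, Int.add_ediv_of_dvd_right (dvd_refl _), Int.ediv_self hi]
  simp only [h1, Int.even_add_one, ne_eq, decide_eq_decide]
  exact fun h => iff_not_self h

/-- The reflection is an involution: colour each point by whether it is lexicographically smaller
than its image. Only fixed points are not separated. -/
lemma exists_coloring_reflect (v : Freq) :
    ∃ col : Freq → Bool, ∀ k, k ≠ v - k → col k ≠ col (v - k) := by
  classical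
  refine ⟨fun k => decide (toLex k < toLex (v - k)), fun k hk => ?_⟩
  simp only [sub_sub_cancel, ne_eq, decide_eq_decide]
  rcases lt_trichotomy (toLex k) (toLex (v - k)) with h | h | h
  · exact fun h' => lt_asymm h (h'.1 h)
  · exact absurd (toLex.injective h) hk
  · exact fun h' => lt_asymm h (h'.2 h)

/-- Opposite signs make `y` a translate of `x`, equal signs a reflection of `x`. The colouring
depends only on the signs and on `v`, so a single one serves a whole fiber of fixed low frequencies.
-/
lemma exists_coloring (e e' : ℤ) (he : e = 1 ∨ e = -1) (he' : e' = 1 ∨ e' = -1) (v : Freq) :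
    ∃ col : Freq → Bool, ∀ x y : Freq, e • x + e' • y = v → x ≠ y → col x ≠ col y := by
  have shift : ∀ w : Freq, ∃ col : Freq → Bool, ∀ x y, y = x + w → x ≠ y → col x ≠ col y := by
    intro w
    obtain ⟨col, hcol⟩ := exists_coloring_shift w
    exact ⟨col, fun x y h hxy => by subst h; exact hcol x hxy⟩
  have reflect : ∀ w : Freq, ∃ col : Freq → Bool, ∀ x y, y = w - x → x ≠ y → col x ≠ col y := by
    intro w
    obtain ⟨col, hcol⟩ := exists_coloring_reflect w
    exact ⟨col, fun x y h hxy => by subst h; exact hcol x hxy⟩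
  rcases he with rfl | rfl <;> rcases he' with rfl | rfl
  · obtain ⟨col, h⟩ := reflect v
    exact ⟨col, fun x y hxy => h x y (by rw [← hxy]; simp)⟩
  · obtain ⟨col, h⟩ := shift (-v)
    exact ⟨col, fun x y hxy => h x y (by rw [← hxy]; simp)⟩
  · obtain ⟨col, h⟩ := shift v
    exact ⟨col, fun x y hxy => h x y (by rw [← hxy]; simp)⟩
  · obtain ⟨col, h⟩ := reflect (-v)
    exact ⟨col, fun x y hxy => h x y (by rw [← hxy]; simp)⟩

/-! ## Sextic forms on sequences of Fourier coefficients -/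

/-- The product `v_{k₁} \bar v_{k₂} v_{k₃} \bar v_{k₄} v_{k₅} \bar v_{k₆}`. -/
def sexticMonomial (v : Freq → ℂ) (k : Fin 6 → Freq) : ℂ :=
  ∏ j : Fin 6, conjIf (decide ((j : ℕ) % 2 = 1)) (v (k j))

/-- The square root `(1 + |k|^{2s})^{1/2}` of the inverse variance. -/
def gaussWeight (s : ℝ) (k : Freq) : ℝ := √(1 + freqNorm k ^ (2 * s))

lemma gaussWeight_pos (s : ℝ) (k : Freq) : 0 < gaussWeight s k :=
  Real.sqrt_pos.2 (by have := Real.rpow_nonneg (freqNorm_nonneg k) (2 * s); linarith)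

lemma le_gaussWeight (s : ℝ) (k : Freq) : (freqNorm k ^ 2) ^ (s / 2) ≤ gaussWeight s k := by
  apply Real.le_sqrt_of_sq_le
  have h : ((freqNorm k ^ 2) ^ (s / 2)) ^ 2 = freqNorm k ^ (2 * s) := by
    rw [← Real.rpow_natCast ((freqNorm k ^ 2) ^ (s / 2)), ← Real.rpow_mul (sq_nonneg _),
      ← Real.rpow_natCast (freqNorm k), ← Real.rpow_mul (freqNorm_nonneg k)]
    congr 1
    push_cast
    ring
  rw [h]
  linarith

/-- The Gaussian Fourier coefficients. -/
def gaussCoeff (s : ℝ) (g : Freq → ℂ) (k : Freq) : ℂ := g k / (gaussWeight s k : ℂ)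

/-- A sequence of Fourier coefficients has `H^σ` norm at most `R`. -/
def SobolevLe (σ R : ℝ) (v : Freq → ℂ) : Prop :=
  ∀ S : Finset Freq, ∑ k ∈ S, bracketSq k ^ σ * ‖v k‖ ^ 2 ≤ R ^ 2

lemma SobolevLe.norm_le {σ R : ℝ} {v : Freq → ℂ} (hR : 0 ≤ R) (h : SobolevLe σ R v) (k : Freq) :
    ‖v k‖ ≤ R * bracketSq k ^ (-(σ / 2)) := by
  have h1 := h {k}
  rw [Finset.sum_singleton] at h1
  have hJ := bracketSq_pos k
  have h2 : bracketSq k ^ σ = (bracketSq k ^ (σ / 2)) ^ 2 := by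
    rw [sq, ← Real.rpow_add hJ, add_halves]
  rw [h2, ← mul_pow] at h1
  have h3 := abs_le_of_sq_le_sq h1 hR
  rw [abs_of_nonneg (by positivity)] at h3
  rw [Real.rpow_neg hJ.le, ← div_eq_mul_inv, le_div_iff₀ (by positivity)]
  linarith

/-- The coefficients of a sextic form are controlled by the symbol `ψ_{2s} / Ω`, and only
six-tuples of zero alternating sum with a frequency of size at least `L` occur. -/
structure SymbolBound (s B L : ℝ) (F : Finset (Fin 6 → Freq)) (c : (Fin 6 → Freq) → ℂ) :
    Prop where
  zeroSum : ∀ k ∈ F, k 0 - k 1 + k 2 - k 3 + k 4 - k 5 = 0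
  large : ∀ k ∈ F, ∃ j, L ≤ freqNorm (k j)
  norm_le : ∀ k ∈ F, ‖c k‖ ≤ B * |psi s k / Omega k|

lemma SymbolBound.mono {s B L : ℝ} {F F' : Finset (Fin 6 → Freq)} {c : (Fin 6 → Freq) → ℂ}
    (h : SymbolBound s B L F c) (hF : F' ⊆ F) : SymbolBound s B L F' c :=
  ⟨fun k hk => h.zeroSum k (hF hk), fun k hk => h.large k (hF hk),
    fun k hk => h.norm_le k (hF hk)⟩

lemma SymbolBound.le_left {s B L : ℝ} {F : Finset (Fin 6 → Freq)} {c : (Fin 6 → Freq) → ℂ}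
    (h : SymbolBound s B L F c) {k : Fin 6 → Freq} (hk : k ∈ F) {a b : Fin 6}
    (htop : IsTopPair k a b) : L ≤ freqNorm (k a) := by
  obtain ⟨j, hj⟩ := h.large k hk
  exact hj.trans (htop.le_left j)

/-- Jensen's inequality for subprobability weights: the missing mass is placed at `0`, where `exp`
equals `1`, which accounts for the summand `1`. -/
lemma exp_sum_mul_le {ι : Type*} (S : Finset ι) (p x : ι → ℝ) (hp : ∀ i ∈ S, 0 ≤ p i)
    (hp1 : ∑ i ∈ S, p i ≤ 1) :
    Real.exp (∑ i ∈ S, p i * x i) ≤ 1 + ∑ i ∈ S, p i * Real.exp (x i) := by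
  set m := ∑ i ∈ S, p i * x i with hm
  -- The tangent line of `exp` at the weighted mean `m`.
  have hexp : ∀ y : ℝ, Real.exp m * (1 - m + y) ≤ Real.exp y := by
    intro y
    have : Real.exp y = Real.exp m * Real.exp (y - m) := by rw [← Real.exp_add]; ring_nf
    rw [this]
    exact mul_le_mul_of_nonneg_left (by linarith [Real.add_one_le_exp (y - m)])
      (Real.exp_pos m).le
  have h0 := hexp 0
  rw [Real.exp_zero, add_zero] at h0
  have h1 : ∑ i ∈ S, p i * (Real.exp m * (1 - m + x i)) ≤ ∑ i ∈ S, p i * Real.exp (x i) :=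
    Finset.sum_le_sum fun i hi => mul_le_mul_of_nonneg_left (hexp _) (hp i hi)
  have h2 : ∑ i ∈ S, p i * (Real.exp m * (1 - m + x i))
      = Real.exp m * ((∑ i ∈ S, p i) * (1 - m) + m) := by
    rw [hm, Finset.sum_mul, ← Finset.sum_add_distrib, Finset.mul_sum]
    exact Finset.sum_congr rfl fun i _ => by ring
  have h3 : (1 - ∑ i ∈ S, p i) * (Real.exp m * (1 - m)) ≤ 1 - ∑ i ∈ S, p i :=
    mul_le_of_le_one_right (by linarith) h0
  have h4 : 0 ≤ ∑ i ∈ S, p i := Finset.sum_nonneg hp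
  have h5 : (1 - ∑ i ∈ S, p i) * (Real.exp m * (1 - m))
      + Real.exp m * ((∑ i ∈ S, p i) * (1 - m) + m) = Real.exp m := by ring
  linarith

lemma rpow_neg_quarter_le {L x : ℝ} (hL : 1 ≤ L) (hx : L ≤ x) :
    (x ^ 2) ^ (-(1 / 4) : ℝ) ≤ L ^ (-(1 / 2) : ℝ) := by
  have h0 : 0 < x := by linarith
  rw [← Real.rpow_natCast, ← Real.rpow_mul h0.le]
  norm_num
  exact Real.rpow_le_rpow_of_nonpos (by linarith) hx (by norm_num)

/-! ## The diagonal contribution -/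

/-- A deterministic estimate. The repeated frequency is summed with the weight of the `H^σ` norm,
giving `R²`, while the four others use the pointwise decay of the coefficients. The symbol bound of
order `2s - 4` leaves `L^{-1/2}` to spare. -/
lemma norm_sum_diagonal_le {s σ R B L : ℝ} (hs : 2 ≤ s) (hσ : s - 7 / 4 ≤ σ) (hσ' : 15 / 2 ≤ σ)
    (hR : 0 ≤ R) (hB : 0 ≤ B) (hL : 1 ≤ L) {a b : Fin 6} {F : Finset (Fin 6 → Freq)}
    {c : (Fin 6 → Freq) → ℂ} (hc : SymbolBound s B L F c) (htop : ∀ k ∈ F, IsTopPair k a b)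
    (heq : ∀ k ∈ F, k a = k b) {v : Freq → ℂ} (hv : SobolevLe σ R v) :
    ‖∑ k ∈ F, c k * sexticMonomial v k‖
      ≤ B * (s + 2) * R ^ 4 * L ^ (-(1 / 2) : ℝ) * (R ^ 2 * bracketSum ^ 5) := by
  classical
  rcases F.eq_empty_or_nonempty with rfl | ⟨k₀, hk₀⟩
  · have := one_le_bracketSum
    simp only [Finset.sum_empty, norm_zero]
    positivity
  have hab := (htop k₀ hk₀).ne
  let f : Fin 6 → Freq → ℝ := fun j k =>
    if j = a then bracketSq k ^ σ * ‖v k‖ ^ 2 else bracketSq k ^ (-(7 / 4) : ℝ)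
  let C : Fin 6 → ℝ := fun j => if j = a then R ^ 2 else bracketSum
  have hf : ∀ j k, 0 ≤ f j k := by
    intro j k
    have := bracketSq_pos k
    simp only [f]
    split_ifs <;> positivity
  have hfC : ∀ j (S : Finset Freq), ∑ k ∈ S, f j k ≤ C j := by
    intro j S
    by_cases hj : j = a
    · simpa [f, C, hj] using hv S
    · simpa [f, C, hj] using sum_bracketSq_le S
  have hC : ∏ j, C j = R ^ 2 * bracketSum ^ 5 := by
    rw [prod_eq_mul_others hab, Finset.prod_congr rfl (g := fun _ => bracketSum)
      (fun j hj => by simp [C, (mem_others.1 hj).2]), Finset.prod_const, card_others hab]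
    simp only [C, if_true, if_neg hab.symm]
    ring
  -- The entry `b` duplicates `a` and must not be summed again. Replacing it by `0` loses no
  -- information, and the weight attached to the frequency `0` is `1`.
  let φ : (Fin 6 → Freq) → (Fin 6 → Freq) := fun k => Function.update k b 0
  have hφ : Set.InjOn φ F := by
    intro k hk k' hk' h
    have h1 : ∀ j, j ≠ b → k j = k' j := by
      intro j hj
      simpa [φ, hj] using congrFun h j
    funext j
    by_cases hj : j = b
    · rw [hj, ← heq k hk, ← heq k' hk', h1 a hab]
    · exact h1 j hj
  have hterm : ∀ k ∈ F, ‖c k * sexticMonomial v k‖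
      ≤ B * (s + 2) * R ^ 4 * L ^ (-(1 / 2) : ℝ) * ∏ j, f j (φ k j) := by
    intro k hk
    have hka := hc.le_left hk (htop k hk)
    have h1 := (hc.norm_le k hk).trans (mul_le_mul_of_nonneg_left
      (abs_psi_div_Omega_le_of_eq hs (htop k hk) (hc.zeroSum k hk) (heq k hk)) hB)
    have hq : 0 < freqNorm (k a) ^ 2 := by have : 0 < freqNorm (k a) := by linarith
                                           positivity
    have h2 : (freqNorm (k a) ^ 2) ^ (s - 2) ≤ L ^ (-(1 / 2) : ℝ) * bracketSq (k a) ^ σ := by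
      -- The quarter power produces `L^{-1/2}`; the rest must be dominated by the Sobolev weight,
      -- whence the threshold `s - 7/4`.
      have e : s - 2 = -(1 / 4) + (s - 7 / 4) := by ring
      rw [e, Real.rpow_add hq]
      refine mul_le_mul (rpow_neg_quarter_le hL hka) ?_ (Real.rpow_nonneg hq.le _)
        (Real.rpow_nonneg (by linarith) _)
      calc _ ≤ bracketSq (k a) ^ (s - 7 / 4) :=
            Real.rpow_le_rpow hq.le (by unfold bracketSq; linarith) (by linarith)
        _ ≤ _ := Real.rpow_le_rpow_of_exponent_le (one_le_bracketSq _) hσ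
    -- The decay needed is `2 - σ/2 ≤ -7/4`, which is the condition `σ ≥ 15/2`.
    have h3 : ∀ j, bracketSq (k j) ^ 2 * ‖v (k j)‖ ≤ R * bracketSq (k j) ^ (-(7 / 4) : ℝ) := by
      intro j
      have hJ := bracketSq_pos (k j)
      calc _ ≤ bracketSq (k j) ^ 2 * (R * bracketSq (k j) ^ (-(σ / 2))) :=
            mul_le_mul_of_nonneg_left (hv.norm_le hR _) (by positivity)
        _ = R * bracketSq (k j) ^ (2 + -(σ / 2)) := by
            rw [Real.rpow_add hJ, Real.rpow_two]; ring
        _ ≤ _ := mul_le_mul_of_nonneg_left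
            (Real.rpow_le_rpow_of_exponent_le (one_le_bracketSq _) (by linarith)) hR
    have h4 : ∏ j ∈ others a b, (bracketSq (k j) ^ 2 * ‖v (k j)‖)
        ≤ R ^ 4 * ∏ j ∈ others a b, bracketSq (k j) ^ (-(7 / 4) : ℝ) := by
      have h5 := Finset.prod_le_prod (s := others a b)
        (fun j _ => by have := bracketSq_pos (k j); positivity) (fun j _ => h3 j)
      rwa [Finset.prod_mul_distrib (f := fun _ => R), Finset.prod_const, card_others hab] at h5
    have h6 : ‖sexticMonomial v k‖ = ‖v (k a)‖ ^ 2 * ∏ j ∈ others a b, ‖v (k j)‖ := by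
      rw [sexticMonomial, norm_prod, prod_eq_mul_others hab]
      simp only [norm_conjIf]
      rw [← heq k hk]
      ring
    have h7 : ∏ j, f j (φ k j) = bracketSq (k a) ^ σ * ‖v (k a)‖ ^ 2 *
        ∏ j ∈ others a b, bracketSq (k j) ^ (-(7 / 4) : ℝ) := by
      rw [prod_eq_mul_others hab]
      have h8 : ∏ j ∈ others a b, f j (φ k j)
          = ∏ j ∈ others a b, bracketSq (k j) ^ (-(7 / 4) : ℝ) :=
        Finset.prod_congr rfl fun j hj => by
          simp [f, φ, (mem_others.1 hj).1, (mem_others.1 hj).2]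
      rw [h8]
      simp [f, φ, hab, hab.symm, bracketSq, freqNorm]
    rw [h7, norm_mul, h6]
    have hP : 0 ≤ ∏ j ∈ others a b, bracketSq (k j) ^ 2 :=
      Finset.prod_nonneg fun j _ => sq_nonneg _
    have hs2 : 0 ≤ s + 2 := by linarith
    calc _ ≤ B * ((s + 2) * (L ^ (-(1 / 2) : ℝ) * bracketSq (k a) ^ σ) *
          ∏ j ∈ others a b, bracketSq (k j) ^ 2) *
          (‖v (k a)‖ ^ 2 * ∏ j ∈ others a b, ‖v (k j)‖) := by
          refine mul_le_mul_of_nonneg_right (h1.trans ?_) (by positivity)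
          gcongr
      _ = B * (s + 2) * L ^ (-(1 / 2) : ℝ) * (bracketSq (k a) ^ σ * ‖v (k a)‖ ^ 2) *
          ∏ j ∈ others a b, (bracketSq (k j) ^ 2 * ‖v (k j)‖) := by
          rw [Finset.prod_mul_distrib]; ring
      _ ≤ B * (s + 2) * L ^ (-(1 / 2) : ℝ) * (bracketSq (k a) ^ σ * ‖v (k a)‖ ^ 2) *
          (R ^ 4 * ∏ j ∈ others a b, bracketSq (k j) ^ (-(7 / 4) : ℝ)) := by
          have := bracketSq_pos (k a)
          have : 0 ≤ L ^ (-(1 / 2) : ℝ) := Real.rpow_nonneg (by linarith) _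
          gcongr
      _ = _ := by ring
  refine (norm_sum_le _ _).trans ((Finset.sum_le_sum hterm).trans ?_)
  rw [← Finset.mul_sum, ← hC]
  refine mul_le_mul_of_nonneg_left ?_ ?_
  · rw [← Finset.sum_image (f := fun l : Fin 6 → Freq => ∏ j, f j (l j)) hφ]
    exact sum_prod_le _ f C hf hfC
  · have : 0 ≤ L ^ (-(1 / 2) : ℝ) := Real.rpow_nonneg (by linarith) _
    have : 0 ≤ s + 2 := by linarith
    positivity

/-! ## The off-diagonal contribution -/

/-- The tuple `k` with the entries `a` and `b` replaced by `0`. -/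
def lowPart (a b : Fin 6) (k : Fin 6 → Freq) : Fin 6 → Freq :=
  Function.update (Function.update k a 0) b 0

lemma lowPart_apply_of_mem {a b j : Fin 6} (hj : j ∈ others a b) (k : Fin 6 → Freq) :
    lowPart a b k j = k j := by
  rw [mem_others] at hj
  simp [lowPart, hj.1, hj.2]

lemma sgn_smul_injective (j : Fin 6) : Function.Injective fun x : Freq => sgn j • x := by
  intro x y h
  rcases sgn_eq_or j with hj | hj <;> simpa [hj] using h

lemma sgn_smul_add_sgn_smul {a b : Fin 6} (hab : a ≠ b) {k : Fin 6 → Freq}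
    (hk : k 0 - k 1 + k 2 - k 3 + k 4 - k 5 = 0) :
    sgn a • k a + sgn b • k b = -∑ j ∈ others a b, sgn j • lowPart a b k j := by
  have h := sum_sgn_eq_zero hk
  rw [sum_eq_add_others hab, ← add_assoc] at h
  rw [eq_neg_of_add_eq_zero_left h]
  congr 1
  exact Finset.sum_congr rfl fun j hj => by rw [lowPart_apply_of_mem hj]

lemma eq_of_lowPart_eq {a b : Fin 6} {k k' : Fin 6 → Freq} (h : lowPart a b k = lowPart a b k')
    (ha : k a = k' a) (hb : k b = k' b) : k = k' := by
  funext j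
  by_cases hja : j = a
  · rw [hja, ha]
  by_cases hjb : j = b
  · rw [hjb, hb]
  have hj := mem_others.2 ⟨hjb, hja⟩
  rw [← lowPart_apply_of_mem hj k, h, lowPart_apply_of_mem hj]

lemma conjIf_div_ofReal (c : Bool) (z : ℂ) (w : ℝ) :
    conjIf c (z / (w : ℂ)) = conjIf c z / (w : ℂ) := by
  cases c <;> simp [conjIf]

/-- The coefficient of `g_{k_a} g_{k_b}` in a sextic form, normalized by the other four
frequencies. -/
def quadCoeff (s : ℝ) (a b : Fin 6) (c : (Fin 6 → Freq) → ℂ) (k : Fin 6 → Freq) : ℂ :=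
  c k / ((gaussWeight s (k a) : ℂ) * (gaussWeight s (k b) : ℂ)) /
    ((∏ j ∈ others a b, bracketSq (k j) : ℝ) : ℂ)

/-- With `q = |k_a|²` and `|k_b|² ≥ q/25`, the symbol `q^{s-1}` divided by the weights is at most a
multiple of `q⁻¹`. Its square splits as `q^{-1/4} q^{-7/4}`: a gain `L^{-1/2}` and a factor summable
over `ℤ³`. -/
lemma norm_quadCoeff_sq_le {s B L : ℝ} (hs : 1 ≤ s) (hB : 0 ≤ B) (hL : 1 ≤ L) {a b : Fin 6}
    {F : Finset (Fin 6 → Freq)} {c : (Fin 6 → Freq) → ℂ} (hc : SymbolBound s B L F c)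
    {k : Fin 6 → Freq} (hk : k ∈ F) (htop : IsTopPair k a b) :
    ‖quadCoeff s a b c k‖ ^ 2 ≤ 4 * (B * (s + 2) * 25 ^ (s / 2)) ^ 2 * L ^ (-(1 / 2) : ℝ) *
      bracketSq (k a) ^ (-(7 / 4) : ℝ) := by
  have hka := hc.le_left hk htop
  have hka0 : 0 < freqNorm (k a) := by linarith
  set q := freqNorm (k a) ^ 2 with hq
  have hq1 : 1 ≤ q := by rw [hq]; nlinarith
  have hq0 : 0 < q := by linarith
  have hP : 0 < ∏ j ∈ others a b, bracketSq (k j) :=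
    Finset.prod_pos fun j _ => bracketSq_pos _
  have hqb : q / 25 ≤ freqNorm (k b) ^ 2 := by
    have := htop.sq_le (hc.zeroSum k hk)
    linarith
  have hcoef := (hc.norm_le k hk).trans
    (mul_le_mul_of_nonneg_left (abs_psi_div_Omega_le hs htop) hB)
  have hwa := le_gaussWeight s (k a)
  have hwb : (q / 25) ^ (s / 2) ≤ gaussWeight s (k b) :=
    (Real.rpow_le_rpow (by positivity) hqb (by linarith)).trans (le_gaussWeight s (k b))
  rw [← hq] at hwa hcoef
  have hbr : q ^ (-(1 / 4) : ℝ) ≤ L ^ (-(1 / 2) : ℝ) := rpow_neg_quarter_le hL hka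
  have hJ : bracketSq (k a) = 1 + q := rfl
  have hJq : bracketSq (k a) / 2 ≤ q := by rw [hJ]; linarith
  have hJ0 := bracketSq_pos (k a)
  clear_value q
  have h25 : (0 : ℝ) < 25 ^ (s / 2) := by positivity
  have hd : ‖quadCoeff s a b c k‖ ≤ B * (s + 2) * 25 ^ (s / 2) * q⁻¹ := by
    have hwa0 := gaussWeight_pos s (k a)
    have hwb0 := gaussWeight_pos s (k b)
    rw [quadCoeff, norm_div, norm_div, norm_mul, Complex.norm_real, Complex.norm_real,
      Complex.norm_real, Real.norm_of_nonneg hwa0.le, Real.norm_of_nonneg hwb0.le,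
      Real.norm_of_nonneg hP.le, div_le_iff₀ hP, div_le_iff₀ (mul_pos hwa0 hwb0)]
    refine hcoef.trans ?_
    have h1 : q ^ (s - 1) = 25 ^ (s / 2) * q⁻¹ * (q ^ (s / 2) * (q / 25) ^ (s / 2)) := by
      rw [Real.div_rpow hq0.le (by norm_num), Real.rpow_sub_one hq0.ne']
      have : q ^ s = q ^ (s / 2) * q ^ (s / 2) := by rw [← Real.rpow_add hq0, add_halves]
      rw [this]
      field_simp
    rw [h1]
    have h2 : q ^ (s / 2) * (q / 25) ^ (s / 2) ≤ gaussWeight s (k a) * gaussWeight s (k b) :=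
      mul_le_mul hwa hwb (by positivity) hwa0.le
    have hs2 : 0 ≤ s + 2 := by linarith
    have hq' : 0 ≤ q⁻¹ := inv_nonneg.2 hq0.le
    generalize (25 : ℝ) ^ (s / 2) = E at h25 ⊢
    generalize ∏ j ∈ others a b, bracketSq (k j) = P at hP ⊢
    generalize gaussWeight s (k a) * gaussWeight s (k b) = W at h2 ⊢
    generalize q ^ (s / 2) * (q / 25) ^ (s / 2) = V at h2 ⊢
    have h3 := mul_le_mul_of_nonneg_left h2
      (mul_nonneg (mul_nonneg (mul_nonneg (mul_nonneg hB hs2) h25.le) hq') hP.le)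
    linarith
  have hq2 : (q⁻¹) ^ 2 ≤ L ^ (-(1 / 2) : ℝ) * (4 * bracketSq (k a) ^ (-(7 / 4) : ℝ)) := by
    have h1 : (q⁻¹) ^ 2 = q ^ (-(1 / 4) : ℝ) * q ^ (-(7 / 4) : ℝ) := by
      rw [← Real.rpow_add hq0, ← Real.rpow_neg_one, ← Real.rpow_natCast, ← Real.rpow_mul hq0.le]
      norm_num
    have h2 : q ^ (-(7 / 4) : ℝ) ≤ 4 * bracketSq (k a) ^ (-(7 / 4) : ℝ) := by
      have h3 : (2 : ℝ) ^ (7 / 4 : ℝ) ≤ 2 ^ (2 : ℝ) :=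
        Real.rpow_le_rpow_of_exponent_le one_le_two (by norm_num)
      rw [Real.rpow_two] at h3
      have h4 : bracketSq (k a) ^ (7 / 4 : ℝ) ≤ (2 * q) ^ (7 / 4 : ℝ) :=
        Real.rpow_le_rpow hJ0.le (by linarith) (by norm_num)
      rw [Real.mul_rpow zero_le_two hq0.le] at h4
      have h5 : 0 < q ^ (7 / 4 : ℝ) := Real.rpow_pos_of_pos hq0 _
      have h6 : 0 < bracketSq (k a) ^ (7 / 4 : ℝ) := Real.rpow_pos_of_pos hJ0 _
      rw [Real.rpow_neg hq0.le, Real.rpow_neg hJ0.le, inv_eq_one_div, ← div_eq_mul_inv,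
        div_le_div_iff₀ h5 h6]
      nlinarith
    rw [h1]
    exact mul_le_mul hbr h2 (Real.rpow_nonneg hq0.le _) (Real.rpow_nonneg (by linarith) _)
  have hfin : ∀ D x y z : ℝ, 0 ≤ x → x ≤ D * y → y ^ 2 ≤ z → x ^ 2 ≤ D ^ 2 * z := by
    intro D x y z hx hxy hyz
    have h1 := pow_le_pow_left₀ hx hxy 2
    rw [mul_pow] at h1
    exact h1.trans (mul_le_mul_of_nonneg_left hyz (sq_nonneg D))
  refine (hfin _ _ _ _ (norm_nonneg _) hd hq2).trans (le_of_eq ?_)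
  ring

/-- With the low frequencies fixed, either of `k_a`, `k_b` determines the other, so both index maps
are injective and the coefficients are square summable as a function of `k_a` alone. The factor
`L^{1/4}` exactly uses up their gain `L^{-1/2}`. -/
lemma lintegral_exp_offdiagonal_fiber_le {s B L τ : ℝ} (hs : 1 ≤ s) (hB : 0 ≤ B) (hL : 1 ≤ L)
    (hτ : τ ^ 2 * (4 * (B * (s + 2) * 25 ^ (s / 2)) ^ 2 * bracketSum) ≤ 1 / 32) {a b : Fin 6}
    {F : Finset (Fin 6 → Freq)} {c : (Fin 6 → Freq) → ℂ} (hc : SymbolBound s B L F c)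
    (htop : ∀ k ∈ F, IsTopPair k a b) (hne : ∀ k ∈ F, k a ≠ k b) (b₁ b₂ : Bool)
    (l : Fin 6 → Freq) (hl : ∀ k ∈ F, lowPart a b k = l) :
    ∫⁻ g, ENNReal.ofReal (Real.exp ‖∑ k ∈ F, ((τ * L ^ (1 / 4 : ℝ) : ℝ) : ℂ) *
        quadCoeff s a b c k * conjIf b₁ (g (k a)) * conjIf b₂ (g (k b))‖) ∂gaussianFamily
      ≤ ENNReal.ofReal (2 * Real.exp 1) := by
  classical
  rcases F.eq_empty_or_nonempty with rfl | ⟨k₀, hk₀⟩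
  · simp only [Finset.sum_empty, norm_zero, Real.exp_zero, lintegral_const, measure_univ, mul_one]
    exact ENNReal.ofReal_le_ofReal (by linarith [Real.add_one_le_exp 1])
  have hab := (htop k₀ hk₀).ne
  have hrel : ∀ k ∈ F, sgn a • k a + sgn b • k b = -∑ j ∈ others a b, sgn j • l j := by
    intro k hk
    rw [← hl k hk]
    exact sgn_smul_add_sgn_smul hab (hc.zeroSum k hk)
  have hinja : Set.InjOn (fun k : Fin 6 → Freq => k a) F := by
    intro k hk k' hk' (h : k a = k' a)
    refine eq_of_lowPart_eq ((hl k hk).trans (hl k' hk').symm) h (sgn_smul_injective b ?_)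
    have := (hrel k hk).trans (hrel k' hk').symm
    rw [h] at this
    exact add_left_cancel this
  have hinjb : Set.InjOn (fun k : Fin 6 → Freq => k b) F := by
    intro k hk k' hk' (h : k b = k' b)
    refine eq_of_lowPart_eq ((hl k hk).trans (hl k' hk').symm) (sgn_smul_injective a ?_) h
    have := (hrel k hk).trans (hrel k' hk').symm
    rw [h] at this
    exact add_right_cancel this
  obtain ⟨col, hcol⟩ := exists_coloring (sgn a) (sgn b) (sgn_eq_or a) (sgn_eq_or b)
    (-∑ j ∈ others a b, sgn j • l j)
  refine lintegral_exp_norm_quadratic_le F (fun k => k a) (fun k => k b) _ b₁ b₂ col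
    (fun k hk => hcol _ _ (hrel k hk) (hne k hk)) hinja hinjb ?_
  simp only [norm_mul, mul_pow, Complex.norm_real, Real.norm_eq_abs, sq_abs, ← Finset.mul_sum]
  have h1 : ∑ k ∈ F, ‖quadCoeff s a b c k‖ ^ 2
      ≤ 4 * (B * (s + 2) * 25 ^ (s / 2)) ^ 2 * L ^ (-(1 / 2) : ℝ) * bracketSum := by
    refine (Finset.sum_le_sum fun k hk =>
      norm_quadCoeff_sq_le hs hB hL hc hk (htop k hk)).trans ?_
    rw [← Finset.mul_sum]
    refine mul_le_mul_of_nonneg_left ?_ ?_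
    · rw [← Finset.sum_image (f := fun k : Freq => bracketSq k ^ (-(7 / 4) : ℝ)) hinja]
      exact sum_bracketSq_le _
    · have : 0 ≤ L ^ (-(1 / 2) : ℝ) := Real.rpow_nonneg (by linarith) _
      positivity
  have hL0 : 0 < L := by linarith
  have h2 : (L ^ (1 / 4 : ℝ)) ^ 2 * L ^ (-(1 / 2) : ℝ) = 1 := by
    rw [← Real.rpow_natCast, ← Real.rpow_mul hL0.le, ← Real.rpow_add hL0]
    norm_num
  calc _ ≤ τ ^ 2 * (L ^ (1 / 4 : ℝ)) ^ 2 *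
        (4 * (B * (s + 2) * 25 ^ (s / 2)) ^ 2 * L ^ (-(1 / 2) : ℝ) * bracketSum) :=
        mul_le_mul_of_nonneg_left h1 (by positivity)
    _ = τ ^ 2 * (4 * (B * (s + 2) * 25 ^ (s / 2)) ^ 2 * bracketSum) *
        ((L ^ (1 / 4 : ℝ)) ^ 2 * L ^ (-(1 / 2) : ℝ)) := by ring
    _ ≤ 1 / 32 := by rw [h2, mul_one]; exact hτ

lemma measurable_sum_conjIf {ι : Type*} (F : Finset ι) (α β : ι → Freq) (d : ι → ℂ)
    (b₁ b₂ : Bool) :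
    Measurable fun g : Freq → ℂ => ∑ i ∈ F, d i * conjIf b₁ (g (α i)) * conjIf b₂ (g (β i)) :=
  Finset.measurable_sum _ fun i _ =>
    (((measurable_conjIf b₁).comp (measurable_pi_apply (α i))).const_mul _).mul
      ((measurable_conjIf b₂).comp (measurable_pi_apply (β i)))

/-- Exponential integrability of the part of a sextic form with a given pair of largest
frequencies, which are different. -/
lemma exists_exp_offdiagonal_le {s σ R B : ℝ} (hs : 1 ≤ s) (hσ : 11 / 2 ≤ σ) (hR : 0 ≤ R)
    (hB : 0 ≤ B) : ∃ κ : ℝ, 0 < κ ∧ ∀ (L : ℝ) (a b : Fin 6) (F : Finset (Fin 6 → Freq))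
      (c : (Fin 6 → Freq) → ℂ), 1 ≤ L → SymbolBound s B L F c → (∀ k ∈ F, IsTopPair k a b) →
      (∀ k ∈ F, k a ≠ k b) → ∃ Y : (Freq → ℂ) → ℝ≥0∞, Measurable Y ∧
        ∫⁻ g, Y g ∂gaussianFamily ≤ ENNReal.ofReal (1 + 2 * Real.exp 1) ∧
        ∀ g, SobolevLe σ R (gaussCoeff s g) → ENNReal.ofReal (Real.exp (κ * L ^ (1 / 4 : ℝ) *
          ‖∑ k ∈ F, c k * sexticMonomial (gaussCoeff s g) k‖)) ≤ Y g := by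
  classical
  have hZ1 := one_le_bracketSum
  have hZ0 : 0 < bracketSum := by linarith
  set D := B * (s + 2) * 25 ^ (s / 2) with hD
  have hD0 : 0 ≤ D := by have : 0 ≤ s + 2 := by linarith
                         positivity
  -- Chosen so that the sum of squares is at most `4/144 ≤ 1/32`; the `+ 1` covers `D = 0`.
  set τ := 1 / (12 * (D + 1) * bracketSum) with hτdef
  have hτ0 : 0 < τ := by positivity
  have hτ : τ ^ 2 * (4 * D ^ 2 * bracketSum) ≤ 1 / 32 := by
    rw [hτdef, div_pow, div_mul_eq_mul_div, div_le_div_iff₀ (by positivity) (by norm_num)]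
    have h1 : D ^ 2 ≤ (D + 1) ^ 2 := pow_le_pow_left₀ hD0 (by linarith) 2
    have h2 : bracketSum ≤ bracketSum ^ 2 := by nlinarith
    have h3 := mul_le_mul h1 h2 hZ0.le (by positivity)
    nlinarith
  refine ⟨τ / (bracketSum ^ 6 * (R ^ 4 + 1)), by positivity, ?_⟩
  intro L a b F c hL hc htop hne
  set κ := τ / (bracketSum ^ 6 * (R ^ 4 + 1)) with hκ
  have hκ0 : 0 < κ := by positivity
  have hL4 : 0 < L ^ (1 / 4 : ℝ) := Real.rpow_pos_of_pos (by linarith) _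
  rcases F.eq_empty_or_nonempty with rfl | ⟨k₀, hk₀⟩
  · refine ⟨fun _ => 1, measurable_const, ?_, fun g _ => by simp⟩
    simp only [lintegral_const, measure_univ, mul_one]
    rw [← ENNReal.ofReal_one]
    exact ENNReal.ofReal_le_ofReal (by linarith [Real.exp_pos 1])
  have hab := (htop k₀ hk₀).ne
  let par (j : Fin 6) : Bool := decide ((j : ℕ) % 2 = 1)
  let S := F.image (lowPart a b)
  let fib (l : Fin 6 → Freq) := F.filter fun k => lowPart a b k = l
  let Q (l : Fin 6 → Freq) (g : Freq → ℂ) : ℂ := ∑ k ∈ fib l, ((τ * L ^ (1 / 4 : ℝ) : ℝ) : ℂ) *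
    quadCoeff s a b c k * conjIf (par a) (g (k a)) * conjIf (par b) (g (k b))
  -- Weights of total mass at most one, which distribute the form over the fibers for the convexity
  -- inequality.
  let p (l : Fin 6 → Freq) : ℝ := (∏ j, bracketSq (l j) ^ (-(7 / 4) : ℝ)) / bracketSum ^ 6
  have hp : ∀ l, 0 ≤ p l := fun l => div_nonneg
    (Finset.prod_nonneg fun j _ => Real.rpow_nonneg (bracketSq_pos _).le _) (by positivity)
  have hp1 : ∑ l ∈ S, p l ≤ 1 := by
    rw [← Finset.sum_div, div_le_one (by positivity)]
    have := sum_prod_le S (fun _ : Fin 6 => fun k : Freq => bracketSq k ^ (-(7 / 4) : ℝ))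
      (fun _ => bracketSum) (fun _ k => Real.rpow_nonneg (bracketSq_pos k).le _)
      (fun _ S => sum_bracketSq_le S)
    simpa using this
  have hQm : ∀ l, Measurable fun g => ENNReal.ofReal (Real.exp ‖Q l g‖) := fun l =>
    (Real.measurable_exp.comp (measurable_sum_conjIf (fib l) (fun k => k a) (fun k => k b)
      (fun k => ((τ * L ^ (1 / 4 : ℝ) : ℝ) : ℂ) * quadCoeff s a b c k) (par a)
        (par b)).norm).ennreal_ofReal
  have hQi : ∀ l, ∫⁻ g, ENNReal.ofReal (Real.exp ‖Q l g‖) ∂gaussianFamily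
      ≤ ENNReal.ofReal (2 * Real.exp 1) := fun l =>
    lintegral_exp_offdiagonal_fiber_le hs hB hL hτ (hc.mono (Finset.filter_subset _ _))
      (fun k hk => htop k (Finset.mem_of_mem_filter k hk))
      (fun k hk => hne k (Finset.mem_of_mem_filter k hk)) _ _ l
      (fun k hk => (Finset.mem_filter.1 hk).2)
  -- The majorant is integrated against the unrestricted Gaussian law, where independence holds; the
  -- Sobolev ball enters only the pointwise comparison.
  refine ⟨fun g => 1 + ∑ l ∈ S, ENNReal.ofReal (p l) * ENNReal.ofReal (Real.exp ‖Q l g‖),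
    measurable_const.add (Finset.measurable_sum _ fun l _ => (hQm l).const_mul _), ?_, ?_⟩
  · rw [lintegral_add_left measurable_const, lintegral_finsetSum _ fun l _ => (hQm l).const_mul _]
    simp_rw [lintegral_const_mul _ (hQm _)]
    rw [ENNReal.ofReal_add zero_le_one (by positivity), ENNReal.ofReal_one]
    simp only [lintegral_const, measure_univ, mul_one]
    gcongr
    calc _ ≤ ∑ l ∈ S, ENNReal.ofReal (p l) * ENNReal.ofReal (2 * Real.exp 1) := by
          gcongr with l _
          exact hQi l
      _ = ENNReal.ofReal (∑ l ∈ S, p l) * ENNReal.ofReal (2 * Real.exp 1) := by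
          rw [← Finset.sum_mul, ENNReal.ofReal_sum_of_nonneg fun l _ => hp l]
      _ ≤ 1 * ENNReal.ofReal (2 * Real.exp 1) := by
          gcongr
          rw [← ENNReal.ofReal_one]
          exact ENNReal.ofReal_le_ofReal hp1
      _ = _ := one_mul _
  · intro g hg
    set v := gaussCoeff s g with hv
    have hfib : ∀ l ∈ S, κ * L ^ (1 / 4 : ℝ) * ‖∑ k ∈ fib l, c k * sexticMonomial v k‖
        ≤ p l * ‖Q l g‖ := by
      intro l hl
      -- The low factor is constant on the fiber and bounded by a number on the ball. Since `Q l` no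
      -- longer contains it, no independence between low and high coefficients is needed.
      let A : ℂ := ∏ j ∈ others a b, ((bracketSq (l j) : ℂ) * conjIf (par j) (v (l j)))
      have hla : l a = 0 ∧ l b = 0 := by
        obtain ⟨k, -, rfl⟩ := Finset.mem_image.1 hl
        simp [lowPart, hab]
      have hA : ‖A‖ ≤ R ^ 4 * ∏ j, bracketSq (l j) ^ (-(7 / 4) : ℝ) := by
        rw [prod_eq_mul_others hab, hla.1, hla.2]
        have h0 : bracketSq 0 ^ (-(7 / 4) : ℝ) = 1 := by simp [bracketSq, freqNorm]
        rw [h0, one_mul, one_mul, norm_prod]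
        have h1 : ∀ j, ‖(bracketSq (l j) : ℂ) * conjIf (par j) (v (l j))‖
            ≤ R * bracketSq (l j) ^ (-(7 / 4) : ℝ) := by
          intro j
          have hJ := bracketSq_pos (l j)
          rw [norm_mul, norm_conjIf, Complex.norm_real, Real.norm_of_nonneg hJ.le]
          calc _ ≤ bracketSq (l j) * (R * bracketSq (l j) ^ (-(σ / 2))) :=
                mul_le_mul_of_nonneg_left (hg.norm_le hR _) hJ.le
            _ = R * bracketSq (l j) ^ (1 + -(σ / 2)) := by
                rw [Real.rpow_add hJ, Real.rpow_one]; ring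
            _ ≤ _ := mul_le_mul_of_nonneg_left
                (Real.rpow_le_rpow_of_exponent_le (one_le_bracketSq _) (by linarith)) hR
        have h2 := Finset.prod_le_prod (s := others a b) (fun j _ => norm_nonneg _)
          (fun j _ => h1 j)
        rwa [Finset.prod_mul_distrib (f := fun _ => R), Finset.prod_const, card_others hab] at h2
      have hsum : ((τ * L ^ (1 / 4 : ℝ) : ℝ) : ℂ) * ∑ k ∈ fib l, c k * sexticMonomial v k
          = A * Q l g := by
        rw [Finset.mul_sum, Finset.mul_sum]
        refine Finset.sum_congr rfl fun k hk => ?_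
        have hkl : lowPart a b k = l := (Finset.mem_filter.1 hk).2
        have hA' : A = ((∏ j ∈ others a b, bracketSq (k j) : ℝ) : ℂ) *
            ∏ j ∈ others a b, conjIf (par j) (v (k j)) := by
          push_cast
          rw [← Finset.prod_mul_distrib]
          refine Finset.prod_congr rfl fun j hj => ?_
          rw [← hkl, lowPart_apply_of_mem hj]
        have hP : ((∏ j ∈ others a b, bracketSq (k j) : ℝ) : ℂ) ≠ 0 := by
          have : 0 < ∏ j ∈ others a b, bracketSq (k j) :=
            Finset.prod_pos fun j _ => bracketSq_pos _
          exact_mod_cast this.ne'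
        have hwa : (gaussWeight s (k a) : ℂ) ≠ 0 := by exact_mod_cast (gaussWeight_pos s _).ne'
        have hwb : (gaussWeight s (k b) : ℂ) ≠ 0 := by exact_mod_cast (gaussWeight_pos s _).ne'
        rw [hA', sexticMonomial, prod_eq_mul_others hab, quadCoeff]
        have hva : conjIf (par a) (v (k a)) = conjIf (par a) (g (k a)) / gaussWeight s (k a) :=
          conjIf_div_ofReal _ _ _
        have hvb : conjIf (par b) (v (k b)) = conjIf (par b) (g (k b)) / gaussWeight s (k b) :=
          conjIf_div_ofReal _ _ _
        change _ * (_ * (conjIf (par a) (v (k a)) * (conjIf (par b) (v (k b)) *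
          ∏ j ∈ others a b, conjIf (par j) (v (k j))))) = _
        rw [hva, hvb]
        generalize ((∏ j ∈ others a b, bracketSq (k j) : ℝ) : ℂ) = P at hP ⊢
        field_simp
      have hnorm := congrArg norm hsum
      rw [norm_mul, norm_mul, Complex.norm_real, Real.norm_of_nonneg (by positivity)] at hnorm
      have h1 : κ = (bracketSum ^ 6 * (R ^ 4 + 1))⁻¹ * τ := by rw [hκ, div_eq_inv_mul]
      calc κ * L ^ (1 / 4 : ℝ) * ‖∑ k ∈ fib l, c k * sexticMonomial v k‖
          = (bracketSum ^ 6 * (R ^ 4 + 1))⁻¹ * (‖A‖ * ‖Q l g‖) := by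
            rw [← hnorm, h1]; ring
        _ ≤ (bracketSum ^ 6 * (R ^ 4 + 1))⁻¹ *
            (((R ^ 4 + 1) * ∏ j, bracketSq (l j) ^ (-(7 / 4) : ℝ)) * ‖Q l g‖) := by
            have h2 : ‖A‖ ≤ (R ^ 4 + 1) * ∏ j, bracketSq (l j) ^ (-(7 / 4) : ℝ) :=
              hA.trans (mul_le_mul_of_nonneg_right (by linarith) (Finset.prod_nonneg
                fun j _ => Real.rpow_nonneg (bracketSq_pos _).le _))
            gcongr
        _ = p l * ‖Q l g‖ := by
            simp only [p]
            field_simp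
    have hsplit : ∑ k ∈ F, c k * sexticMonomial v k
        = ∑ l ∈ S, ∑ k ∈ fib l, c k * sexticMonomial v k :=
      (Finset.sum_fiberwise_of_maps_to (fun k hk => Finset.mem_image_of_mem _ hk) _).symm
    have hle : κ * L ^ (1 / 4 : ℝ) * ‖∑ k ∈ F, c k * sexticMonomial v k‖
        ≤ ∑ l ∈ S, p l * ‖Q l g‖ := by
      rw [hsplit]
      refine (mul_le_mul_of_nonneg_left (norm_sum_le _ _) (by positivity)).trans ?_
      rw [Finset.mul_sum]
      exact Finset.sum_le_sum hfib
    calc _ ≤ ENNReal.ofReal (1 + ∑ l ∈ S, p l * Real.exp ‖Q l g‖) :=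
          ENNReal.ofReal_le_ofReal ((Real.exp_le_exp.2 hle).trans
            (exp_sum_mul_le S p _ (fun l _ => hp l) hp1))
      _ = 1 + ∑ l ∈ S, ENNReal.ofReal (p l) * ENNReal.ofReal (Real.exp ‖Q l g‖) := by
          rw [ENNReal.ofReal_add zero_le_one (Finset.sum_nonneg fun l _ =>
            mul_nonneg (hp l) (Real.exp_pos _).le), ENNReal.ofReal_one,
            ENNReal.ofReal_sum_of_nonneg fun l _ => mul_nonneg (hp l) (Real.exp_pos _).le]
          simp_rw [ENNReal.ofReal_mul (hp _)]

/-! ### Assembling the diagonal and off-diagonal contributions. -/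

/-- Exponential integrability of sextic forms of Gaussian coefficients with symbol
`O(ψ_{2s} / Ω)` and a frequency of size at least `L`. -/
lemma exists_exp_sextic_le {s σ R B : ℝ} (hs : 2 ≤ s) (hσ : s - 7 / 4 ≤ σ) (hσ' : 15 / 2 ≤ σ)
    (hR : 0 ≤ R) (hB : 0 ≤ B) : ∃ κ C : ℝ, 0 < κ ∧ ∀ (L : ℝ) (F : Finset (Fin 6 → Freq))
      (c : (Fin 6 → Freq) → ℂ), 1 ≤ L → SymbolBound s B L F c →
      ∃ Y : (Freq → ℂ) → ℝ≥0∞, Measurable Y ∧ ∫⁻ g, Y g ∂gaussianFamily ≤ ENNReal.ofReal C ∧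
        ∀ g, SobolevLe σ R (gaussCoeff s g) → ENNReal.ofReal (Real.exp (κ * L ^ (1 / 4 : ℝ) *
          ‖∑ k ∈ F, c k * sexticMonomial (gaussCoeff s g) k‖)) ≤ Y g := by
  classical
  obtain ⟨κ, hκ, hoff⟩ := exists_exp_offdiagonal_le (s := s) (σ := σ) (by linarith)
    (by linarith) hR hB
  set E := B * (s + 2) * R ^ 4 * (R ^ 2 * bracketSum ^ 5) with hE
  have hE0 : 0 ≤ E := by
    have := one_le_bracketSum
    have : 0 ≤ s + 2 := by linarith
    positivity
  refine ⟨κ / 36, 1 + Real.exp (κ * E) * (1 + 2 * Real.exp 1), by positivity, ?_⟩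
  intro L F c hL hc
  -- Ties are resolved by a choice of one top pair per tuple, which partitions the tuples into `36`
  -- classes; the exponential of the sum is then split by averaging over the classes.
  choose pr hpr using exists_isTopPair
  let Fp (p : Fin 6 × Fin 6) := F.filter fun k => pr k = p
  let D (p : Fin 6 × Fin 6) := (Fp p).filter fun k => k p.1 = k p.2
  let O (p : Fin 6 × Fin 6) := (Fp p).filter fun k => ¬ k p.1 = k p.2
  have hFp : ∀ p, Fp p ⊆ F := fun p => Finset.filter_subset _ _
  have htop : ∀ p, ∀ k ∈ Fp p, IsTopPair k p.1 p.2 := by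
    intro p k hk
    rw [← (Finset.mem_filter.1 hk).2]
    exact hpr k
  have hO := fun p => hoff L p.1 p.2 (O p) c hL
    (hc.mono ((Finset.filter_subset _ _).trans (hFp p)))
    (fun k hk => htop p k (Finset.mem_of_mem_filter k hk)) (fun k hk => (Finset.mem_filter.1 hk).2)
  choose Y hYm hYi hY using hO
  have hexp := (Real.exp_pos (κ * E)).le
  refine ⟨fun g => 1 + ∑ p, ENNReal.ofReal (1 / 36) * (ENNReal.ofReal (Real.exp (κ * E)) * Y p g),
    measurable_const.add (Finset.measurable_sum _ fun p _ => ((hYm p).const_mul _).const_mul _),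
    ?_, ?_⟩
  · rw [lintegral_add_left measurable_const,
      lintegral_finsetSum _ fun p _ => ((hYm p).const_mul _).const_mul _]
    simp_rw [lintegral_const_mul _ ((hYm _).const_mul _), lintegral_const_mul _ (hYm _)]
    rw [ENNReal.ofReal_add zero_le_one (by positivity), ENNReal.ofReal_one]
    simp only [lintegral_const, measure_univ, mul_one]
    gcongr
    calc _ ≤ ∑ _p : Fin 6 × Fin 6, ENNReal.ofReal (1 / 36) *
          (ENNReal.ofReal (Real.exp (κ * E)) * ENNReal.ofReal (1 + 2 * Real.exp 1)) := by
          gcongr with p _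
          exact hYi p
      _ = _ := by
          rw [← ENNReal.ofReal_mul hexp, ← ENNReal.ofReal_mul (by norm_num),
            ← ENNReal.ofReal_sum_of_nonneg fun _ _ => by positivity]
          congr 1
          simp
  · intro g hg
    set v := gaussCoeff s g
    have hL4 : 0 < L ^ (1 / 4 : ℝ) := Real.rpow_pos_of_pos (by linarith) _
    have hL2 : L ^ (1 / 4 : ℝ) * L ^ (-(1 / 2) : ℝ) ≤ 1 := by
      rw [← Real.rpow_add (by linarith)]
      exact Real.rpow_le_one_of_one_le_of_nonpos hL (by norm_num)
    let T (F' : Finset (Fin 6 → Freq)) : ℂ := ∑ k ∈ F', c k * sexticMonomial v k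
    have hT : T F = ∑ p, T (Fp p) :=
      (Finset.sum_fiberwise F pr _).symm
    have hTp : ∀ p, T (Fp p) = T (D p) + T (O p) := fun p =>
      (Finset.sum_filter_add_sum_filter_not _ _ _).symm
    have hD : ∀ p, κ * L ^ (1 / 4 : ℝ) * ‖T (D p)‖ ≤ κ * E := by
      intro p
      have h1 := norm_sum_diagonal_le hs hσ hσ' hR hB hL
        (hc.mono ((Finset.filter_subset _ _).trans (hFp p)) : SymbolBound s B L (D p) c)
        (fun k hk => htop p k (Finset.mem_of_mem_filter k hk))
        (fun k hk => (Finset.mem_filter.1 hk).2) hg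
      calc _ ≤ κ * L ^ (1 / 4 : ℝ) * (B * (s + 2) * R ^ 4 * L ^ (-(1 / 2) : ℝ) *
            (R ^ 2 * bracketSum ^ 5)) := mul_le_mul_of_nonneg_left h1 (by positivity)
        _ = κ * E * (L ^ (1 / 4 : ℝ) * L ^ (-(1 / 2) : ℝ)) := by rw [hE]; ring
        _ ≤ κ * E := mul_le_of_le_one_right (by positivity) hL2
    have hle : κ / 36 * L ^ (1 / 4 : ℝ) * ‖T F‖
        ≤ ∑ p : Fin 6 × Fin 6, 1 / 36 * (κ * E + κ * L ^ (1 / 4 : ℝ) * ‖T (O p)‖) := by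
      rw [hT]
      refine (mul_le_mul_of_nonneg_left (norm_sum_le _ _) (by positivity)).trans ?_
      rw [Finset.mul_sum]
      refine Finset.sum_le_sum fun p _ => ?_
      rw [hTp]
      have h1 := mul_le_mul_of_nonneg_left (norm_add_le (T (D p)) (T (O p)))
        (by positivity : 0 ≤ κ * L ^ (1 / 4 : ℝ))
      have h2 := hD p
      linarith
    have hJ := exp_sum_mul_le (Finset.univ : Finset (Fin 6 × Fin 6)) (fun _ => 1 / 36)
      (fun p => κ * E + κ * L ^ (1 / 4 : ℝ) * ‖T (O p)‖) (fun _ _ => by norm_num) (by simp)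
    calc _ ≤ ENNReal.ofReal (1 + ∑ p : Fin 6 × Fin 6, 1 / 36 *
          Real.exp (κ * E + κ * L ^ (1 / 4 : ℝ) * ‖T (O p)‖)) :=
          ENNReal.ofReal_le_ofReal ((Real.exp_le_exp.2 hle).trans hJ)
      _ = 1 + ∑ p : Fin 6 × Fin 6, ENNReal.ofReal (1 / 36) * (ENNReal.ofReal (Real.exp (κ * E)) *
          ENNReal.ofReal (Real.exp (κ * L ^ (1 / 4 : ℝ) * ‖T (O p)‖))) := by
          rw [ENNReal.ofReal_add zero_le_one (by positivity), ENNReal.ofReal_one,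
            ENNReal.ofReal_sum_of_nonneg fun _ _ => by positivity]
          simp_rw [Real.exp_add, ENNReal.ofReal_mul (by norm_num : (0 : ℝ) ≤ 1 / 36),
            ENNReal.ofReal_mul hexp]
      _ ≤ _ := by
          dsimp only
          gcongr with p _
          exact hY p g hg

/-! ## Fourier coefficients under the Gaussian measure -/

lemma fourierCoeff_eq_inner (u : L2Torus) (k : Freq) : fourierCoeff u k = inner ℂ (mode k) u := by
  have h := UnitAddTorus.mFourierBasis_repr (d := Fin 3) u k
  rw [HilbertBasis.repr_apply_apply, UnitAddTorus.coe_mFourierBasis] at h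
  exact h.symm

lemma measurable_fourierCoeff (k : Freq) : Measurable fun u : L2Torus => fourierCoeff u k := by
  simp_rw [fourierCoeff_eq_inner]
  exact (innerSL ℂ (mode k)).continuous.measurable

lemma measurable_sobolevNorm (σ : ℝ) : Measurable (sobolevNorm σ) := by
  unfold sobolevNorm
  refine (Measurable.tsum fun k => ?_).pow_const _
  exact (((measurable_fourierCoeff k).norm.pow_const 2).const_mul _).ennreal_ofReal

/-- By orthonormality, pairing the almost surely convergent series with a mode picks out one term.
This transfers every estimate from sequences of Gaussians to `gaussMeasure`. -/
lemma ae_fourierCoeff_randomSeries {s : ℝ} (hs : 3 / 2 < s) :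
    ∀ᵐ g ∂gaussianFamily, fourierCoeff (randomSeries s g) = gaussCoeff s g := by
  filter_upwards [ae_summable_randomSeries hs] with g hg
  funext k
  rw [fourierCoeff_eq_inner]
  have h1 := (innerSL ℂ (mode k)).hasSum hg.hasSum
  suffices h2 : (fun l => innerSL ℂ (mode k)
      ((g l / ((√(1 + freqNorm l ^ (2 * s)) : ℝ) : ℂ)) • mode l))
      = fun l => if l = k then gaussCoeff s g k else 0 by
    rw [h2] at h1
    exact h1.unique (hasSum_ite_eq k (gaussCoeff s g k))
  funext l
  rw [innerSL_apply_apply, inner_smul_right,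
    orthonormal_iff_ite.1 orthonormal_mode]
  by_cases h : k = l
  · subst h; simp [gaussCoeff, gaussWeight]
  · simp [h, Ne.symm h]

lemma lintegral_gaussMeasure {s : ℝ} (hs : 3 / 2 < s) {f : L2Torus → ℝ≥0∞} (hf : Measurable f) :
    ∫⁻ u, f u ∂gaussMeasure s = ∫⁻ g, f (randomSeries s g) ∂gaussianFamily :=
  lintegral_map' hf.aemeasurable (aemeasurable_randomSeries hs)

lemma sobolevLe_of_sobolevNorm_le {σ R : ℝ} (hR : 0 ≤ R) {u : L2Torus}
    (h : sobolevNorm σ u ≤ ENNReal.ofReal R) : SobolevLe σ R (fourierCoeff u) := by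
  intro S
  have h1 : ∑' k : Freq, ENNReal.ofReal ((1 + freqNorm k ^ 2) ^ σ * ‖fourierCoeff u k‖ ^ 2)
      ≤ ENNReal.ofReal (R ^ 2) := by
    unfold sobolevNorm at h
    have := ENNReal.rpow_le_rpow h (by norm_num : (0 : ℝ) ≤ 2)
    rw [← ENNReal.rpow_mul] at this
    norm_num at this
    rwa [← ENNReal.ofReal_pow hR] at this
  have h2 := (ENNReal.sum_le_tsum S).trans h1
  change ∑ k ∈ S, ENNReal.ofReal (bracketSq k ^ σ * ‖fourierCoeff u k‖ ^ 2) ≤ _ at h2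
  rw [← ENNReal.ofReal_sum_of_nonneg fun k _ => mul_nonneg
    (Real.rpow_nonneg (bracketSq_pos k).le _) (sq_nonneg _)] at h2
  exact (ENNReal.ofReal_le_ofReal_iff (sq_nonneg R)).1 h2

/-- The ball of radius `R` in `H^σ`. -/
def sobolevBall (σ R : ℝ) : Set L2Torus := {u | sobolevNorm σ u ≤ ENNReal.ofReal R}

lemma measurableSet_sobolevBall (σ R : ℝ) : MeasurableSet (sobolevBall σ R) :=
  measurableSet_le (measurable_sobolevNorm σ) measurable_const

lemma measurable_sum_sexticMonomial (F : Finset (Fin 6 → Freq)) (c : (Fin 6 → Freq) → ℂ) :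
    Measurable fun u : L2Torus => ∑ k ∈ F, c k * sexticMonomial (fourierCoeff u) k := by
  refine Finset.measurable_sum _ fun k _ => Measurable.const_mul ?_ _
  unfold sexticMonomial
  exact Finset.measurable_prod _ fun j _ =>
    (measurable_conjIf _).comp (measurable_fourierCoeff (k j))

/-- Exponential integrability on balls of `H^σ` of sextic forms with symbol `O(ψ_{2s} / Ω)` and a
frequency of size at least `L`. -/
lemma exists_lintegral_exp_sextic_le {s σ R B : ℝ} (hs : 2 ≤ s) (hσ : s - 7 / 4 ≤ σ)
    (hσ' : 15 / 2 ≤ σ) (hR : 0 ≤ R) (hB : 0 ≤ B) : ∃ κ C : ℝ, 0 < κ ∧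
      ∀ (L : ℝ) (F : Finset (Fin 6 → Freq)) (c : (Fin 6 → Freq) → ℂ), 1 ≤ L →
        SymbolBound s B L F c →
        ∫⁻ u in sobolevBall σ R, ENNReal.ofReal (Real.exp (κ * L ^ (1 / 4 : ℝ) *
          ‖∑ k ∈ F, c k * sexticMonomial (fourierCoeff u) k‖)) ∂gaussMeasure s
          ≤ ENNReal.ofReal C := by
  obtain ⟨κ, C, hκ, h⟩ := exists_exp_sextic_le hs hσ hσ' hR hB
  refine ⟨κ, C, hκ, fun L F c hL hc => ?_⟩
  obtain ⟨Y, hYm, hYi, hY⟩ := h L F c hL hc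
  have hs' : 3 / 2 < s := by linarith
  have hm : Measurable fun u : L2Torus => ENNReal.ofReal (Real.exp (κ * L ^ (1 / 4 : ℝ) *
      ‖∑ k ∈ F, c k * sexticMonomial (fourierCoeff u) k‖)) :=
    (Real.measurable_exp.comp
      ((measurable_sum_sexticMonomial F c).norm.const_mul _)).ennreal_ofReal
  rw [← lintegral_indicator (measurableSet_sobolevBall σ R),
    lintegral_gaussMeasure hs' (hm.indicator (measurableSet_sobolevBall σ R))]
  refine (lintegral_mono_ae ?_).trans hYi
  filter_upwards [ae_fourierCoeff_randomSeries hs'] with g hg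
  by_cases hu : randomSeries s g ∈ sobolevBall σ R
  · rw [Set.indicator_of_mem hu, hg]
    apply hY
    rw [← hg]
    exact sobolevLe_of_sobolevNorm_le hR hu
  · rw [Set.indicator_of_notMem hu]
    exact zero_le

/-- The Gaussian measure is supported in `H^σ` for `σ < s - 3/2`. -/
lemma ae_sobolevNorm_lt_top {s σ : ℝ} (hs : 3 / 2 < s) (hσ : σ < s - 3 / 2) :
    ∀ᵐ u ∂gaussMeasure s, sobolevNorm σ u < ∞ := by
  have hterm : ∀ k, Measurable fun g : Freq → ℂ =>
      ENNReal.ofReal (2 ^ s * bracketSq k ^ (-(s - σ))) * ENNReal.ofReal (‖g k‖ ^ 2) :=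
    fun k => by fun_prop
  -- The covariance uses `1 + |k|^{2s}` and the norm uses `(1 + |k|²)^s`; they are comparable, so
  -- the mean of the squared norm is a multiple of `∑ (1 + |k|²)^{σ-s}`, finite for `s - σ > 3/2`.
  have hwt : ∀ k, bracketSq k ^ s ≤ 2 ^ s * gaussWeight s k ^ 2 := by
    intro k
    have hq : 0 ≤ freqNorm k ^ 2 := sq_nonneg _
    have h0 : 0 ≤ freqNorm k ^ (2 * s) := Real.rpow_nonneg (freqNorm_nonneg k) _
    rw [gaussWeight, Real.sq_sqrt (by linarith)]
    have h1 : bracketSq k ≤ 2 * max 1 (freqNorm k ^ 2) := by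
      unfold bracketSq
      linarith [le_max_left 1 (freqNorm k ^ 2), le_max_right 1 (freqNorm k ^ 2)]
    refine (Real.rpow_le_rpow (bracketSq_pos k).le h1 (by linarith)).trans ?_
    rw [Real.mul_rpow zero_le_two (by positivity)]
    refine mul_le_mul_of_nonneg_left ?_ (by positivity)
    rcases max_cases 1 (freqNorm k ^ 2) with ⟨h, _⟩ | ⟨h, _⟩ <;> rw [h]
    · rw [Real.one_rpow]; linarith
    · rw [Real.rpow_mul (freqNorm_nonneg k), Real.rpow_two]; linarith
  have hfin : ∫⁻ g, ∑' k : Freq, ENNReal.ofReal (2 ^ s * bracketSq k ^ (-(s - σ))) *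
      ENNReal.ofReal (‖g k‖ ^ 2) ∂gaussianFamily ≠ ∞ := by
    rw [lintegral_tsum fun k => (hterm k).aemeasurable]
    have : ∀ k : Freq, ∫⁻ g, ENNReal.ofReal (2 ^ s * bracketSq k ^ (-(s - σ))) *
        ENNReal.ofReal (‖g k‖ ^ 2) ∂gaussianFamily =
        ENNReal.ofReal (2 ^ s * bracketSq k ^ (-(s - σ))) *
          ∫⁻ z, ENNReal.ofReal (‖z‖ ^ 2) ∂stdComplexGaussian := by
      intro k
      rw [lintegral_const_mul _ (by fun_prop)]
      congr 1
      exact (measurePreserving_eval_infinitePi (fun _ : Freq => stdComplexGaussian) k).lintegral_comp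
        (f := fun z => ENNReal.ofReal (‖z‖ ^ 2)) (by fun_prop)
    simp_rw [this]
    rw [ENNReal.tsum_mul_right]
    exact ENNReal.mul_ne_top ((summable_bracketSq_rpow (by linarith)).mul_left _).tsum_ofReal_ne_top
      lintegral_stdComplexGaussian.ne
  have hae := ae_lt_top (Measurable.tsum hterm) hfin
  refine (ae_map_iff (aemeasurable_randomSeries hs)
    (measurableSet_lt (measurable_sobolevNorm σ) measurable_const)).2 ?_
  filter_upwards [hae, ae_fourierCoeff_randomSeries hs] with g hg hc
  unfold sobolevNorm
  refine ENNReal.rpow_lt_top_of_nonneg (by norm_num) (ne_top_of_le_ne_top hg.ne ?_)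
  refine ENNReal.tsum_le_tsum fun k => ?_
  have hJ := bracketSq_pos k
  have hw := gaussWeight_pos s k
  rw [← ENNReal.ofReal_mul (by positivity), hc]
  apply ENNReal.ofReal_le_ofReal
  change bracketSq k ^ σ * _ ≤ _
  rw [gaussCoeff, norm_div, Complex.norm_real, Real.norm_of_nonneg hw.le, div_pow]
  have h1 : bracketSq k ^ σ = bracketSq k ^ (-(s - σ)) * bracketSq k ^ s := by
    rw [← Real.rpow_add hJ]; ring_nf
  rw [h1, mul_div_assoc', div_le_iff₀ (by positivity)]
  calc _ ≤ bracketSq k ^ (-(s - σ)) * (2 ^ s * gaussWeight s k ^ 2) * ‖g k‖ ^ 2 := by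
        gcongr
        exact hwt k
    _ = _ := by ring

/-! ## The sextic form as a finite sum -/

/-- The six-tuples of frequencies in `S` of zero alternating sum. -/
def zeroSumTuples (S : Finset Freq) : Finset (Fin 6 → Freq) :=
  (Fintype.piFinset fun _ => S).filter fun k => k 0 - k 1 + k 2 - k 3 + k 4 - k 5 = 0

lemma mem_zeroSumTuples {S : Finset Freq} {k : Fin 6 → Freq} :
    k ∈ zeroSumTuples S ↔ (∀ j, k j ∈ S) ∧ k 0 - k 1 + k 2 - k 3 + k 4 - k 5 = 0 := by
  simp [zeroSumTuples, Fintype.mem_piFinset]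

/-- The coefficient of the sextic sum. -/
def sexticCoeff (χ : ℝ → ℝ) (δ₀ s : ℝ) (m : Freq → ℝ) (k : Fin 6 → Freq) : ℂ :=
  ((1 - χ (Omega k / lam k ^ δ₀) : ℝ) : ℂ) * ((psi s k : ℂ) / (-Complex.I * (Omega k : ℂ))) *
    ((∏ j : Fin 6, m (k j) : ℝ) : ℂ)

lemma sexticTerm_eq (χ : ℝ → ℝ) (δ₀ s : ℝ) (m : Freq → ℝ) (u : L2Torus) (k : Fin 6 → Freq) :
    sexticTerm χ δ₀ s m u k = sexticCoeff χ δ₀ s m k * sexticMonomial (fourierCoeff u) k := by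
  unfold sexticTerm sexticCoeff sexticMonomial
  congr 1
  simp [Fin.prod_univ_six, conjIf]

lemma sexticForm_eq_sum (χ : ℝ → ℝ) (δ₀ s : ℝ) {m : Freq → ℝ} {S : Finset Freq}
    (hm : ∀ k, k ∉ S → m k = 0) (u : L2Torus) :
    sexticForm χ δ₀ s m u = 1 / 6 * (∑ k ∈ zeroSumTuples S,
      sexticCoeff χ δ₀ s m k * sexticMonomial (fourierCoeff u) k).im := by
  unfold sexticForm
  congr 2
  have h0 : ∀ k : Fin 6 → Freq, k ∉ zeroSumTuples S →
      Set.indicator {k : Fin 6 → Freq | k 0 - k 1 + k 2 - k 3 + k 4 - k 5 = 0}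
        (sexticTerm χ δ₀ s m u) k = 0 := by
    intro k hk
    by_cases hz : k 0 - k 1 + k 2 - k 3 + k 4 - k 5 = 0
    · have : ∃ j, k j ∉ S := by
        by_contra! h
        exact hk (mem_zeroSumTuples.2 ⟨h, hz⟩)
      obtain ⟨j, hj⟩ := this
      have hp : ∏ j : Fin 6, m (k j) = 0 := Finset.prod_eq_zero (Finset.mem_univ j) (hm _ hj)
      rw [Set.indicator_of_mem (by exact hz), sexticTerm, hp]
      simp
    · exact Set.indicator_of_notMem (s := {k : Fin 6 → Freq |
        k 0 - k 1 + k 2 - k 3 + k 4 - k 5 = 0}) hz _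
  have h1 := tsum_subtype {k : Fin 6 → Freq | k 0 - k 1 + k 2 - k 3 + k 4 - k 5 = 0}
    (sexticTerm χ δ₀ s m u)
  refine h1.trans ?_
  rw [tsum_eq_sum h0]
  refine Finset.sum_congr rfl fun k hk => ?_
  rw [Set.indicator_of_mem (by exact (mem_zeroSumTuples.1 hk).2), sexticTerm_eq]

lemma measurable_sexticForm (χ : ℝ → ℝ) (δ₀ s : ℝ) {m : Freq → ℝ} {S : Finset Freq}
    (hm : ∀ k, k ∉ S → m k = 0) : Measurable (sexticForm χ δ₀ s m) := by
  have : sexticForm χ δ₀ s m = fun u => 1 / 6 * (∑ k ∈ zeroSumTuples S,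
      sexticCoeff χ δ₀ s m k * sexticMonomial (fourierCoeff u) k).im :=
    funext (sexticForm_eq_sum χ δ₀ s hm)
  rw [this]
  exact (Complex.measurable_im.comp (measurable_sum_sexticMonomial _ _)).const_mul _

lemma norm_symbol_eq (χ : ℝ → ℝ) (δ₀ s : ℝ) (k : Fin 6 → Freq) :
    ‖((1 - χ (Omega k / lam k ^ δ₀) : ℝ) : ℂ) * ((psi s k : ℂ) / (-Complex.I * (Omega k : ℂ)))‖
      = |1 - χ (Omega k / lam k ^ δ₀)| * |psi s k / Omega k| := by
  rw [norm_mul, norm_div, norm_mul, norm_neg, Complex.norm_I, one_mul, Complex.norm_real,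
    Complex.norm_real, Complex.norm_real, Real.norm_eq_abs, Real.norm_eq_abs, Real.norm_eq_abs,
    abs_div]

lemma abs_prod_le {m : Freq → ℝ} {B : ℝ} (hm : ∀ k, |m k| ≤ B) (k : Fin 6 → Freq) :
    |∏ j, m (k j)| ≤ B ^ 6 := by
  rw [Finset.abs_prod]
  refine (Finset.prod_le_prod (fun _ _ => abs_nonneg _) fun j _ => hm (k j)).trans ?_
  simp

lemma norm_sexticCoeff_le {χ : ℝ → ℝ} {B₀ : ℝ} (hχ : ∀ x, |1 - χ x| ≤ B₀) (δ₀ s : ℝ)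
    {m : Freq → ℝ} {B : ℝ} (hm : ∀ k, |m k| ≤ B) (k : Fin 6 → Freq) :
    ‖sexticCoeff χ δ₀ s m k‖ ≤ B₀ * B ^ 6 * |psi s k / Omega k| := by
  have hB : 0 ≤ B₀ := (abs_nonneg _).trans (hχ 0)
  rw [sexticCoeff, norm_mul, norm_symbol_eq, Complex.norm_real, Real.norm_eq_abs]
  calc _ ≤ B₀ * |psi s k / Omega k| * B ^ 6 := by
        gcongr
        · exact hχ _
        · exact abs_prod_le hm k
    _ = _ := by ring

lemma norm_sexticMonomial_le {σ R : ℝ} (hσ : 0 ≤ σ) (hR : 0 ≤ R) {v : Freq → ℂ}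
    (hv : SobolevLe σ R v) (k : Fin 6 → Freq) : ‖sexticMonomial v k‖ ≤ R ^ 6 := by
  rw [sexticMonomial, norm_prod]
  have h1 : ∀ j : Fin 6, ‖conjIf (decide ((j : ℕ) % 2 = 1)) (v (k j))‖ ≤ R := by
    intro j
    rw [norm_conjIf]
    refine (hv.norm_le hR _).trans (mul_le_of_le_one_right hR ?_)
    exact Real.rpow_le_one_of_one_le_of_nonpos (one_le_bracketSq _) (by linarith)
  refine (Finset.prod_le_prod (fun _ _ => norm_nonneg _) fun j _ => h1 j).trans ?_
  simp

lemma finite_freqNorm_le (M : ℝ) : {k : Freq | freqNorm k ≤ M}.Finite := by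
  refine (Set.finite_Icc (fun _ : Fin 3 => -⌈M⌉) (fun _ => ⌈M⌉)).subset fun k hk => ?_
  have h1 : ∀ i, |(k i : ℝ)| ≤ M := fun i => by
    refine le_trans (Real.abs_le_sqrt ?_) hk
    exact Finset.single_le_sum (f := fun i => (k i : ℝ) ^ 2) (fun _ _ => sq_nonneg _)
      (Finset.mem_univ i)
  have h2 : ∀ i, |k i| ≤ ⌈M⌉ := fun i => by
    have := (h1 i).trans (Int.le_ceil M)
    exact_mod_cast this
  exact ⟨fun i => (abs_le.1 (h2 i)).1, fun i => (abs_le.1 (h2 i)).2⟩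

/-- The frequencies of length at most `M`. -/
def freqBall (M : ℝ) : Finset Freq := (finite_freqNorm_le M).toFinset

lemma mem_freqBall {M : ℝ} {k : Freq} : k ∈ freqBall M ↔ freqNorm k ≤ M := by
  simp [freqBall]

/-! ## Uniform exponential integrability and moments of differences -/

/-- Split at a height `L` independent of the truncation. Above it, the exponential rate `κ L^{1/4}`
already exceeds `q`; below it, only finitely many tuples occur and their sum is bounded on the ball.
-/
lemma exists_lintegral_exp_sexticForm_le {s σ R B B₀ : ℝ} (hs : 2 ≤ s) (hσ : s - 7 / 4 ≤ σ)
    (hσ' : 15 / 2 ≤ σ) (hR : 0 ≤ R) {χ : ℝ → ℝ} (hχ : ∀ x, |1 - χ x| ≤ B₀) (δ₀ : ℝ)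
    {q : ℝ} (hq : 0 ≤ q) :
    ∃ C : ℝ, ∀ (S : Finset Freq) (m : Freq → ℝ), (∀ k, k ∉ S → m k = 0) → (∀ k, |m k| ≤ B) →
      ∫⁻ u in sobolevBall σ R, ENNReal.ofReal (Real.exp (q * |sexticForm χ δ₀ s m u|))
        ∂gaussMeasure s ≤ ENNReal.ofReal C := by
  classical
  have hB₀ : 0 ≤ B₀ := (abs_nonneg _).trans (hχ 0)
  obtain ⟨κ, C, hκ, h⟩ := exists_lintegral_exp_sextic_le (s := s) (σ := σ) (B := B₀ * B ^ 6)
    hs hσ hσ' hR (by positivity)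
  -- The solution of `κ L^{1/4} = q`, raised to at least `1`.
  set L := max 1 ((q / κ) ^ 4) with hLdef
  have hL1 : 1 ≤ L := le_max_left _ _
  have hqL : q ≤ κ * L ^ (1 / 4 : ℝ) := by
    have h1 : ((q / κ) ^ 4) ^ (1 / 4 : ℝ) ≤ L ^ (1 / 4 : ℝ) :=
      Real.rpow_le_rpow (by positivity) (le_max_right _ _) (by norm_num)
    rw [← Real.rpow_natCast, ← Real.rpow_mul (by positivity)] at h1
    norm_num at h1
    rw [div_le_iff₀ hκ] at h1
    linarith
  let K : ℝ := ∑ k ∈ zeroSumTuples (freqBall L), B₀ * B ^ 6 * |psi s k / Omega k| * R ^ 6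
  refine ⟨Real.exp (q * K) * C, fun S m hmS hmB => ?_⟩
  let F := zeroSumTuples S
  let P : (Fin 6 → Freq) → Prop := fun k => ∃ j, L ≤ freqNorm (k j)
  let T (F' : Finset (Fin 6 → Freq)) (u : L2Torus) : ℂ :=
    ∑ k ∈ F', sexticCoeff χ δ₀ s m k * sexticMonomial (fourierCoeff u) k
  have hcoef := norm_sexticCoeff_le hχ δ₀ s hmB
  have hhigh := h L (F.filter P) (sexticCoeff χ δ₀ s m) hL1
    ⟨fun k hk => (mem_zeroSumTuples.1 (Finset.mem_of_mem_filter k hk)).2,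
      fun k hk => (Finset.mem_filter.1 hk).2, fun k _ => hcoef k⟩
  have hlow : ∀ u ∈ sobolevBall σ R, ‖T (F.filter fun k => ¬ P k) u‖ ≤ K := by
    intro u hu
    have hv := sobolevLe_of_sobolevNorm_le hR hu
    refine (norm_sum_le _ _).trans ?_
    refine (Finset.sum_le_sum fun k _ => ?_).trans (Finset.sum_le_sum_of_subset_of_nonneg
      (f := fun k => B₀ * B ^ 6 * |psi s k / Omega k| * R ^ 6) ?_ fun _ _ _ => by positivity)
    · rw [norm_mul]
      exact mul_le_mul (hcoef k) (norm_sexticMonomial_le (by linarith) hR hv k) (norm_nonneg _)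
        (by positivity)
    · intro k hk
      rw [Finset.mem_filter] at hk
      refine mem_zeroSumTuples.2 ⟨fun j => mem_freqBall.2 ?_, (mem_zeroSumTuples.1 hk.1).2⟩
      by_contra! hlt
      exact hk.2 ⟨j, hlt.le⟩
  have hpt : ∀ u ∈ sobolevBall σ R, ENNReal.ofReal (Real.exp (q * |sexticForm χ δ₀ s m u|))
      ≤ ENNReal.ofReal (Real.exp (q * K)) *
        ENNReal.ofReal (Real.exp (κ * L ^ (1 / 4 : ℝ) * ‖T (F.filter P) u‖)) := by
    intro u hu
    rw [← ENNReal.ofReal_mul (Real.exp_pos _).le, ← Real.exp_add]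
    refine ENNReal.ofReal_le_ofReal (Real.exp_le_exp.2 ?_)
    have h1 : T F u = T (F.filter P) u + T (F.filter fun k => ¬ P k) u :=
      (Finset.sum_filter_add_sum_filter_not _ _ _).symm
    have h2 : |sexticForm χ δ₀ s m u| ≤ ‖T F u‖ := by
      rw [sexticForm_eq_sum χ δ₀ s hmS, abs_mul, abs_of_pos (by norm_num : (0 : ℝ) < 1 / 6)]
      have := Complex.abs_im_le_norm (T F u)
      have := norm_nonneg (T F u)
      change 1 / 6 * |(T F u).im| ≤ _
      linarith
    have h3 := norm_add_le (T (F.filter P) u) (T (F.filter fun k => ¬ P k) u)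
    rw [← h1] at h3
    have h4 := hlow u hu
    have h5 : q * |sexticForm χ δ₀ s m u| ≤ q * (‖T (F.filter P) u‖ + K) :=
      mul_le_mul_of_nonneg_left (by linarith) hq
    have h6 := mul_le_mul_of_nonneg_right hqL (norm_nonneg (T (F.filter P) u))
    linarith
  refine (setLIntegral_mono_ae' (measurableSet_sobolevBall σ R)
    (Eventually.of_forall hpt)).trans ?_
  rw [lintegral_const_mul' _ _ ENNReal.ofReal_ne_top, ENNReal.ofReal_mul (Real.exp_pos _).le]
  exact mul_le_mul_right hhigh _

lemma pow_eight_le (κ x : ℝ) (hκ : 0 < κ) (hx : 0 ≤ x) :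
    x ^ 8 ≤ 40320 / κ ^ 8 * Real.exp (κ * x) := by
  have h1 := Real.pow_div_factorial_le_exp (κ * x) (by positivity) 8
  have h2 : (Nat.factorial 8 : ℝ) = 40320 := by norm_num [Nat.factorial]
  rw [h2, div_le_iff₀ (by norm_num), mul_pow] at h1
  rw [div_mul_eq_mul_div, le_div_iff₀ (by positivity)]
  linarith

/-- Two truncations which agree on frequencies of length less than `L` give sextic forms that are
close in `L⁸` on balls of `H^σ`. -/
lemma exists_eLpNorm_sexticForm_sub_le {s σ R B B₀ : ℝ} (hs : 2 ≤ s) (hσ : s - 7 / 4 ≤ σ)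
    (hσ' : 15 / 2 ≤ σ) (hR : 0 ≤ R) {χ : ℝ → ℝ} (hχ : ∀ x, |1 - χ x| ≤ B₀) (δ₀ : ℝ) :
    ∃ C : ℝ, 0 ≤ C ∧ ∀ (L : ℝ) (S : Finset Freq) (m m' : Freq → ℝ), 1 ≤ L →
      (∀ k, k ∉ S → m k = 0) → (∀ k, k ∉ S → m' k = 0) → (∀ k, |m k| ≤ B) → (∀ k, |m' k| ≤ B) →
      (∀ k, freqNorm k < L → m k = m' k) →
      eLpNorm (fun u => sexticForm χ δ₀ s m u - sexticForm χ δ₀ s m' u) 8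
        ((gaussMeasure s).restrict (sobolevBall σ R)) ≤ ENNReal.ofReal (C * L ^ (-(1 / 4) : ℝ)) := by
  classical
  have hB₀ : 0 ≤ B₀ := (abs_nonneg _).trans (hχ 0)
  obtain ⟨κ, C, hκ, h⟩ := exists_lintegral_exp_sextic_le (s := s) (σ := σ)
    -- The coefficients are differences of two, each bounded by `B₀ B⁶` times the symbol.
    (B := B₀ * B ^ 6 + B₀ * B ^ 6) hs hσ hσ' hR (by positivity)
  set C' := max C 0 with hC'
  have hC'0 : 0 ≤ C' := le_max_right _ _
  set A := 40320 * C' with hA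
  have hA0 : 0 ≤ A := by positivity
  refine ⟨A ^ (1 / 8 : ℝ) / κ, by positivity, fun L S m m' hL hm hm' hmB hmB' heq => ?_⟩
  have hL0 : 0 < L := by linarith
  let F := zeroSumTuples S
  let P : (Fin 6 → Freq) → Prop := fun k => ∃ j, L ≤ freqNorm (k j)
  let c : (Fin 6 → Freq) → ℂ := fun k => sexticCoeff χ δ₀ s m k - sexticCoeff χ δ₀ s m' k
  let T (u : L2Torus) : ℂ := ∑ k ∈ F.filter P, c k * sexticMonomial (fourierCoeff u) k
  set θ := κ * L ^ (1 / 4 : ℝ) with hθ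
  have hθ0 : 0 < θ := mul_pos hκ (Real.rpow_pos_of_pos hL0 _)
  have hT : ∀ u, ‖sexticForm χ δ₀ s m u - sexticForm χ δ₀ s m' u‖ ≤ ‖T u‖ := by
    intro u
    have h0 : ∑ k ∈ F, c k * sexticMonomial (fourierCoeff u) k = T u := by
      -- If all six frequencies are below `L` the two coefficients agree, so only tuples with a
      -- large frequency survive in the difference.
      refine (Finset.sum_filter_of_ne fun k hk hne => ?_).symm
      by_contra hP
      apply hne
      have : ∀ j, m (k j) = m' (k j) := fun j => heq _ (by
        by_contra! hlt
        exact hP ⟨j, hlt⟩)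
      simp [c, sexticCoeff, this]
    rw [sexticForm_eq_sum χ δ₀ s hm, sexticForm_eq_sum χ δ₀ s hm', ← mul_sub, ← Complex.sub_im,
      ← Finset.sum_sub_distrib]
    simp_rw [← sub_mul]
    change ‖1 / 6 * (∑ k ∈ F, c k * sexticMonomial (fourierCoeff u) k).im‖ ≤ _
    rw [h0, norm_mul, Real.norm_eq_abs, Real.norm_eq_abs,
      abs_of_pos (by norm_num : (0 : ℝ) < 1 / 6)]
    have := Complex.abs_im_le_norm (T u)
    have := norm_nonneg (T u)
    linarith
  have hexp := h L (F.filter P) c hL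
    ⟨fun k hk => (mem_zeroSumTuples.1 (Finset.mem_of_mem_filter k hk)).2,
      fun k hk => (Finset.mem_filter.1 hk).2, fun k _ => by
        rw [add_mul]
        exact (norm_sub_le _ _).trans (add_le_add (norm_sexticCoeff_le hχ δ₀ s hmB k)
          (norm_sexticCoeff_le hχ δ₀ s hmB' k))⟩
  have hint : ∫⁻ u in sobolevBall σ R, ‖sexticForm χ δ₀ s m u - sexticForm χ δ₀ s m' u‖ₑ ^ (8 : ℝ)
      ∂gaussMeasure s ≤ ENNReal.ofReal (40320 / θ ^ 8) * ENNReal.ofReal C' := by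
    refine le_trans ?_ (mul_le_mul_right (hexp.trans (ENNReal.ofReal_le_ofReal (le_max_left C 0))) _)
    rw [← lintegral_const_mul' _ _ ENNReal.ofReal_ne_top]
    refine lintegral_mono fun u => ?_
    rw [← ENNReal.ofReal_mul (by positivity), ← ofReal_norm,
      ENNReal.ofReal_rpow_of_nonneg (norm_nonneg _) (by norm_num)]
    apply ENNReal.ofReal_le_ofReal
    have h8 : ‖sexticForm χ δ₀ s m u - sexticForm χ δ₀ s m' u‖ ^ (8 : ℝ)
        = ‖sexticForm χ δ₀ s m u - sexticForm χ δ₀ s m' u‖ ^ 8 := by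
      rw [← Real.rpow_natCast]; norm_num
    rw [h8]
    exact (pow_le_pow_left₀ (norm_nonneg _) (hT u) 8).trans
      (pow_eight_le θ _ hθ0 (norm_nonneg _))
  rw [eLpNorm_eq_lintegral_rpow_enorm_toReal (by norm_num) (by norm_num)]
  have h8 : (8 : ℝ≥0∞).toReal = 8 := by norm_num
  rw [h8]
  refine (ENNReal.rpow_le_rpow hint (by norm_num)).trans ?_
  rw [← ENNReal.ofReal_mul (by positivity), ENNReal.ofReal_rpow_of_nonneg (by positivity)
    (by norm_num)]
  apply ENNReal.ofReal_le_ofReal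
  refine le_of_eq ?_
  have e : 40320 / θ ^ 8 * C' = A * (θ⁻¹) ^ 8 := by rw [hA]; field_simp
  rw [e, Real.mul_rpow hA0 (by positivity), ← Real.rpow_natCast, ← Real.rpow_mul (by positivity)]
  norm_num
  rw [hθ, mul_inv, ← Real.rpow_neg hL0.le]
  norm_num
  ring

/-! ## Almost sure convergence from rates in `L⁸` -/

/-- The exponent `8` turns the rate `n^{-1/4}` into the summable `n^{-2}`, so `∑ |Y n|⁸` is finite
almost everywhere. -/
lemma ae_tendsto_zero_of_eLpNorm_le {α : Type*} [MeasurableSpace α] {μ : Measure α}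
    {Y : ℕ → α → ℝ} (hY : ∀ n, AEStronglyMeasurable (Y n) μ) {C : ℝ} (hC : 0 ≤ C)
    (h : ∀ n, eLpNorm (Y n) 8 μ ≤ ENNReal.ofReal (C * ((n : ℝ) + 1) ^ (-(1 / 4) : ℝ))) :
    ∀ᵐ x ∂μ, Tendsto (fun n => Y n x) atTop (𝓝 0) := by
  have hint : ∀ n, ∫⁻ x, ‖Y n x‖ₑ ^ (8 : ℝ) ∂μ
      ≤ ENNReal.ofReal (C ^ 8 * (1 / ((n : ℝ) + 1) ^ 2)) := by
    intro n
    have h1 := ENNReal.rpow_le_rpow (h n) (by norm_num : (0 : ℝ) ≤ 8)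
    rw [eLpNorm_eq_lintegral_rpow_enorm_toReal (by norm_num) (by norm_num)] at h1
    have h8 : (8 : ℝ≥0∞).toReal = 8 := by norm_num
    rw [h8, ← ENNReal.rpow_mul, one_div_mul_cancel (by norm_num), ENNReal.rpow_one] at h1
    refine h1.trans (le_of_eq ?_)
    have hn : (0 : ℝ) < (n : ℝ) + 1 := by positivity
    rw [ENNReal.ofReal_rpow_of_nonneg (by positivity) (by norm_num), Real.mul_rpow hC
      (by positivity), ← Real.rpow_mul hn.le]
    norm_num
  have hsum : Summable fun n : ℕ => C ^ 8 * (1 / ((n : ℝ) + 1) ^ 2) := by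
    refine Summable.mul_left _ ?_
    have := (summable_nat_add_iff 1).2 (Real.summable_one_div_nat_pow.2 one_lt_two)
    simpa using this
  have hfin : ∫⁻ x, ∑' n, ‖Y n x‖ₑ ^ (8 : ℝ) ∂μ ≠ ∞ := by
    rw [lintegral_tsum fun n => ((hY n).enorm.pow_const _)]
    exact ne_top_of_le_ne_top hsum.tsum_ofReal_ne_top (ENNReal.tsum_le_tsum hint)
  have hae := ae_lt_top' (AEMeasurable.tsum fun n => ((hY n).enorm.pow_const _)) hfin
  filter_upwards [hae] with x hx
  have h1 := ENNReal.tendsto_atTop_zero_of_tsum_ne_top hx.ne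
  have h2 := (ENNReal.continuous_rpow_const (y := 1 / 8)).tendsto (0 : ℝ≥0∞) |>.comp h1
  rw [ENNReal.zero_rpow_of_pos (by norm_num)] at h2
  have h3 : Tendsto (fun n => ‖Y n x‖ₑ) atTop (𝓝 0) := by
    refine h2.congr fun n => ?_
    rw [Function.comp_apply, ← ENNReal.rpow_mul]
    norm_num
  rw [tendsto_zero_iff_enorm_tendsto_zero]
  exact h3

/-- The Cauchy rate `n^{-1/4}` is not summable, so a limit is first found along a sparse
subsequence. Fatou's lemma passes the rate to the distance from that limit, and summability of
eighth powers then gives convergence of the full sequence. -/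
lemma ae_exists_tendsto_of_eLpNorm_le {α : Type*} [MeasurableSpace α] {μ : Measure α}
    {X : ℕ → α → ℝ} (hX : ∀ n, AEStronglyMeasurable (X n) μ) {C : ℝ} (hC : 0 ≤ C)
    (h : ∀ n n', n ≤ n' →
      eLpNorm (X n - X n') 8 μ ≤ ENNReal.ofReal (C * ((n : ℝ) + 1) ^ (-(1 / 4) : ℝ))) :
    ∀ᵐ x ∂μ, ∃ l, Tendsto (fun n => X n x) atTop (𝓝 l) := by
  -- Along eighth powers the rate `n^{-1/4}` becomes `j^{-2}`.
  let φ : ℕ → ℕ := fun j => (j + 1) ^ 8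
  have hφmono : Monotone φ := fun i j hij => Nat.pow_le_pow_left (by omega) 8
  have hφle : ∀ j, j ≤ φ j := fun j =>
    (Nat.le_succ j).trans (Nat.le_self_pow (by norm_num) (j + 1))
  have hsum : Summable fun j : ℕ => (C + 1) * (1 / ((j : ℝ) + 1) ^ 2) := by
    refine Summable.mul_left _ ?_
    have := (summable_nat_add_iff 1).2 (Real.summable_one_div_nat_pow.2 one_lt_two)
    simpa using this
  have hrate : ∀ N n : ℕ, N ≤ n → C * ((φ n : ℝ) + 1) ^ (-(1 / 4) : ℝ)
      < (C + 1) * (1 / ((N : ℝ) + 1) ^ 2) := by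
    intro N n hNn
    have hN : (0 : ℝ) < (N : ℝ) + 1 := by positivity
    have h1 : ((N : ℝ) + 1) ^ 8 ≤ (φ n : ℝ) + 1 := by
      have : ((N + 1) ^ 8 : ℕ) ≤ φ n := hφmono hNn
      have h2 : (((N + 1) ^ 8 : ℕ) : ℝ) ≤ (φ n : ℝ) := by exact_mod_cast this
      push_cast at h2
      linarith
    have h2 : ((φ n : ℝ) + 1) ^ (-(1 / 4) : ℝ) ≤ 1 / ((N : ℝ) + 1) ^ 2 := by
      refine (Real.rpow_le_rpow_of_nonpos (by positivity) h1 (by norm_num)).trans (le_of_eq ?_)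
      rw [← Real.rpow_natCast, ← Real.rpow_mul hN.le]
      norm_num
    have h3 : 0 < 1 / ((N : ℝ) + 1) ^ 2 := by positivity
    nlinarith [mul_le_mul_of_nonneg_left h2 hC]
  have hcau : ∀ N n m : ℕ, N ≤ n → N ≤ m → eLpNorm (X (φ n) - X (φ m)) 8 μ
      < ENNReal.ofReal ((C + 1) * (1 / ((N : ℝ) + 1) ^ 2)) := by
    intro N n m hn hm
    have hlt : ∀ j, N ≤ j → ENNReal.ofReal (C * ((φ j : ℝ) + 1) ^ (-(1 / 4) : ℝ))
        < ENNReal.ofReal ((C + 1) * (1 / ((N : ℝ) + 1) ^ 2)) := fun j hj =>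
      (ENNReal.ofReal_lt_ofReal_iff (by positivity)).2 (hrate N j hj)
    rcases le_total n m with hnm | hnm
    · exact (h _ _ (hφmono hnm)).trans_lt (hlt n hn)
    · rw [eLpNorm_sub_comm]
      exact (h _ _ (hφmono hnm)).trans_lt (hlt m hm)
  have hsub : ∀ᵐ x ∂μ, ∃ l : ℝ, Tendsto (fun j => X (φ j) x) atTop (𝓝 l) :=
    Lp.ae_tendsto_of_cauchy_eLpNorm (fun j => hX (φ j)) (by norm_num) hsum.tsum_ofReal_ne_top hcau
  let Xl : α → ℝ := fun x => limUnder atTop fun j => X (φ j) x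
  have hlim : ∀ᵐ x ∂μ, Tendsto (fun j => X (φ j) x) atTop (𝓝 (Xl x)) := by
    filter_upwards [hsub] with x hx
    exact tendsto_nhds_limUnder hx
  have hXl : AEStronglyMeasurable Xl μ :=
    aestronglyMeasurable_of_tendsto_ae atTop (fun j => hX (φ j)) hlim
  have hbound : ∀ n, eLpNorm (X n - Xl) 8 μ
      ≤ ENNReal.ofReal (C * ((n : ℝ) + 1) ^ (-(1 / 4) : ℝ)) := by
    intro n
    refine (Lp.eLpNorm_lim_le_liminf_eLpNorm (f := fun j => X n - X (φ j))
      (fun j => (hX n).sub (hX (φ j))) (X n - Xl) ?_).trans ?_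
    · filter_upwards [hlim] with x hx
      exact tendsto_const_nhds.sub hx
    · refine (liminf_le_liminf (v := fun _ =>
        ENNReal.ofReal (C * ((n : ℝ) + 1) ^ (-(1 / 4) : ℝ))) ?_).trans (le_of_eq (by simp))
      filter_upwards [eventually_ge_atTop n] with j hj
      exact h n (φ j) (hj.trans (hφle j))
  filter_upwards [ae_tendsto_zero_of_eLpNorm_le (fun n => (hX n).sub hXl) hC hbound] with x hx
  refine ⟨Xl x, ?_⟩
  have := hx.add_const (Xl x)
  simpa using this

/-! ### From almost sure convergence to convergence in `Lᵖ`. -/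

/-- Almost sure convergence together with a bound for the squares in `Lᵖ` implies convergence in
`Lᵖ`. -/
lemma tendsto_eLpNorm_sub_of_sq_le {α : Type*} [MeasurableSpace α] {μ : Measure α}
    [IsFiniteMeasure μ] {p : ℝ≥0∞} (hp : 1 ≤ p) (hp' : p ≠ ∞) {f : ℕ → α → ℝ} {g : α → ℝ}
    (hf : ∀ n, AEStronglyMeasurable (f n) μ) {C : ℝ} (hC : 0 ≤ C)
    (hsq : ∀ n, eLpNorm (fun x => f n x ^ 2) p μ ≤ ENNReal.ofReal C)
    (hfg : ∀ᵐ x ∂μ, Tendsto (fun n => f n x) atTop (𝓝 (g x))) :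
    MemLp g p μ ∧ Tendsto (fun n => eLpNorm (f n - g) p μ) atTop (𝓝 0) := by
  have hb : ∀ n, eLpNorm (f n) p μ ≤ eLpNorm (fun _ : α => (1 : ℝ)) p μ + ENNReal.ofReal C := by
    intro n
    have habs : ∀ y : ℝ, ‖y‖ ≤ 1 + y ^ 2 := fun y => by
      rw [Real.norm_eq_abs]
      nlinarith [sq_abs y, sq_nonneg (|y| - 1)]
    have h1 : eLpNorm (f n) p μ ≤ eLpNorm ((fun _ => (1 : ℝ)) + fun x => f n x ^ 2) p μ :=
      eLpNorm_mono_real fun x => habs (f n x)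
    have h2 : AEStronglyMeasurable (fun x => f n x ^ 2) μ := (hf n).pow 2
    exact h1.trans ((eLpNorm_add_le aestronglyMeasurable_const h2 hp).trans
      (add_le_add le_rfl (hsq n)))
  have hfin : eLpNorm (fun _ : α => (1 : ℝ)) p μ + ENNReal.ofReal C < ∞ :=
    ENNReal.add_lt_top.2 ⟨(memLp_const 1).2, ENNReal.ofReal_lt_top⟩
  have hg : MemLp g p μ := by
    refine ⟨aestronglyMeasurable_of_tendsto_ae atTop hf hfg, ?_⟩
    refine (Lp.eLpNorm_lim_le_liminf_eLpNorm hf g hfg).trans_lt (lt_of_le_of_lt ?_ hfin)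
    exact (liminf_le_liminf (v := fun _ => eLpNorm (fun _ : α => (1 : ℝ)) p μ + ENNReal.ofReal C)
      (Eventually.of_forall hb)).trans (le_of_eq (by simp))
  refine ⟨hg, tendsto_Lp_finite_of_tendsto_ae hp hp' hf hg ?_ hfg⟩
  refine unifIntegrable_of hp hp' hf fun ε hε => ?_
  -- Where `|f n| ≥ (C + 1)/ε` one has `|f n| ≤ (ε/(C + 1)) |f n|²`, so the tail has norm at most `ε
  -- C/(C + 1)`, uniformly in `n`.
  have hK : 0 < (C + 1) / ε := by positivity
  refine ⟨⟨(C + 1) / ε, hK.le⟩, fun n => ?_⟩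
  have h1 : ∀ x, ‖({x | (⟨(C + 1) / ε, hK.le⟩ : NNReal) ≤ ‖f n x‖₊}.indicator (f n)) x‖
      ≤ ‖(ε / (C + 1)) • (f n x ^ 2)‖ := by
    intro x
    by_cases hx : x ∈ {x | (⟨(C + 1) / ε, hK.le⟩ : NNReal) ≤ ‖f n x‖₊}
    · rw [Set.indicator_of_mem hx]
      have hx' : (C + 1) / ε ≤ |f n x| := hx
      rw [div_le_iff₀ hε] at hx'
      have h2 : 0 ≤ ε / (C + 1) * f n x ^ 2 := by positivity
      rw [smul_eq_mul, Real.norm_of_nonneg h2, Real.norm_eq_abs,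
        div_mul_eq_mul_div, le_div_iff₀ (by positivity), ← sq_abs]
      nlinarith [abs_nonneg (f n x)]
    · rw [Set.indicator_of_notMem hx, norm_zero]
      exact norm_nonneg _
  refine (eLpNorm_mono h1).trans ?_
  refine (eLpNorm_const_smul_le (c := ε / (C + 1)) (f := fun x => f n x ^ 2)).trans ?_
  rw [Real.enorm_eq_ofReal (by positivity)]
  refine (mul_le_mul_right (hsq n) _).trans ?_
  rw [← ENNReal.ofReal_mul (by positivity)]
  apply ENNReal.ofReal_le_ofReal
  rw [div_mul_eq_mul_div, div_le_iff₀ (by positivity)]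
  nlinarith

lemma eLpNorm_le_of_exp_le {α : Type*} [MeasurableSpace α] {μ : Measure α} {p : ℝ≥0∞}
    (hp : 1 ≤ p) (hp' : p ≠ ∞) {A q C : ℝ} (hA : 0 ≤ A) {S : Set α} (hS : MeasurableSet S)
    {f X : α → ℝ} (hf0 : ∀ x, x ∉ S → f x = 0)
    (hf : ∀ x ∈ S, |f x| ≤ A * Real.exp (q * |X x|))
    (hX : ∫⁻ x in S, ENNReal.ofReal (Real.exp (p.toReal * q * |X x|)) ∂μ ≤ ENNReal.ofReal C) :
    eLpNorm f p μ
      ≤ (ENNReal.ofReal (A ^ p.toReal) * ENNReal.ofReal C) ^ (1 / p.toReal) := by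
  have hp0 : p ≠ 0 := (zero_lt_one.trans_le hp).ne'
  rw [eLpNorm_eq_lintegral_rpow_enorm_toReal hp0 hp']
  have hpr : 0 < p.toReal := ENNReal.toReal_pos hp0 hp'
  refine ENNReal.rpow_le_rpow (le_trans ?_ (mul_le_mul_right hX _)) (by positivity)
  rw [← lintegral_const_mul' _ _ ENNReal.ofReal_ne_top, ← lintegral_indicator hS]
  refine lintegral_mono fun x => ?_
  by_cases hx : x ∈ S
  · rw [Set.indicator_of_mem hx, ← ENNReal.ofReal_mul (by positivity), ← ofReal_norm,
      ENNReal.ofReal_rpow_of_nonneg (norm_nonneg _) hpr.le]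
    apply ENNReal.ofReal_le_ofReal
    refine (Real.rpow_le_rpow (norm_nonneg _) (hf x hx) hpr.le).trans (le_of_eq ?_)
    rw [Real.mul_rpow hA (Real.exp_pos _).le, ← Real.exp_mul]
    congr 2
    ring
  · rw [Set.indicator_of_notMem hx, hf0 x hx, enorm_zero, ENNReal.zero_rpow_of_pos hpr]

/-! ## Cutoffs -/

lemma IsBump.exists_abs_le {χ : ℝ → ℝ} (h : IsBump χ) : ∃ A : ℝ, 0 ≤ A ∧ ∀ x, |χ x| ≤ A := by
  have hc : HasCompactSupport χ :=
    isCompact_Icc.of_isClosed_subset (isClosed_tsupport χ) (h.support.trans Set.Ioo_subset_Icc_self)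
  obtain ⟨A, hA⟩ := h.smooth.continuous.bounded_above_of_compact_support hc
  exact ⟨A, (norm_nonneg _).trans (hA 0), hA⟩

lemma IsRadialCutoff.exists_abs_le {χ : EuclideanSpace ℝ (Fin 3) → ℝ} (h : IsRadialCutoff χ) :
    ∃ A : ℝ, ∀ x, |χ x| ≤ A := by
  have hc : HasCompactSupport χ := (isCompact_closedBall 0 1).of_isClosed_subset
    (isClosed_tsupport χ) (h.support.trans Metric.ball_subset_closedBall)
  exact h.smooth.continuous.bounded_above_of_compact_support hc

lemma norm_toLp_freq (k : Freq) :
    ‖(WithLp.toLp 2 fun i => (k i : ℝ) : EuclideanSpace ℝ (Fin 3))‖ = freqNorm k := by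
  rw [EuclideanSpace.norm_eq, freqNorm]
  simp

lemma smoothTrunc_eq_zero {χ : EuclideanSpace ℝ (Fin 3) → ℝ} (h : IsRadialCutoff χ) {N : ℕ}
    (hN : 1 ≤ N) {k : Freq} (hk : k ∉ freqBall N) : smoothTrunc χ N k = 0 := by
  refine image_eq_zero_of_notMem_tsupport (f := χ) fun hmem => ?_
  have h1 := h.support hmem
  have hN0 : (0 : ℝ) < N := by exact_mod_cast hN
  rw [mem_ball_zero_iff, norm_smul, norm_inv, Real.norm_of_nonneg hN0.le, norm_toLp_freq,
    inv_mul_lt_iff₀ hN0, mul_one] at h1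
  exact hk (mem_freqBall.2 h1.le)

lemma smoothTrunc_eq_one {χ : EuclideanSpace ℝ (Fin 3) → ℝ} (h : IsRadialCutoff χ) {N : ℕ}
    (hN : 1 ≤ N) {k : Freq} (hk : freqNorm k < (N : ℝ) / 2) : smoothTrunc χ N k = 1 := by
  refine h.eq_one _ fun i => ?_
  have hN0 : (0 : ℝ) < N := by exact_mod_cast hN
  have h1 : |(k i : ℝ)| ≤ freqNorm k := by
    refine Real.abs_le_sqrt ?_
    exact Finset.single_le_sum (f := fun i => (k i : ℝ) ^ 2) (fun _ _ => sq_nonneg _)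
      (Finset.mem_univ i)
  have h2 := abs_le.1 (h1.trans hk.le)
  change (N : ℝ)⁻¹ * (k i : ℝ) ∈ _
  rw [inv_mul_eq_div]
  constructor
  · rw [le_div_iff₀ hN0]; linarith
  · rw [div_le_iff₀ hN0]; linarith

lemma sharpTrunc_eq_zero {M : ℕ} {S : Finset Freq} (hS : freqBall M ⊆ S) {k : Freq}
    (hk : k ∉ S) : sharpTrunc M k = 0 :=
  if_neg fun h => hk (hS (mem_freqBall.2 h))

lemma abs_sharpTrunc_le (M : ℕ) (k : Freq) : |sharpTrunc M k| ≤ 1 := by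
  unfold sharpTrunc
  split_ifs <;> simp

lemma measurable_normCutoff {χ : ℝ → ℝ} (h : IsBump χ) (R σ : ℝ) :
    Measurable (normCutoff χ R σ) := by
  unfold normCutoff
  refine Measurable.ite (measurable_sobolevNorm σ (measurableSet_singleton ∞)) measurable_const ?_
  exact h.smooth.continuous.measurable.comp
    ((measurable_sobolevNorm σ).ennreal_toReal.const_mul _)

lemma normCutoff_eq_zero {χ : ℝ → ℝ} (h : IsBump χ) {R σ : ℝ} (hR : 0 < R) {u : L2Torus}
    (hu : u ∉ sobolevBall σ R) : normCutoff χ R σ u = 0 := by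
  unfold normCutoff
  split_ifs with htop
  · rfl
  refine image_eq_zero_of_notMem_tsupport fun hmem => hu ?_
  have h1 := (h.support hmem).2
  rw [inv_mul_lt_iff₀ hR, mul_one] at h1
  exact (ENNReal.le_ofReal_iff_toReal_le htop hR.le).2 h1.le

lemma abs_normCutoff_le {χ : ℝ → ℝ} {A : ℝ} (hA : 0 ≤ A) (h : ∀ x, |χ x| ≤ A) (R σ : ℝ)
    (u : L2Torus) : |normCutoff χ R σ u| ≤ A := by
  unfold normCutoff
  split_ifs
  · simpa using hA
  · exact h _

/-! ## Convergence of the truncated functionals -/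

/-- All moment bounds are local in `H^σ`; integer balls exhaust almost all of the space because the
Sobolev norm is almost surely finite. -/
lemma ae_of_forall_sobolevBall {s σ : ℝ} (hs : 3 / 2 < s) (hσ : σ < s - 3 / 2) {P : L2Torus → Prop}
    (h : ∀ n : ℕ, ∀ᵐ u ∂(gaussMeasure s).restrict (sobolevBall σ n), P u) :
    ∀ᵐ u ∂gaussMeasure s, P u := by
  have h1 : ∀ n : ℕ, ∀ᵐ u ∂gaussMeasure s, u ∈ sobolevBall σ n → P u := fun n =>
    (ae_restrict_iff' (measurableSet_sobolevBall σ n)).1 (h n)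
  filter_upwards [ae_all_iff.2 h1, ae_sobolevNorm_lt_top hs hσ] with u hu hfin
  obtain ⟨n, hn⟩ := exists_nat_ge (sobolevNorm σ u).toReal
  exact hu n ((ENNReal.le_ofReal_iff_toReal_le hfin.ne n.cast_nonneg).2 hn)

lemma freqBall_mono {M M' : ℝ} (h : M ≤ M') : freqBall M ⊆ freqBall M' := fun _ hk =>
  mem_freqBall.2 ((mem_freqBall.1 hk).trans h)

section

variable {s σ : ℝ} {χ : ℝ → ℝ} {χ₃ : EuclideanSpace ℝ (Fin 3) → ℝ}

/-- The sharply truncated sextic sums converge almost surely. -/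
lemma ae_tendsto_sharp (hs : 10 ≤ s) (hσ : s - 7 / 4 ≤ σ) (hσ' : σ < s - 3 / 2) (hχ : IsBump χ)
    (δ₀ : ℝ) : ∀ᵐ u ∂gaussMeasure s,
      Tendsto (fun M : ℕ => sexticForm χ δ₀ s (sharpTrunc M) u) atTop
        (𝓝 (energyCorr χ δ₀ s u)) := by
  obtain ⟨A, hA0, hA⟩ := hχ.exists_abs_le
  have hA1 : ∀ x, |1 - χ x| ≤ 1 + A := fun x =>
    (abs_sub _ _).trans (add_le_add (by simp) (hA x))
  refine ae_of_forall_sobolevBall (by linarith) hσ' fun r => ?_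
  obtain ⟨C, hC0, hC⟩ := exists_eLpNorm_sexticForm_sub_le (s := s) (σ := σ) (R := r) (B := 1)
    (by linarith) hσ (by linarith) r.cast_nonneg hA1 δ₀
  have hlim := ae_exists_tendsto_of_eLpNorm_le
    (μ := (gaussMeasure s).restrict (sobolevBall σ r))
    -- The shift makes `L = n + 1 ≥ 1` the radius below which all later truncations agree.
    (X := fun n => sexticForm χ δ₀ s (sharpTrunc (n + 1)))
    (fun n => (measurable_sexticForm χ δ₀ s
      (fun k hk => sharpTrunc_eq_zero subset_rfl hk)).aestronglyMeasurable) hC0 ?_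
  · filter_upwards [hlim] with u ⟨l, hl⟩
    exact tendsto_nhds_limUnder ⟨l, (tendsto_add_atTop_iff_nat 1).1 hl⟩
  · intro n n' hn
    have hnn : ((n : ℝ) + 1) ≤ (n' : ℝ) + 1 := by
      have : (n : ℝ) ≤ n' := by exact_mod_cast hn
      linarith
    refine hC ((n : ℝ) + 1) (freqBall ((n' + 1 : ℕ) : ℝ)) (sharpTrunc (n + 1)) (sharpTrunc (n' + 1))
      (by linarith [(n.cast_nonneg : (0 : ℝ) ≤ n)])
      (fun k hk => sharpTrunc_eq_zero (freqBall_mono (by push_cast; exact hnn)) hk)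
      (fun k hk => sharpTrunc_eq_zero subset_rfl hk) (abs_sharpTrunc_le _) (abs_sharpTrunc_le _) ?_
    intro k hk
    rw [sharpTrunc, sharpTrunc, if_pos (by push_cast; exact hk.le),
      if_pos (by push_cast; exact hk.le.trans hnn)]

/-- The smoothly truncated functionals converge almost surely to the full one. -/
lemma ae_tendsto_energyCorrN (hs : 10 ≤ s) (hσ : s - 7 / 4 ≤ σ) (hσ' : σ < s - 3 / 2)
    (hχ : IsBump χ) (hχ₃ : IsRadialCutoff χ₃) (δ₀ : ℝ) : ∀ᵐ u ∂gaussMeasure s,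
      Tendsto (fun N : ℕ => energyCorrN χ₃ χ δ₀ s N u) atTop (𝓝 (energyCorr χ δ₀ s u)) := by
  obtain ⟨A, hA0, hA⟩ := hχ.exists_abs_le
  obtain ⟨B, hB⟩ := hχ₃.exists_abs_le
  have hA1 : ∀ x, |1 - χ x| ≤ 1 + A := fun x =>
    (abs_sub _ _).trans (add_le_add (by simp) (hA x))
  -- The smooth and sharp truncations at `N = n + 2` both equal `1` for `|k| < N/2`; the shift by
  -- two ensures `L = N/2 ≥ 1`.
  have hdiff : ∀ᵐ u ∂gaussMeasure s, Tendsto (fun n : ℕ => energyCorrN χ₃ χ δ₀ s (n + 2) u -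
      sexticForm χ δ₀ s (sharpTrunc (n + 2)) u) atTop (𝓝 0) := by
    refine ae_of_forall_sobolevBall (by linarith) hσ' fun r => ?_
    obtain ⟨C, hC0, hC⟩ := exists_eLpNorm_sexticForm_sub_le (s := s) (σ := σ) (R := r)
      (B := max B 1) (by linarith) hσ (by linarith) r.cast_nonneg hA1 δ₀
    refine ae_tendsto_zero_of_eLpNorm_le (C := C * 2) (fun n => ?_) (by positivity) fun n => ?_
    · exact ((measurable_sexticForm χ δ₀ s fun k hk => smoothTrunc_eq_zero hχ₃ (by omega) hk).sub
        (measurable_sexticForm χ δ₀ s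
          fun k hk => sharpTrunc_eq_zero subset_rfl hk)).aestronglyMeasurable
    · have hn : (0 : ℝ) ≤ n := n.cast_nonneg
      refine (hC (((n : ℝ) + 2) / 2) (freqBall ((n + 2 : ℕ) : ℝ)) (smoothTrunc χ₃ (n + 2))
        (sharpTrunc (n + 2)) (by linarith) (fun k hk => smoothTrunc_eq_zero hχ₃ (by omega) hk)
        (fun k hk => sharpTrunc_eq_zero subset_rfl hk)
        (fun k => (hB _).trans (le_max_left _ _))
        (fun k => (abs_sharpTrunc_le _ k).trans (le_max_right _ _)) fun k hk => ?_).trans ?_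
      · rw [smoothTrunc_eq_one hχ₃ (by omega) (by push_cast; exact hk), sharpTrunc,
          if_pos (by push_cast; linarith)]
      · apply ENNReal.ofReal_le_ofReal
        rw [mul_assoc]
        refine mul_le_mul_of_nonneg_left ?_ hC0
        have h1 : (((n : ℝ) + 2) / 2) ^ (-(1 / 4) : ℝ) ≤ (((n : ℝ) + 1) / 2) ^ (-(1 / 4) : ℝ) :=
          Real.rpow_le_rpow_of_nonpos (by positivity) (by linarith) (by norm_num)
        refine h1.trans ?_
        rw [Real.div_rpow (by positivity) zero_le_two, Real.rpow_neg zero_le_two, div_inv_eq_mul,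
          mul_comm]
        refine mul_le_mul_of_nonneg_right ?_ (by positivity)
        calc (2 : ℝ) ^ (1 / 4 : ℝ) ≤ 2 ^ (1 : ℝ) :=
              Real.rpow_le_rpow_of_exponent_le one_le_two (by norm_num)
          _ = 2 := Real.rpow_one 2
  filter_upwards [hdiff, ae_tendsto_sharp hs hσ hσ' hχ δ₀] with u h1 h2
  have h3 := h1.add ((tendsto_add_atTop_iff_nat 2).2 h2)
  simp only [sub_add_cancel, zero_add] at h3
  exact (tendsto_add_atTop_iff_nat 2).1 h3

lemma measurable_energyCorrN (hχ₃ : IsRadialCutoff χ₃) (δ₀ : ℝ) {N : ℕ} (hN : 1 ≤ N) :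
    Measurable (energyCorrN χ₃ χ δ₀ s N) :=
  measurable_sexticForm χ δ₀ s fun _ hk => smoothTrunc_eq_zero hχ₃ hN hk

/-! ### Uniform `Lᵖ` bounds and conclusion. -/

/-- Functions which are controlled by exponentials of the truncated functionals on balls of `H^σ`
are bounded in `Lᵖ`, uniformly in the truncation. -/
lemma exists_eLpNorm_le_of_exp_energyCorrN (hs : 10 ≤ s) (hσ : s - 7 / 4 ≤ σ) (hχ : IsBump χ)
    (hχ₃ : IsRadialCutoff χ₃) (δ₀ : ℝ) {R A q : ℝ} (hR : 0 < R) (hA : 0 ≤ A) (hq : 0 ≤ q)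
    {p : ℝ≥0∞} (hp : 1 ≤ p) (hp' : p ≠ ∞) :
    ∃ C : ℝ, 0 < C ∧ ∀ N : ℕ, 1 ≤ N → ∀ f : L2Torus → ℝ,
      (∀ u, u ∉ sobolevBall σ R → f u = 0) →
      (∀ u, |f u| ≤ A * Real.exp (q * |energyCorrN χ₃ χ δ₀ s N u|)) →
      eLpNorm f p (gaussMeasure s) ≤ ENNReal.ofReal C := by
  obtain ⟨A', hA'0, hA'⟩ := hχ.exists_abs_le
  obtain ⟨B, hB⟩ := hχ₃.exists_abs_le
  have hA1 : ∀ x, |1 - χ x| ≤ 1 + A' := fun x =>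
    (abs_sub _ _).trans (add_le_add (by simp) (hA' x))
  obtain ⟨C, hC⟩ := exists_lintegral_exp_sexticForm_le (s := s) (σ := σ) (R := R) (B := B)
    (by linarith) hσ (by linarith) hR.le hA1 δ₀ (q := p.toReal * q) (by positivity)
  set D : ℝ≥0∞ := (ENNReal.ofReal (A ^ p.toReal) * ENNReal.ofReal C) ^ (1 / p.toReal) with hD
  have hDtop : D ≠ ∞ := ENNReal.rpow_ne_top_of_nonneg (by positivity)
    (ENNReal.mul_ne_top ENNReal.ofReal_ne_top ENNReal.ofReal_ne_top)
  refine ⟨D.toReal + 1, by positivity, fun N hN f hf0 hf => ?_⟩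
  have h1 := eLpNorm_le_of_exp_le (μ := gaussMeasure s) hp hp' hA (measurableSet_sobolevBall σ R)
    hf0 (fun u _ => hf u) (hC (freqBall N) (smoothTrunc χ₃ N)
      (fun k hk => smoothTrunc_eq_zero hχ₃ hN hk) fun k => hB _)
  refine h1.trans ?_
  rw [← hD, ← ENNReal.ofReal_toReal hDtop]
  exact ENNReal.ofReal_le_ofReal (by rw [ENNReal.toReal_ofReal ENNReal.toReal_nonneg]; linarith)

end

end NLSTorus

end

open NLSTorus in
theorem proposition2p1 (s : ℝ) (hs : 10 ≤ s) :
    ∃ σ₀ : ℝ, σ₀ < s - 3 / 2 ∧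
      ∀ σ : ℝ, σ₀ < σ → σ < s - 3 / 2 →
      ∀ χ₃ : EuclideanSpace ℝ (Fin 3) → ℝ, IsRadialCutoff χ₃ →
      ∀ χ : ℝ → ℝ, IsBump χ →
      ∀ δ₀ : ℝ, 0 < δ₀ → δ₀ < 2 / 3 →
        -- the series defining `R_s(u)` converges for almost every `u`
        (∀ᵐ u ∂(gaussMeasure s),
          Tendsto (fun M : ℕ => sexticForm χ δ₀ s (sharpTrunc M) u) atTop
            (𝓝 (energyCorr χ δ₀ s u))) ∧
        -- uniform bound
        (∀ R : ℝ, 1 ≤ R → ∀ p : ℝ≥0∞, 1 ≤ p → p ≠ ⊤ →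
          ∃ C : ℝ, 0 < C ∧ ∀ N : ℕ, 1 ≤ N →
            MemLp (fun u => normCutoff χ R σ u * Real.exp |energyCorrN χ₃ χ δ₀ s N u|) p
              (gaussMeasure s) ∧
            eLpNorm (fun u => normCutoff χ R σ u * Real.exp |energyCorrN χ₃ χ δ₀ s N u|) p
              (gaussMeasure s) ≤ ENNReal.ofReal C) ∧
        -- convergence
        (∀ R : ℝ, 0 < R → ∀ p : ℝ≥0∞, 1 ≤ p → p ≠ ⊤ →
          (∀ N : ℕ, 1 ≤ N →
            MemLp (fun u => normCutoff χ R σ u * Real.exp (-energyCorrN χ₃ χ δ₀ s N u)) p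
              (gaussMeasure s)) ∧
          MemLp (fun u => normCutoff χ R σ u * Real.exp (-energyCorr χ δ₀ s u)) p
            (gaussMeasure s) ∧
          Tendsto (fun N : ℕ => eLpNorm (fun u =>
              normCutoff χ R σ u * Real.exp (-energyCorrN χ₃ χ δ₀ s N u) -
                normCutoff χ R σ u * Real.exp (-energyCorr χ δ₀ s u)) p (gaussMeasure s))
            atTop (𝓝 0)) := by
  -- The regularity required by the diagonal terms. With `s ≥ 10` it also gives `σ ≥ 33/4`, more
  -- than the `15/2` needed for the low frequencies.
  refine ⟨s - 7 / 4, by linarith, ?_⟩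
  intro σ hσ hσ' χ₃ hχ₃ χ hχ δ₀ _ _
  have hprob := isProbabilityMeasure_gaussMeasure (s := s) (by linarith)
  obtain ⟨A, hA0, hA⟩ := hχ.exists_abs_le
  have hcut : ∀ R u, |normCutoff χ R σ u| ≤ A := fun R u => abs_normCutoff_le hA0 hA R σ u
  have hmeas : ∀ N : ℕ, 1 ≤ N → Measurable (energyCorrN χ₃ χ δ₀ s N) := fun N hN =>
    measurable_energyCorrN hχ₃ δ₀ hN
  refine ⟨ae_tendsto_sharp hs hσ.le hσ' hχ δ₀, fun R hR p hp hp' => ?_, fun R hR p hp hp' => ?_⟩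
  · have hR0 : 0 < R := by linarith
    obtain ⟨C, hC0, hC⟩ := exists_eLpNorm_le_of_exp_energyCorrN hs hσ.le hχ hχ₃ δ₀ hR0 hA0
      zero_le_one hp hp'
    refine ⟨C, hC0, fun N hN => ?_⟩
    have h1 := hC N hN (fun u => normCutoff χ R σ u * Real.exp |energyCorrN χ₃ χ δ₀ s N u|)
      (fun u hu => by rw [normCutoff_eq_zero hχ hR0 hu, zero_mul])
      (fun u => by
        rw [abs_mul, Real.abs_exp, one_mul]
        exact mul_le_mul_of_nonneg_right (hcut R u) (Real.exp_pos _).le)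
    exact ⟨⟨((measurable_normCutoff hχ R σ).mul
      (Real.measurable_exp.comp (hmeas N hN).abs)).aestronglyMeasurable,
      h1.trans_lt ENNReal.ofReal_lt_top⟩, h1⟩
  · obtain ⟨C, -, hC⟩ := exists_eLpNorm_le_of_exp_energyCorrN hs hσ.le hχ hχ₃ δ₀ hR hA0
      zero_le_one hp hp'
    -- A uniform bound on the squares, with amplitude `A²` and exponent `2`, supplies the uniform
    -- integrability behind the `Lᵖ` convergence.
    obtain ⟨C₂, hC₂0, hC₂⟩ := exists_eLpNorm_le_of_exp_energyCorrN hs hσ.le hχ hχ₃ δ₀ hR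
      (sq_nonneg A) zero_le_two hp hp'
    have hbd : ∀ N u, |normCutoff χ R σ u * Real.exp (-energyCorrN χ₃ χ δ₀ s N u)|
        ≤ A * Real.exp |energyCorrN χ₃ χ δ₀ s N u| := fun N u => by
      rw [abs_mul, Real.abs_exp]
      exact mul_le_mul (hcut R u) (Real.exp_le_exp.2 (neg_le_abs _)) (Real.exp_pos _).le hA0
    have hfm : ∀ N : ℕ, 1 ≤ N → AEStronglyMeasurable
        (fun u => normCutoff χ R σ u * Real.exp (-energyCorrN χ₃ χ δ₀ s N u)) (gaussMeasure s) :=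
      fun N hN => ((measurable_normCutoff hχ R σ).mul
        (Real.measurable_exp.comp (hmeas N hN).neg)).aestronglyMeasurable
    have hsq : ∀ N : ℕ, 1 ≤ N → eLpNorm (fun u =>
        (normCutoff χ R σ u * Real.exp (-energyCorrN χ₃ χ δ₀ s N u)) ^ 2) p (gaussMeasure s)
        ≤ ENNReal.ofReal C₂ := fun N hN =>
      hC₂ N hN _ (fun u hu => by rw [normCutoff_eq_zero hχ hR hu, zero_mul]; norm_num)
        (fun u => by
          rw [abs_pow]
          refine (pow_le_pow_left₀ (abs_nonneg _) (hbd N u) 2).trans (le_of_eq ?_)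
          rw [mul_pow, ← Real.exp_nat_mul]
          norm_num)
    have hlim : ∀ᵐ u ∂gaussMeasure s, Tendsto (fun n : ℕ =>
        normCutoff χ R σ u * Real.exp (-energyCorrN χ₃ χ δ₀ s (n + 1) u)) atTop
        (𝓝 (normCutoff χ R σ u * Real.exp (-energyCorr χ δ₀ s u))) := by
      filter_upwards [ae_tendsto_energyCorrN hs hσ.le hσ' hχ hχ₃ δ₀] with u hu
      exact (((Real.continuous_exp.tendsto _).comp
        ((tendsto_add_atTop_iff_nat 1).2 hu).neg)).const_mul _
    -- The sequence starts at `N = 1`, since measurability and the bounds are available for `N ≥ 1`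
    -- only.
    obtain ⟨hmem, htend⟩ := tendsto_eLpNorm_sub_of_sq_le hp hp'
      (fun n => hfm (n + 1) (by omega)) hC₂0.le (fun n => hsq (n + 1) (by omega)) hlim
    refine ⟨fun N hN => ⟨hfm N hN, ?_⟩, hmem, (tendsto_add_atTop_iff_nat 1).1 htend⟩
    refine (hC N hN _ (fun u hu => by rw [normCutoff_eq_zero hχ hR hu, zero_mul])
      (fun u => by rw [one_mul]; exact hbd N u)).trans_lt ENNReal.ofReal_lt_top
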